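/- Let $\mathbb F$ be a field, of any characteristic. **Conventions.** A symmetric sequence $M$ is a family of $\mathbb F$-linear representations $M(n)$ of the symmetric groups $\Sigma_n$, $n\ge 0$; it is reduced if $M(0)=0$. For symmetric sequences $M,N$ put $$M\circ N=\bigoplus_{k\ge 0}\bigl(M(k)\otimes N^{\otimes k}\bigr)_{\Sigma_k},\qquad M\,\tilde\circ\,N=\bigoplus_{k\ge 0}\bigl(M(k)\otimes N^{\otimes k}\bigr)^{\Sigma_k},$$ where $N^{\otimes k}$ is the $k$-th tensor power for the (Day convolution) tensor product of symmetric sequences, and let $Tr_{M,N}:M\circ N\to M\,\tilde\circ\,N$ be the trace (norm) map $[x]\mapsto\sum_{\sigma\in\Sigma_k}\sigma x$. For a vector space $V$ let $\Gamma(M,V)=M\,\tilde\circ\,V=\bigoplus_n (M(n)\otimes V^{\otimes n})^{\Sigma_n}$, and let $\mathfrak a_{M,N,V}:M\,\tilde\circ\,(N\,\tilde\circ\,V)\to(M\,\tilde\circ\,N)\,\tilde\circ\,V$ be the associator. An operad is a monoid $(\mathcal P,\mu_{\mathcal P},\eta_{\mathcal P})$ for $\circ$. For a reduced operad $\mathcal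 P$, $\Gamma(\mathcal P)$ is the endofunctor $V\mapsto\Gamma(\mathcal P,V)$ of vector spaces with unit $v\mapsto 1\otimes v$ and multiplication $$\mathcal P\tilde\circ(\mathcal P\tilde\circ V)\xrightarrow{\mathfrak a}(\mathcal P\tilde\circ\mathcal P)\tilde\circ V\xrightarrow{Tr^{-1}\tilde\circ V}(\mathcal P\circ\mathcal P)\tilde\circ V\xrightarrow{\mu_{\mathcal P}\tilde\circ V}\mathcal P\tilde\circ V ;$$ a divided power $\mathcal P$-algebra is an algebra over this monad. An operadic distributive law is a morphism of symmetric sequences $\Lambda:\mathcal Q\circ\mathcal P\to\mathcal P\circ\mathcal Q$ such that, up to the associators of $\circ$, $$\Lambda(\mathcal Q\circ\mu_{\mathcal P})=(\mu_{\mathcal P}\circ\mathcal Q)(\mathcal P\circ\Lambda)(\Lambda\circ\mathcal P),\qquad \Lambda(\mu_{\mathcal Q}\circ\mathcal P)=(\mathcal P\circ\mu_{\mathcal Q})(\Lambda\circ\mathcal Q)(\mathcal Q\circ\Lambda),$$ $$\Lambda(\mathcal Q\circ\eta_{\mathcal P})=\eta_{\mathcal P}\circ\mathcal Q,\qquad \Lambda(\eta_{\mathcal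 Q}\circ\mathcal P)=\mathcal P\circ\eta_{\mathcal Q}.$$ A distributive law of monads $TS\Rightarrow ST$ is a natural transformation satisfying the same four identities with composition of functors in place of $\circ$; it makes $ST$ a monad, with unit $\eta_S\eta_T$ and multiplication $(\mu_S\mu_T)(S\,\cdot\,T)$, the middle $TS$ being exchanged by the law. **Proposition.** Let $\mathcal P,\mathcal Q$ be reduced operads over $\mathbb F$ and $\Lambda:\mathcal Q\circ\mathcal P\to\mathcal P\circ\mathcal Q$ an operadic distributive law. 1. For reduced symmetric sequences the associators of $\circ$, the trace maps $Tr_{M,N}$ and the associators $\mathfrak a_{M,N,V}$ are isomorphisms. The symmetric sequence $\mathcal P\circ\mathcal Q$, with unit $\eta_{\mathcal P}\circ\eta_{\mathcal Q}$ and multiplication $(\mu_{\mathcal P}\circ\mu_{\mathcal Q})(\mathcal P\circ\Lambda\circ\mathcal Q)$, is a reduced operad, and $\Gamma(\mathcal P)$, $\Gamma(\mathcal Q)$, $\Gamma(\mathcal P\circ\mathcal Q)$ are monads. 2. The composite $\tilde\Lambda_V$ of the maps $$\mathcal Q\tilde\circ(\mathcal P\tilde\circ V)\to\mathcal P\tilde\circ(\mathcal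 Q\tilde\circ(\mathcal P\tilde\circ(\mathcal Q\tilde\circ V)))\to((\mathcal P\tilde\circ\mathcal Q)\tilde\circ(\mathcal P\tilde\circ\mathcal Q))\tilde\circ V\to((\mathcal P\circ\mathcal Q)\tilde\circ(\mathcal P\circ\mathcal Q))\tilde\circ V$$ $$\to((\mathcal P\circ\mathcal Q)\circ(\mathcal P\circ\mathcal Q))\tilde\circ V\to(\mathcal P\circ\mathcal Q)\tilde\circ V\to(\mathcal P\tilde\circ\mathcal Q)\tilde\circ V\to\mathcal P\tilde\circ(\mathcal Q\tilde\circ V)$$ given successively by the units of $\mathcal P$ and $\mathcal Q$, three associators, $(Tr_{\mathcal P,\mathcal Q}^{-1}\tilde\circ Tr_{\mathcal P,\mathcal Q}^{-1})\tilde\circ V$, $Tr^{-1}_{\mathcal P\circ\mathcal Q,\mathcal P\circ\mathcal Q}\tilde\circ V$, the multiplication of the operad $\mathcal P\circ\mathcal Q$, $Tr_{\mathcal P,\mathcal Q}\tilde\circ V$ and $\mathfrak a_{\mathcal P,\mathcal Q,V}^{-1}$, is a distributive law of monads $\tilde\Lambda:\Gamma(\mathcal Q)\Gamma(\mathcal P)\Rightarrow\Gamma(\mathcal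 P)\Gamma(\mathcal Q)$. 3. The maps $\Theta_V=\mathfrak a_{\mathcal P,\mathcal Q,V}^{-1}\,(Tr_{\mathcal P,\mathcal Q}\tilde\circ V):\Gamma(\mathcal P\circ\mathcal Q,V)\to\Gamma(\mathcal P,\Gamma(\mathcal Q,V))$ form an isomorphism of monads from $\Gamma(\mathcal P\circ\mathcal Q)$ to the monad $\Gamma(\mathcal P)\Gamma(\mathcal Q)$ defined by $\tilde\Lambda$. 4. A divided power $\mathcal P\circ\mathcal Q$-algebra is a vector space with a $\Gamma(\mathcal P)$-algebra and a $\Gamma(\mathcal Q)$-algebra structure which satisfy the compatibility relation given by $\tilde\Lambda$. Precisely, for every vector space $A$ there is a bijection from the $\Gamma(\mathcal P\circ\mathcal Q)$-algebra structures $c$ on $A$ to the pairs $(a,b)$ of a $\Gamma(\mathcal P)$-algebra structure $a$ and a $\Gamma(\mathcal Q)$-algebra structure $b$ on $A$ such that $$b\circ\Gamma(\mathcal Q,a)=a\circ\Gamma(\mathcal P,b)\circ\tilde\Lambda_A:\ \Gamma(\mathcal Q,\Gamma(\mathcal P,A))\to A .$$ It is given by $a=c\,\Theta_A^{-1}\,\Gamma(\mathcal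 P,\eta)$ and $b=c\,\Theta_A^{-1}\,\eta$, where $\eta$ denotes the unit $A\to\Gamma(\mathcal Q,A)$ in the first formula and the unit $\Gamma(\mathcal Q,A)\to\Gamma(\mathcal P,\Gamma(\mathcal Q,A))$ in the second; its inverse is $c=a\,\Gamma(\mathcal P,b)\,\Theta_A$. A linear map between divided power $\mathcal P\circ\mathcal Q$-algebras is a morphism of such algebras if and only if it is a morphism of both $\Gamma(\mathcal P)$-algebras and $\Gamma(\mathcal Q)$-algebras for the corresponding structures. -/

import Mathlib

open TensorProduct DirectSum CategoryTheory

universe u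

noncomputable section

namespace DivPow

/-- A symmetric sequence of `F`-vector spaces, as a functor from finite sets and bijections to
vector spaces. The arity `n` component is `M(n) = M.obj (Fin n)`, with `Σ_n = Equiv.Perm (Fin n)`
acting on it through `M.map`; the value on a finite set `S` with `n` elements is the usual
relabelling of `M(n)` by the bijections between `{1, …, n}` and `S`. -/
structure SymSeq (F : Type u) [Field F] where
  obj : (S : Type) → [Finite S] → ModuleCat.{u} F
  map : {S T : Type} → [Finite S] → [Finite T] → (S ≃ T) → (obj S →ₗ[F] obj T)
  map_refl : ∀ (S : Type) [Finite S] (x : obj S), map (Equiv.refl S) x = x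
  map_trans : ∀ {S T R : Type} [Finite S] [Finite T] [Finite R] (d : S ≃ T) (e : T ≃ R)
    (x : obj S), map (d.trans e) x = map e (map d x)

namespace SymSeq

variable {F : Type u} [Field F]

/-- `M` is reduced if `M(0) = 0`. -/
def IsReduced (M : SymSeq F) : Prop := ∀ (S : Type) [Finite S], IsEmpty S → Subsingleton (M.obj S)

/-- Morphisms of symmetric sequences. -/
@[ext]
structure Hom (M N : SymSeq F) where
  app : (S : Type) → [Finite S] → (M.obj S →ₗ[F] N.obj S)
  naturality : ∀ {S T : Type} [Finite S] [Finite T] (d : S ≃ T) (x : M.obj S),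
    app T (M.map d x) = N.map d (app S x)

def Hom.id (M : SymSeq F) : Hom M M := ⟨fun _ _ => LinearMap.id, fun _ _ => rfl⟩

def Hom.comp {M N L : SymSeq F} (ψ : Hom N L) (φ : Hom M N) : Hom M L :=
  ⟨fun S _ => ψ.app S ∘ₗ φ.app S, fun d x => by simp [φ.naturality, ψ.naturality]⟩

/-- The fibre of `f` over `k`. -/
abbrev Fib {S K : Type} (f : S → K) (k : K) : Type := {s : S // f s = k}

/-- The bijection of fibres induced by a commutative square of bijections. -/
def fibEquiv {S T K J : Type} (d : S ≃ T) (e : K ≃ J) {f : S → K} {g : T → J}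
    (h : ∀ s, g (d s) = e (f s)) (j : J) : Fib f (e.symm j) ≃ Fib g j :=
  d.subtypeEquiv fun s => by rw [h, Equiv.eq_symm_apply]

/-- `⨂_{k ∈ K} N(f⁻¹(k))`. -/
abbrev FibTensor (N : SymSeq F) {S K : Type} [Finite S] (f : S → K) : Type u :=
  PiTensorProduct F fun k : K => N.obj (Fib f k)

/-- The relabelling `⨂_k N(f⁻¹(k)) → ⨂_j N(g⁻¹(j))` along bijections `d`, `e` with
`g ∘ d = e ∘ f`; it permutes the tensor factors by `e` and applies `N` to bijections of fibres. -/
def fibMap (N : SymSeq F) {S T K J : Type} [Finite S] [Finite T] (d : S ≃ T) (e : K ≃ J)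
    {f : S → K} {g : T → J} (h : ∀ s, g (d s) = e (f s)) :
    FibTensor N f →ₗ[F] FibTensor N g :=
  PiTensorProduct.map (fun j => N.map (fibEquiv d e h j)) ∘ₗ
    (PiTensorProduct.reindex F (fun k => N.obj (Fib f k)) e).toLinearMap

theorem fibMap_tprod (N : SymSeq F) {S T K J : Type} [Finite S] [Finite T] (d : S ≃ T) (e : K ≃ J)
    {f : S → K} {g : T → J} (h : ∀ s, g (d s) = e (f s)) (n : ∀ k, N.obj (Fib f k)) :
    fibMap N d e h (PiTensorProduct.tprod F n) =
      PiTensorProduct.tprod F fun j => N.map (fibEquiv d e h j) (n (e.symm j)) := by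
  simp [fibMap]

theorem tensor_ext {K : Type} {X : K → Type u} [∀ k, AddCommGroup (X k)] [∀ k, Module F (X k)]
    {W : Type u} [AddCommGroup W] [Module F W] {φ ψ : PiTensorProduct F X →ₗ[F] W}
    (h : ∀ n, φ (PiTensorProduct.tprod F n) = ψ (PiTensorProduct.tprod F n)) : φ = ψ :=
  PiTensorProduct.ext (MultilinearMap.ext h)

theorem fibMap_refl (N : SymSeq F) {S K : Type} [Finite S] (f : S → K)
    (h : ∀ s, f (Equiv.refl S s) = Equiv.refl K (f s)) :
    fibMap N (Equiv.refl S) (Equiv.refl K) h = LinearMap.id := by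
  refine tensor_ext fun n => ?_
  rw [fibMap_tprod, LinearMap.id_apply]
  congr 1; funext k
  exact N.map_refl _ _

theorem fibMap_trans (N : SymSeq F) {S T R K J I : Type} [Finite S] [Finite T] [Finite R]
    (d : S ≃ T) (d' : T ≃ R) (e : K ≃ J) (e' : J ≃ I)
    {f : S → K} {g : T → J} {q : R → I} (h : ∀ s, g (d s) = e (f s)) (h' : ∀ s, q (d' s) = e' (g s))
    (h'' : ∀ s, q (d.trans d' s) = e.trans e' (f s)) :
    fibMap N (d.trans d') (e.trans e') h'' = fibMap N d' e' h' ∘ₗ fibMap N d e h := by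
  refine tensor_ext fun n => ?_
  rw [LinearMap.comp_apply, fibMap_tprod, fibMap_tprod, fibMap_tprod]
  congr 1; funext k
  exact N.map_trans (fibEquiv d e h (e'.symm k)) (fibEquiv d' e' h' k) _

open scoped Classical in
/-- The tensor power `N^{⊠ K}(S) = ⨁_{f : S → K} ⨂_{k ∈ K} N(f⁻¹(k))`. For `K = {1, …, k}` and
`S = {1, …, n}`, the maps `f` with fibres of sizes `n₁, …, n_k` contribute the representation of
`Σ_n` induced from `N(n₁) ⊗ ⋯ ⊗ N(n_k)` on `Σ_{n₁} × ⋯ × Σ_{n_k}`. -/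
abbrev Pow (N : SymSeq F) (S K : Type) [Finite S] : Type u := ⨁ f : S → K, FibTensor N f

open scoped Classical in
/-- Relabelling of `N^{⊠ K}(S)` along bijections of `S` and of `K`. -/
def powMap (N : SymSeq F) {S T K J : Type} [Finite S] [Finite T] (d : S ≃ T) (e : K ≃ J) :
    Pow N S K →ₗ[F] Pow N T J :=
  DirectSum.toModule F _ _ fun f =>
    DirectSum.lof F (T → J) (fun g => FibTensor N g) (fun t => e (f (d.symm t))) ∘ₗ
      fibMap N d e (fun s => by simp)


open scoped Classical in
theorem powMap_lof (N : SymSeq F) {S T K J : Type} [Finite S] [Finite T] (d : S ≃ T) (e : K ≃ J)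
    (f : S → K) (g : T → J) (h : ∀ s, g (d s) = e (f s)) (x : FibTensor N f) :
    powMap N d e (DirectSum.lof F _ _ f x) = DirectSum.lof F _ _ g (fibMap N d e h x) := by
  obtain rfl : g = fun t => e (f (d.symm t)) := by
    funext t; simpa using h (d.symm t)
  simp [powMap]

theorem powMap_refl (N : SymSeq F) (S K : Type) [Finite S] :
    powMap N (Equiv.refl S) (Equiv.refl K) = LinearMap.id := by
  classical
  refine DirectSum.linearMap_ext F fun f => LinearMap.ext fun x => ?_
  have h : ∀ s, f (Equiv.refl S s) = Equiv.refl K (f s) := fun _ => rfl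
  rw [LinearMap.comp_apply, powMap_lof N _ _ f f h, fibMap_refl]; rfl

theorem powMap_trans (N : SymSeq F) {S T R K J I : Type} [Finite S] [Finite T] [Finite R]
    (d : S ≃ T) (d' : T ≃ R) (e : K ≃ J) (e' : J ≃ I) :
    powMap N (d.trans d') (e.trans e') = powMap N d' e' ∘ₗ powMap N d e := by
  classical
  refine DirectSum.linearMap_ext F fun f => LinearMap.ext fun x => ?_
  obtain ⟨g, h⟩ : ∃ g : T → J, ∀ s, g (d s) = e (f s) := ⟨fun t => e (f (d.symm t)), by simp⟩
  obtain ⟨q, h'⟩ : ∃ q : R → I, ∀ t, q (d' t) = e' (g t) := ⟨fun r => e' (g (d'.symm r)), by simp⟩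
  have h'' : ∀ s, q (d.trans d' s) = e.trans e' (f s) := by simp [h, h']
  rw [LinearMap.comp_apply, LinearMap.comp_apply, LinearMap.comp_apply,
    powMap_lof N d e f _ h, powMap_lof N d' e' _ _ h', powMap_lof N _ _ f _ h'',
    fibMap_trans N d d' e e' h h' h'']
  rfl

/-- `M(K) ⊗ N^{⊠ K}(S)` -/
abbrev Pre (M N : SymSeq F) (S K : Type) [Finite S] [Finite K] : Type u := M.obj K ⊗[F] Pow N S K

/-- Relabelling of `M(K) ⊗ N^{⊠ K}(S)` along bijections of `S` and of `K`. -/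
def preMap (M N : SymSeq F) {S T K J : Type} [Finite S] [Finite T] [Finite K] [Finite J]
    (d : S ≃ T) (e : K ≃ J) : Pre M N S K →ₗ[F] Pre M N T J :=
  TensorProduct.map (M.map e) (powMap N d e)

theorem preMap_refl (M N : SymSeq F) (S K : Type) [Finite S] [Finite K] :
    preMap M N (Equiv.refl S) (Equiv.refl K) = LinearMap.id := by
  have : M.map (Equiv.refl K) = LinearMap.id := LinearMap.ext (M.map_refl K)
  rw [preMap, powMap_refl, this, TensorProduct.map_id]

theorem preMap_trans (M N : SymSeq F) {S T R K J I : Type} [Finite S] [Finite T] [Finite R]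
    [Finite K] [Finite J] [Finite I]
    (d : S ≃ T) (d' : T ≃ R) (e : K ≃ J) (e' : J ≃ I) :
    preMap M N (d.trans d') (e.trans e') = preMap M N d' e' ∘ₗ preMap M N d e := by
  have : M.map (e.trans e') = M.map e' ∘ₗ M.map e := LinearMap.ext (M.map_trans e e')
  rw [preMap, powMap_trans, this, TensorProduct.map_comp]; rfl

/-- The diagonal action of `Perm K` on `M(K) ⊗ N^{⊠ K}(S)`. -/
def preRep (M N : SymSeq F) (S K : Type) [Finite S] [Finite K] :
    Representation F (Equiv.Perm K) (Pre M N S K) where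
  toFun σ := preMap M N (Equiv.refl S) σ
  map_one' := preMap_refl M N S K
  map_mul' σ τ := preMap_trans M N (Equiv.refl S) (Equiv.refl S) τ σ

theorem preMap_preRep (M N : SymSeq F) {S T K : Type} [Finite S] [Finite T] [Finite K]
    (d : S ≃ T) (σ : Equiv.Perm K) (x : Pre M N S K) :
    preMap M N d (Equiv.refl K) (preRep M N S K σ x) =
      preRep M N T K σ (preMap M N d (Equiv.refl K) x) := by
  have h₁ := preMap_trans M N (Equiv.refl S) d σ (Equiv.refl K)
  have h₂ := preMap_trans M N d (Equiv.refl T) (Equiv.refl K) σ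
  exact (LinearMap.congr_fun h₁ x).symm.trans (LinearMap.congr_fun h₂ x)

/-- Relabelling of the coinvariants along a bijection of `S`. -/
def preCoinvMap (M N : SymSeq F) {S T : Type} [Finite S] [Finite T] (K : Type) [Finite K]
    (d : S ≃ T) : (preRep M N S K).Coinvariants →ₗ[F] (preRep M N T K).Coinvariants :=
  Representation.Coinvariants.lift _
    (Representation.Coinvariants.mk _ ∘ₗ preMap M N d (Equiv.refl K)) fun σ => by
      refine LinearMap.ext fun x => ?_
      simp only [LinearMap.comp_apply, preMap_preRep, Representation.Coinvariants.mk_self_apply]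

/-- Relabelling of the invariants along a bijection of `S`. -/
def preInvMap (M N : SymSeq F) {S T : Type} [Finite S] [Finite T] (K : Type) [Finite K]
    (d : S ≃ T) : (preRep M N S K).invariants →ₗ[F] (preRep M N T K).invariants :=
  (preMap M N d (Equiv.refl K)).restrict fun x hx σ => by
    rw [← preMap_preRep, hx σ]

theorem coe_preInvMap (M N : SymSeq F) {S T : Type} [Finite S] [Finite T] (K : Type) [Finite K]
    (d : S ≃ T) (x : (preRep M N S K).invariants) :
    (preInvMap M N K d x : Pre M N T K) = preMap M N d (Equiv.refl K) x := rfl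

/-- The composition product `M ∘ N = ⨁_k (M(k) ⊗ N^{⊠ k})_{Σ_k}`. -/
def comp (M N : SymSeq F) : SymSeq F where
  obj S _ := ModuleCat.of F (⨁ k : ℕ, (preRep M N S (Fin k)).Coinvariants)
  map d := DirectSum.lmap fun k => preCoinvMap M N (Fin k) d
  map_refl S _ x := by
    have : ∀ k, preCoinvMap M N (Fin k) (Equiv.refl S) = LinearMap.id := fun k => by
      refine Representation.Coinvariants.hom_ext (LinearMap.ext fun y => ?_)
      simp [preCoinvMap, preMap_refl]
    simp [this]
  map_trans {S T R} _ _ _ d e x := by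
    have : ∀ k, preCoinvMap M N (Fin k) (d.trans e) =
        preCoinvMap M N (Fin k) e ∘ₗ preCoinvMap M N (Fin k) d := fun k => by
      refine Representation.Coinvariants.hom_ext (LinearMap.ext fun y => ?_)
      have := LinearMap.congr_fun (preMap_trans M N d e (Equiv.refl (Fin k)) (Equiv.refl (Fin k))) y
      simp only [LinearMap.comp_apply] at this
      simp [preCoinvMap, ← this]
    simp [this, DirectSum.lmap_comp]

/-- The product `M ∘̃ N = ⨁_k (M(k) ⊗ N^{⊠ k})^{Σ_k}`. -/
def dcomp (M N : SymSeq F) : SymSeq F where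
  obj S _ := ModuleCat.of F (⨁ k : ℕ, (preRep M N S (Fin k)).invariants)
  map d := DirectSum.lmap fun k => preInvMap M N (Fin k) d
  map_refl S _ x := by
    have : ∀ k, preInvMap M N (Fin k) (Equiv.refl S) = LinearMap.id := fun k => by
      refine LinearMap.ext fun y => Subtype.ext ?_
      simp [coe_preInvMap, preMap_refl]
    simp [this]
  map_trans {S T R} _ _ _ d e x := by
    have : ∀ k, preInvMap M N (Fin k) (d.trans e) =
        preInvMap M N (Fin k) e ∘ₗ preInvMap M N (Fin k) d := fun k => by
      refine LinearMap.ext fun y => Subtype.ext ?_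
      have := LinearMap.congr_fun
        (preMap_trans M N d e (Equiv.refl (Fin k)) (Equiv.refl (Fin k))) y.1
      simpa [coe_preInvMap] using this
    simp [this, DirectSum.lmap_comp]

/-- The norm map `[x] ↦ ∑_σ σ x` from coinvariants to invariants. -/
def preNorm (M N : SymSeq F) (S K : Type) [Finite S] [Fintype K] [DecidableEq K] :
    (preRep M N S K).Coinvariants →ₗ[F] (preRep M N S K).invariants :=
  Representation.Coinvariants.lift _
    ((Representation.norm (preRep M N S K)).codRestrict _ fun x σ => by simp) fun σ =>
      LinearMap.ext fun x => Subtype.ext (by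
        change (preRep M N S K).norm ((preRep M N S K) σ x) = (preRep M N S K).norm x
        simp)

theorem coe_preNorm_mk (M N : SymSeq F) (S K : Type) [Finite S] [Fintype K] [DecidableEq K]
    (x : Pre M N S K) :
    (preNorm M N S K (Representation.Coinvariants.mk _ x) : Pre M N S K) =
      ∑ σ, preRep M N S K σ x := by
  change (preRep M N S K).norm x = _
  simp [Representation.norm]

/-- The trace (norm) map `Tr : M ∘ N → M ∘̃ N`. -/
def trace (M N : SymSeq F) : Hom (comp M N) (dcomp M N) where
  app S _ := DirectSum.lmap fun k => preNorm M N S (Fin k)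
  naturality d x := by
    refine LinearMap.congr_fun (f := DirectSum.lmap _ ∘ₗ DirectSum.lmap _)
      (g := DirectSum.lmap _ ∘ₗ DirectSum.lmap _) ?_ x
    rw [← DirectSum.lmap_comp, ← DirectSum.lmap_comp]
    congr 1; funext k
    refine Representation.Coinvariants.hom_ext (LinearMap.ext fun y => Subtype.ext ?_)
    simp [preCoinvMap, coe_preInvMap, coe_preNorm_mk, preMap_preRep]

/-- The map `M(K) ⊗ N^{⊠ K}(S) → M'(K) ⊗ N'^{⊠ K}(S)` induced by morphisms `φ`, `ψ`. -/
def prePair {M M' N N' : SymSeq F} (φ : Hom M M') (ψ : Hom N N') (S K : Type) [Finite S]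
    [Finite K] : Pre M N S K →ₗ[F] Pre M' N' S K :=
  TensorProduct.map (φ.app K)
    (DirectSum.lmap fun f => PiTensorProduct.map fun k => ψ.app (Fib f k))

theorem prePair_preMap {M M' N N' : SymSeq F} (φ : Hom M M') (ψ : Hom N N') {S T K J : Type}
    [Finite S] [Finite T] [Finite K] [Finite J] (d : S ≃ T) (e : K ≃ J) (x : Pre M N S K) :
    prePair φ ψ T J (preMap M N d e x) = preMap M' N' d e (prePair φ ψ S K x) := by
  classical
  have h₁ : φ.app J ∘ₗ M.map e = M'.map e ∘ₗ φ.app K := LinearMap.ext (φ.naturality e)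
  have h₂ : (DirectSum.lmap fun g : T → J => PiTensorProduct.map fun k => ψ.app (Fib g k)) ∘ₗ
      powMap N d e = powMap N' d e ∘ₗ
        (DirectSum.lmap fun f : S → K => PiTensorProduct.map fun k => ψ.app (Fib f k)) := by
    refine DirectSum.linearMap_ext F fun f => tensor_ext fun n => ?_
    obtain ⟨g, h⟩ : ∃ g : T → J, ∀ s, g (d s) = e (f s) := ⟨fun t => e (f (d.symm t)), by simp⟩
    simp only [LinearMap.comp_apply, powMap_lof _ d e f g h, DirectSum.lmap_lof,
      PiTensorProduct.map_tprod, fibMap_tprod, ψ.naturality]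
  refine LinearMap.congr_fun (f := prePair φ ψ T J ∘ₗ preMap M N d e)
    (g := preMap M' N' d e ∘ₗ prePair φ ψ S K) ?_ x
  rw [prePair, preMap, ← TensorProduct.map_comp, h₁, h₂, TensorProduct.map_comp]
  rfl

/-- The morphism `φ ∘ ψ : M ∘ N → M' ∘ N'` induced by `φ` and `ψ`. -/
def compMap {M M' N N' : SymSeq F} (φ : Hom M M') (ψ : Hom N N') :
    Hom (comp M N) (comp M' N') where
  app S _ := DirectSum.lmap fun k => Representation.Coinvariants.lift _
    (Representation.Coinvariants.mk _ ∘ₗ prePair φ ψ S (Fin k)) fun σ => by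
      refine LinearMap.ext fun x => ?_
      have : prePair φ ψ S (Fin k) (preRep M N S (Fin k) σ x) =
        preRep M' N' S (Fin k) σ (prePair φ ψ S (Fin k) x) := prePair_preMap φ ψ _ _ x
      simp only [LinearMap.comp_apply, this, Representation.Coinvariants.mk_self_apply]
  naturality d x := by
    refine LinearMap.congr_fun (f := DirectSum.lmap _ ∘ₗ DirectSum.lmap _)
      (g := DirectSum.lmap _ ∘ₗ DirectSum.lmap _) ?_ x
    rw [← DirectSum.lmap_comp, ← DirectSum.lmap_comp]
    congr 1; funext k
    refine Representation.Coinvariants.hom_ext (LinearMap.ext fun y => ?_)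
    simp [preCoinvMap, prePair_preMap]

/-- The restriction of `prePair` to invariants. -/
def preInvPair {M M' N N' : SymSeq F} (φ : Hom M M') (ψ : Hom N N') (S K : Type) [Finite S]
    [Finite K] : (preRep M N S K).invariants →ₗ[F] (preRep M' N' S K).invariants :=
  (prePair φ ψ S K).restrict fun x hx σ => by
    have : prePair φ ψ S K (preRep M N S K σ x) =
        preRep M' N' S K σ (prePair φ ψ S K x) := prePair_preMap φ ψ _ _ x
    rw [← this, hx σ]

theorem coe_preInvPair {M M' N N' : SymSeq F} (φ : Hom M M') (ψ : Hom N N') (S K : Type) [Finite S]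
    [Finite K] (x : (preRep M N S K).invariants) :
    (preInvPair φ ψ S K x : Pre M' N' S K) = prePair φ ψ S K x := rfl

/-- The morphism `φ ∘̃ ψ : M ∘̃ N → M' ∘̃ N'` induced by `φ` and `ψ`. -/
def dcompMap {M M' N N' : SymSeq F} (φ : Hom M M') (ψ : Hom N N') :
    Hom (dcomp M N) (dcomp M' N') where
  app S _ := DirectSum.lmap fun k => preInvPair φ ψ S (Fin k)
  naturality d x := by
    refine LinearMap.congr_fun (f := DirectSum.lmap _ ∘ₗ DirectSum.lmap _)
      (g := DirectSum.lmap _ ∘ₗ DirectSum.lmap _) ?_ x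
    rw [← DirectSum.lmap_comp, ← DirectSum.lmap_comp]
    congr 1; funext k
    refine LinearMap.ext fun y => Subtype.ext ?_
    simp [coe_preInvMap, coe_preInvPair, prePair_preMap]

open scoped Classical in
/-- The class in `M ∘ N` of a decorated map `f : S → {1, …, k}`. -/
def cls (M N : SymSeq F) {S : Type} [Finite S] {k : ℕ} (f : S → Fin k) :
    M.obj (Fin k) ⊗[F] FibTensor N f →ₗ[F] (comp M N).obj S :=
  DirectSum.lof F ℕ (fun k => (preRep M N S (Fin k)).Coinvariants) k ∘ₗ
    Representation.Coinvariants.mk (preRep M N S (Fin k)) ∘ₗ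
    (DirectSum.lof F (S → Fin k) (fun f => FibTensor N f) f).lTensor (M.obj (Fin k))

theorem cls_map (M N : SymSeq F) {S T : Type} [Finite S] [Finite T] (d : S ≃ T) {k : ℕ}
    (σ : Equiv.Perm (Fin k)) (f : S → Fin k) (g : T → Fin k) (h : ∀ s, g (d s) = σ (f s))
    (m : M.obj (Fin k)) (t : FibTensor N f) :
    cls M N g (M.map σ m ⊗ₜ fibMap N d σ h t) = (comp M N).map d (cls M N f (m ⊗ₜ t)) := by
  classical
  have hm := preMap_trans M N d (Equiv.refl T) (Equiv.refl (Fin k)) σ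
  have : preMap M N d σ (m ⊗ₜ DirectSum.lof F _ _ f t) = preRep M N T (Fin k) σ
      (preMap M N d (Equiv.refl (Fin k)) (m ⊗ₜ DirectSum.lof F _ _ f t)) :=
    LinearMap.congr_fun hm _
  have h2 : preMap M N d σ (m ⊗ₜ DirectSum.lof F _ _ f t) =
      M.map σ m ⊗ₜ DirectSum.lof F _ _ g (fibMap N d σ h t) := by
    simp [preMap, powMap_lof N d σ f g h]
  have h3 : Representation.Coinvariants.mk (preRep M N T (Fin k))
      (M.map σ m ⊗ₜ DirectSum.lof F _ _ g (fibMap N d σ h t)) =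
      preCoinvMap M N (Fin k) d (Representation.Coinvariants.mk (preRep M N S (Fin k))
        (m ⊗ₜ DirectSum.lof F _ _ f t)) := by
    rw [← h2, this, Representation.Coinvariants.mk_self_apply]; rfl
  have h4 : (comp M N).map d (cls M N f (m ⊗ₜ t)) =
      DirectSum.lof F ℕ (fun k => (preRep M N T (Fin k)).Coinvariants) k
        (preCoinvMap M N (Fin k) d (Representation.Coinvariants.mk (preRep M N S (Fin k))
        (m ⊗ₜ DirectSum.lof F _ _ f t))) := DirectSum.lmap_lof _ _ _
  rw [h4, ← h3]; rfl

/-- Two linear maps out of `M ∘ N` agreeing on classes of pure tensors are equal. -/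
theorem comp_ext {M N : SymSeq F} {S : Type} [Finite S] {W : Type u} [AddCommGroup W]
    [Module F W] {φ ψ : (comp M N).obj S →ₗ[F] W}
    (h : ∀ (k : ℕ) (f : S → Fin k) (m : M.obj (Fin k)) (n : ∀ i, N.obj (Fib f i)),
      φ (cls M N f (m ⊗ₜ PiTensorProduct.tprod F n)) =
        ψ (cls M N f (m ⊗ₜ PiTensorProduct.tprod F n))) : φ = ψ := by
  classical
  refine DirectSum.linearMap_ext F fun k => Representation.Coinvariants.hom_ext ?_
  refine TensorProduct.ext (LinearMap.ext fun m => ?_)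
  refine DirectSum.linearMap_ext F fun f => tensor_ext fun n => ?_
  exact h k f m n

open scoped Classical in
/-- Linear maps out of `M(K) ⊗ N^{⊠ K}(S)`. -/
def preLift {M N : SymSeq F} {S K : Type} [Finite S] [Finite K] {W : Type u} [AddCommGroup W]
    [Module F W] (φ : ∀ f : S → K, M.obj K ⊗[F] FibTensor N f →ₗ[F] W) : Pre M N S K →ₗ[F] W :=
  TensorProduct.lift (LinearMap.flip (DirectSum.toModule F (S → K) _ fun f =>
    (TensorProduct.curry (φ f)).flip))

open scoped Classical in
theorem preLift_lof {M N : SymSeq F} {S K : Type} [Finite S] [Finite K] {W : Type u}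
    [AddCommGroup W] [Module F W] (φ : ∀ f : S → K, M.obj K ⊗[F] FibTensor N f →ₗ[F] W)
    (m : M.obj K) (f : S → K) (t : FibTensor N f) :
    preLift φ (m ⊗ₜ DirectSum.lof F (S → K) (fun f => FibTensor N f) f t) = φ f (m ⊗ₜ t) := by
  simp [preLift]

theorem preRep_lof (M N : SymSeq F) {S K : Type} [Finite S] [Finite K]
    [DecidableEq (S → K)] (σ : Equiv.Perm K) (f g : S → K) (h : ∀ s, g (Equiv.refl S s) = σ (f s))
    (m : M.obj K) (t : FibTensor N f) :
    preRep M N S K σ (m ⊗ₜ DirectSum.lof F (S → K) (fun f => FibTensor N f) f t) =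
      M.map σ m ⊗ₜ DirectSum.lof F (S → K) (fun f => FibTensor N f) g
        (fibMap N (Equiv.refl S) σ h t) := by
  obtain rfl : ‹DecidableEq (S → K)› = Classical.decEq _ := Subsingleton.elim _ _
  change preMap M N (Equiv.refl S) σ _ = _
  rw [preMap, TensorProduct.map_tmul, powMap_lof N (Equiv.refl S) σ f g h]

/-- Linear maps out of the coinvariants. -/
def coinvLift {M N : SymSeq F} {S K : Type} [Finite S] [Finite K] {W : Type u} [AddCommGroup W]
    [Module F W] (φ : ∀ f : S → K, M.obj K ⊗[F] FibTensor N f →ₗ[F] W)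
    (hφ : ∀ (σ : Equiv.Perm K) (f g : S → K)
      (h : ∀ s, g (Equiv.refl S s) = σ (f s)) (m : M.obj K) (n : ∀ i, N.obj (Fib f i)),
      φ g (M.map σ m ⊗ₜ fibMap N (Equiv.refl S) σ h (PiTensorProduct.tprod F n)) =
        φ f (m ⊗ₜ PiTensorProduct.tprod F n)) : (preRep M N S K).Coinvariants →ₗ[F] W :=
  Representation.Coinvariants.lift (preRep M N S K) (preLift φ) fun σ => by
    classical
    refine TensorProduct.ext (LinearMap.ext fun m => ?_)
    refine DirectSum.linearMap_ext F fun f => tensor_ext fun n => ?_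
    obtain ⟨g, h⟩ : ∃ g : S → K, ∀ s, g (Equiv.refl S s) = σ (f s) := ⟨fun t => σ (f t), by simp⟩
    change preLift φ (preRep M N S K σ (m ⊗ₜ DirectSum.lof F _ _ f
      (PiTensorProduct.tprod F n))) = preLift φ (m ⊗ₜ DirectSum.lof F _ _ f _)
    rw [preRep_lof M N σ f g h, preLift_lof, preLift_lof, hφ]

theorem coinvLift_mk {M N : SymSeq F} {S K : Type} [Finite S] [Finite K] {W : Type u}
    [AddCommGroup W] [Module F W] (φ : ∀ f : S → K, M.obj K ⊗[F] FibTensor N f →ₗ[F] W)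
    (hφ) (x : Pre M N S K) :
    coinvLift φ hφ (Representation.Coinvariants.mk _ x) = preLift φ x := rfl

/-- Linear maps out of `M ∘ N`. -/
def compLift {M N : SymSeq F} {S : Type} [Finite S] {W : Type u} [AddCommGroup W]
    [Module F W] (φ : ∀ (k : ℕ) (f : S → Fin k), M.obj (Fin k) ⊗[F] FibTensor N f →ₗ[F] W)
    (hφ : ∀ (k : ℕ) (σ : Equiv.Perm (Fin k)) (f g : S → Fin k)
      (h : ∀ s, g (Equiv.refl S s) = σ (f s)) (m : M.obj (Fin k)) (n : ∀ i, N.obj (Fib f i)),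
      φ k g (M.map σ m ⊗ₜ fibMap N (Equiv.refl S) σ h (PiTensorProduct.tprod F n)) =
        φ k f (m ⊗ₜ PiTensorProduct.tprod F n)) :
    (comp M N).obj S →ₗ[F] W :=
  DirectSum.toModule F ℕ W fun k => coinvLift (φ k) (hφ k)

theorem compLift_cls {M N : SymSeq F} {S : Type} [Finite S] {W : Type u} [AddCommGroup W]
    [Module F W] (φ : ∀ (k : ℕ) (f : S → Fin k), M.obj (Fin k) ⊗[F] FibTensor N f →ₗ[F] W)
    (hφ) {k : ℕ} (f : S → Fin k) (x : M.obj (Fin k) ⊗[F] FibTensor N f) :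
    compLift φ hφ (cls M N f x) = φ k f x := by
  refine LinearMap.congr_fun (f := compLift φ hφ ∘ₗ cls M N f) ?_ x
  refine TensorProduct.ext' fun m t => ?_
  exact (DirectSum.toModule_lof F (φ := fun k => coinvLift (φ k) (hφ k)) k _).trans
    (preLift_lof (φ k) m f t)

/-- The class in `M ∘ N` of a decorated map `f : S → K` to any finite set `K`. -/
def elt (M N : SymSeq F) {S K : Type} [Finite S] [Finite K] (f : S → K) :
    M.obj K ⊗[F] FibTensor N f →ₗ[F] (comp M N).obj S :=
  cls M N (fun s => Finite.equivFin K (f s)) ∘ₗ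
    TensorProduct.map (M.map (Finite.equivFin K))
      (fibMap N (Equiv.refl S) (Finite.equivFin K) fun _ => rfl)

theorem elt_tmul (M N : SymSeq F) {S K : Type} [Finite S] [Finite K] (f : S → K) {k : ℕ}
    (e : K ≃ Fin k) (g : S → Fin k) (h : ∀ s, g (Equiv.refl S s) = e (f s)) (m : M.obj K)
    (t : FibTensor N f) :
    elt M N f (m ⊗ₜ t) = cls M N g (M.map e m ⊗ₜ fibMap N (Equiv.refl S) e h t) := by
  obtain rfl : k = Nat.card K := (Nat.card_eq_of_equiv_fin e).symm
  obtain ⟨g', h'⟩ : ∃ g' : S → Fin (Nat.card K), ∀ s, g' (Equiv.refl S s) = Finite.equivFin K (f s) :=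
    ⟨fun t => Finite.equivFin K (f t), fun _ => rfl⟩
  obtain ⟨σ, hσ⟩ : ∃ σ, e = (Finite.equivFin K).trans σ := ⟨(Finite.equivFin K).symm.trans e, by ext; simp⟩
  have h1 : elt M N f (m ⊗ₜ t) = cls M N g' (M.map (Finite.equivFin K) m ⊗ₜ
      fibMap N (Equiv.refl S) (Finite.equivFin K) h' t) := by
    obtain rfl : g' = fun s => Finite.equivFin K (f s) := funext h'
    rfl
  subst hσ
  have h'' : ∀ s, g (Equiv.refl S s) = σ (g' s) := fun s => by
    have h1 := h' s
    simp only [Equiv.refl_apply] at h1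
    rw [h s, h1]; rfl
  have h2 := cls_map M N (Equiv.refl S) σ g' g h'' (M.map (Finite.equivFin K) m)
    (fibMap N (Equiv.refl S) (Finite.equivFin K) h' t)
  rw [(comp M N).map_refl] at h2
  rw [h1, ← h2, ← M.map_trans]
  congr 2
  exact (LinearMap.congr_fun (fibMap_trans N (Equiv.refl S) (Equiv.refl S) (Finite.equivFin K) σ
    h' h'' h) t).symm

theorem elt_eq_cls (M N : SymSeq F) {S : Type} [Finite S] {k : ℕ} (f : S → Fin k) 
    (x : M.obj (Fin k) ⊗[F] FibTensor N f) : elt M N f x = cls M N f x := by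
  refine LinearMap.congr_fun (TensorProduct.ext' fun m t => ?_) x
  have h : ∀ s, f (Equiv.refl S s) = Equiv.refl (Fin k) (f s) := fun _ => rfl
  rw [elt_tmul M N f (Equiv.refl _) f h, M.map_refl, fibMap_refl]; rfl

theorem elt_map (M N : SymSeq F) {S T K J : Type} [Finite S] [Finite T] [Finite K] [Finite J]
    (d : S ≃ T) (e : K ≃ J) (f : S → K) (g : T → J) (h : ∀ s, g (d s) = e (f s))
    (m : M.obj K) (t : FibTensor N f) :
    elt M N g (M.map e m ⊗ₜ fibMap N d e h t) = (comp M N).map d (elt M N f (m ⊗ₜ t)) := by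
  obtain ⟨k, ⟨a⟩⟩ := Finite.exists_equiv_fin J
  obtain ⟨p, hp⟩ : ∃ p : S → Fin k, ∀ s, p (Equiv.refl S s) = e.trans a (f s) := ⟨fun s => a (e (f s)), fun _ => rfl⟩
  obtain ⟨q, hq⟩ : ∃ q : T → Fin k, ∀ s, q (Equiv.refl T s) = a (g s) := ⟨fun s => a (g s), fun _ => rfl⟩
  have hpq : ∀ s, q (d s) = Equiv.refl _ (p s) := fun s => by
    have h1 := hp s; have h2 := hq (d s)
    simp only [Equiv.refl_apply, Equiv.trans_apply] at h1 h2 ⊢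
    rw [h1, h2, h]
  have hdiag : ∀ s, q ((d.trans (Equiv.refl T)) s) = (e.trans a) (f s) := fun s => by
    have h1 := hp s; have h2 := hpq s
    simp only [Equiv.refl_apply, Equiv.trans_apply] at h1 h2 ⊢
    rw [h2, h1]
  rw [elt_tmul M N g a q hq, elt_tmul M N f (e.trans a) p hp, ← M.map_trans]
  have h3 := cls_map M N d (Equiv.refl _) p q hpq (M.map (e.trans a) m)
    (fibMap N (Equiv.refl S) (e.trans a) hp t)
  rw [M.map_refl] at h3
  rw [← h3]
  congr 2
  exact (LinearMap.congr_fun (fibMap_trans N d (Equiv.refl T) e a h hq hdiag) t).symm.trans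
    (LinearMap.congr_fun (fibMap_trans N (Equiv.refl S) d (e.trans a) (Equiv.refl _) hp hpq hdiag) t)

theorem split_update {K J : Type} [DecidableEq K] [DecidableEq J] (g : K → J) (X : K → Type u)
    [∀ k, AddCommGroup (X k)] [∀ k, Module F (X k)] [∀ j, DecidableEq (Fib g j)]
    (x : ∀ k, X k) (i : K) (v : X i) :
    (fun j => PiTensorProduct.tprod F fun k : Fib g j => Function.update x i v k) =
      Function.update (fun j => PiTensorProduct.tprod F fun k : Fib g j => x k) (g i)
        (PiTensorProduct.tprod F (Function.update (fun k : Fib g (g i) => x k) ⟨i, rfl⟩ v)) := by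
  funext j
  by_cases hj : j = g i
  · subst hj
    rw [Function.update_self]
    congr 1; funext k
    by_cases hk : k = ⟨i, rfl⟩
    · subst hk; simp
    · rw [Function.update_of_ne hk, Function.update_of_ne fun h => hk (Subtype.ext h)]
  · rw [Function.update_of_ne hj]
    congr 1; funext k
    rw [Function.update_of_ne]
    rintro rfl
    exact hj k.2.symm

open scoped Classical in
/-- Grouping of tensor factors: `⨂_k X_k → ⨂_j ⨂_{k ∈ g⁻¹(j)} X_k`. -/
def splitTensor {K J : Type} (g : K → J) (X : K → Type u) [∀ k, AddCommGroup (X k)]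
    [∀ k, Module F (X k)] :
    PiTensorProduct F X →ₗ[F]
      PiTensorProduct F fun j => PiTensorProduct F fun k : Fib g j => X k :=
  PiTensorProduct.lift (MultilinearMap.mk'
    (fun x => PiTensorProduct.tprod F fun j => PiTensorProduct.tprod F fun k : Fib g j => x k)
    (fun x i v w => by
      simp only [split_update, MultilinearMap.map_update_add])
    (fun x i c v => by
      simp only [split_update, MultilinearMap.map_update_smul]))

theorem splitTensor_tprod {K J : Type} (g : K → J) (X : K → Type u) [∀ k, AddCommGroup (X k)]
    [∀ k, Module F (X k)] (x : ∀ k, X k) :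
    splitTensor (F := F) g X (PiTensorProduct.tprod F x) =
      PiTensorProduct.tprod F fun j => PiTensorProduct.tprod F fun k : Fib g j => x k := by
  simp [splitTensor]

/-- The restriction of `f : S → K` to a map from `(g ∘ f)⁻¹(j)` to `g⁻¹(j)`. -/
def fibRestrict {S K J : Type} (f : S → K) (g : K → J) (j : J) (s : Fib (g ∘ f) j) : Fib g j :=
  ⟨f s, s.2⟩

/-- For `k ∈ g⁻¹(j)`, the fibre of `f` over `k` is that of the restriction of `f`. -/
def fibFib {S K J : Type} (f : S → K) (g : K → J) (j : J) (k : Fib g j) :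
    Fib f k.1 ≃ Fib (fibRestrict f g j) k where
  toFun s := ⟨⟨s.1, by rw [Function.comp_apply, s.2, k.2]⟩, Subtype.ext s.2⟩
  invFun s := ⟨s.1.1, congrArg Subtype.val s.2⟩
  left_inv _ := rfl
  right_inv _ := rfl

/-- The pairing `⨂_j N(g⁻¹(j)) ⊗ ⨂_k L(f⁻¹(k)) → ⨂_j (N ∘ L)((g ∘ f)⁻¹(j))` which sends
`(ν_j)_j ⊗ (λ_k)_k` to the tensor product over `j` of the classes `(ν_j; (λ_k)_{k ∈ g⁻¹(j)})`. -/
def assocFib (N L : SymSeq F) {S K J : Type} [Finite S] [Finite K] (f : S → K) (g : K → J) :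
    FibTensor N g →ₗ[F] FibTensor L f →ₗ[F] FibTensor (comp N L) (g ∘ f) :=
  (PiTensorProduct.map₂ fun j => TensorProduct.curry (elt N L (fibRestrict f g j) ∘ₗ
      (PiTensorProduct.map fun k => L.map (fibFib f g j k)).lTensor (N.obj (Fib g j)))).compl₂
    (splitTensor g fun k => L.obj (Fib f k))

theorem assocFib_tprod (N L : SymSeq F) {S K J : Type} [Finite S] [Finite K]
    (f : S → K) (g : K → J) (n : ∀ j, N.obj (Fib g j)) (l : ∀ k, L.obj (Fib f k)) :
    assocFib N L f g (PiTensorProduct.tprod F n) (PiTensorProduct.tprod F l) =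
      PiTensorProduct.tprod F fun j => elt N L (fibRestrict f g j)
        (n j ⊗ₜ PiTensorProduct.tprod F fun k : Fib g j => L.map (fibFib f g j k) (l k)) := by
  simp [assocFib, splitTensor_tprod, PiTensorProduct.map₂_tprod_tprod]

/-- The associator on representatives:
`((μ; (ν_j)_j); (λ_k)_k) ↦ (μ; ((ν_j; (λ_k)_{k ∈ g⁻¹(j)}))_j)`. -/
def assocElt (M N L : SymSeq F) {S K J : Type} [Finite S] [Finite K] [Finite J]
    (f : S → K) (g : K → J) :
    (M.obj J ⊗[F] FibTensor N g) ⊗[F] FibTensor L f →ₗ[F] (comp M (comp N L)).obj S :=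
  elt M (comp N L) (g ∘ f) ∘ₗ (TensorProduct.lift (assocFib N L f g)).lTensor (M.obj J) ∘ₗ
    (TensorProduct.assoc F _ _ _).toLinearMap

theorem assocElt_map (M N L : SymSeq F) {S T K K' J J' : Type} [Finite S] [Finite T] [Finite K]
    [Finite K'] [Finite J] [Finite J'] (d : S ≃ T) (a : K ≃ K') (b : J ≃ J') (f : S → K)
    (f' : T → K') (g : K → J) (g' : K' → J') (hf : ∀ s, f' (d s) = a (f s))
    (hg : ∀ k, g' (a k) = b (g k)) (m : M.obj J) (n : ∀ j, N.obj (Fib g j))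
    (l : ∀ k, L.obj (Fib f k)) :
    assocElt M N L f' g' ((M.map b m ⊗ₜ fibMap N a b hg (PiTensorProduct.tprod F n)) ⊗ₜ
        fibMap L d a hf (PiTensorProduct.tprod F l)) =
      (comp M (comp N L)).map d
        (assocElt M N L f g ((m ⊗ₜ PiTensorProduct.tprod F n) ⊗ₜ PiTensorProduct.tprod F l)) := by
  have hgf : ∀ s, (g' ∘ f') (d s) = b ((g ∘ f) s) := fun s => by simp [hf, hg]
  have h1 := elt_map M (comp N L) d b (g ∘ f) (g' ∘ f') hgf m
    (assocFib N L f g (PiTensorProduct.tprod F n) (PiTensorProduct.tprod F l))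
  have e1 : ∀ (f : S → K) (g : K → J) x y z, assocElt M N L f g ((x ⊗ₜ y) ⊗ₜ z) =
    elt M (comp N L) (g ∘ f) (x ⊗ₜ assocFib N L f g y z) := fun _ _ _ _ _ => rfl
  have e2 : ∀ (f : T → K') (g : K' → J') x y z, assocElt M N L f g ((x ⊗ₜ y) ⊗ₜ z) =
    elt M (comp N L) (g ∘ f) (x ⊗ₜ assocFib N L f g y z) := fun _ _ _ _ _ => rfl
  rw [e1, e2, ← h1]
  congr 2
  rw [assocFib_tprod, fibMap_tprod, fibMap_tprod, fibMap_tprod, assocFib_tprod]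
  congr 1; funext j
  have hj : ∀ s, fibRestrict f' g' j (fibEquiv d b hgf j s) =
      fibEquiv a b hg j (fibRestrict f g (b.symm j) s) := fun s => Subtype.ext (hf s.1)
  rw [← elt_map N L (fibEquiv d b hgf j) (fibEquiv a b hg j) _ _ hj, fibMap_tprod]
  congr 3; funext k
  rw [← L.map_trans, ← L.map_trans]
  rfl

theorem assocElt_refl (M N L : SymSeq F) {S K K' J J' : Type} [Finite S] [Finite K]
    [Finite K'] [Finite J] [Finite J'] (a : K ≃ K') (b : J ≃ J') (f : S → K)
    (f' : S → K') (g : K → J) (g' : K' → J') (hf : ∀ s, f' (Equiv.refl S s) = a (f s))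
    (hg : ∀ k, g' (a k) = b (g k)) (m : M.obj J) (n : ∀ j, N.obj (Fib g j))
    (l : ∀ k, L.obj (Fib f k)) :
    assocElt M N L f' g' ((M.map b m ⊗ₜ fibMap N a b hg (PiTensorProduct.tprod F n)) ⊗ₜ
        fibMap L (Equiv.refl S) a hf (PiTensorProduct.tprod F l)) =
      assocElt M N L f g ((m ⊗ₜ PiTensorProduct.tprod F n) ⊗ₜ PiTensorProduct.tprod F l) := by
  rw [assocElt_map, (comp M (comp N L)).map_refl]

theorem assocAux_wd (M N L : SymSeq F) {S K : Type} [Finite S] [Finite K] (f : S → K) (k : ℕ)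
    (σ : Equiv.Perm (Fin k)) (g g' : K → Fin k) (h : ∀ s, g' (Equiv.refl K s) = σ (g s))
    (m : M.obj (Fin k)) (n : ∀ i, N.obj (Fib g i)) :
    TensorProduct.curry (assocElt M N L f g')
        (M.map σ m ⊗ₜ fibMap N (Equiv.refl K) σ h (PiTensorProduct.tprod F n)) =
      TensorProduct.curry (assocElt M N L f g) (m ⊗ₜ PiTensorProduct.tprod F n) := by
  refine tensor_ext fun l => ?_
  have hf : ∀ s, f (Equiv.refl S s) = Equiv.refl K (f s) := fun _ => rfl
  have h1 := assocElt_refl M N L (Equiv.refl K) σ f f g g' hf h m n l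
  rw [fibMap_refl] at h1
  exact h1

/-- The associator, with the decoration of the inner composite `M ∘ N` descended to classes. -/
def assocAux (M N L : SymSeq F) {S K : Type} [Finite S] [Finite K] (f : S → K) :
    (comp M N).obj K →ₗ[F] FibTensor L f →ₗ[F] (comp M (comp N L)).obj S :=
  compLift (fun _ g => TensorProduct.curry (assocElt M N L f g)) (assocAux_wd M N L f)

theorem assocAux_cls (M N L : SymSeq F) {S K : Type} [Finite S] [Finite K] (f : S → K) {k : ℕ}
    (g : K → Fin k) (x : M.obj (Fin k) ⊗[F] FibTensor N g) (t : FibTensor L f) :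
    assocAux M N L f (cls M N g x) t = assocElt M N L f g (x ⊗ₜ t) := by
  rw [assocAux, compLift_cls]; rfl

theorem assocAux_map (M N L : SymSeq F) {S T K K' : Type} [Finite S] [Finite T] [Finite K]
    [Finite K'] (d : S ≃ T) (a : K ≃ K') (f : S → K) (f' : T → K')
    (hf : ∀ s, f' (d s) = a (f s)) (x : (comp M N).obj K) (t : FibTensor L f) :
    assocAux M N L f' ((comp M N).map a x) (fibMap L d a hf t) =
      (comp M (comp N L)).map d (assocAux M N L f x t) := by
  have h : LinearMap.compl₁₂ (assocAux M N L f') ((comp M N).map a) (fibMap L d a hf) =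
      (assocAux M N L f).compr₂ ((comp M (comp N L)).map d) := by
    refine comp_ext fun k g m n => tensor_ext fun l => ?_
    obtain ⟨g', hg⟩ : ∃ g' : K' → Fin k, ∀ s, g' (a s) = Equiv.refl _ (g s) :=
      ⟨fun s => g (a.symm s), by simp⟩
    have h1 := cls_map M N a (Equiv.refl _) g g' hg m (PiTensorProduct.tprod F n)
    have h2 := assocElt_map M N L d a (Equiv.refl _) f f' g g' hf hg m n l
    rw [M.map_refl] at h1 h2
    change assocAux M N L f' ((comp M N).map a (cls M N g (m ⊗ₜ PiTensorProduct.tprod F n)))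
      (fibMap L d a hf (PiTensorProduct.tprod F l)) = (comp M (comp N L)).map d
        (assocAux M N L f (cls M N g (m ⊗ₜ PiTensorProduct.tprod F n)) (PiTensorProduct.tprod F l))
    rw [← h1, assocAux_cls, assocAux_cls, h2]
  exact LinearMap.congr_fun₂ h x t

/-- The associator on a given finite set. -/
def assocApp (M N L : SymSeq F) (S : Type) [Finite S] :
    (comp (comp M N) L).obj S →ₗ[F] (comp M (comp N L)).obj S :=
  compLift (fun _ f => TensorProduct.lift (assocAux M N L f)) fun k σ f g h m l => by
    rw [TensorProduct.lift.tmul, TensorProduct.lift.tmul, assocAux_map,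
      (comp M (comp N L)).map_refl]

theorem assocApp_cls (M N L : SymSeq F) {S : Type} [Finite S] {k : ℕ} (f : S → Fin k)
    (x : (comp M N).obj (Fin k)) (t : FibTensor L f) :
    assocApp M N L S (cls (comp M N) L f (x ⊗ₜ t)) = assocAux M N L f x t := by
  rw [assocApp, compLift_cls, TensorProduct.lift.tmul]

/-- The associator `(M ∘ N) ∘ L → M ∘ (N ∘ L)`, which sends `((μ; ν₁, …, ν_m); λ_{1,1}, …)` to
`(μ; (ν₁; λ_{1,1}, …), …, (ν_m; λ_{m,1}, …))`. -/
def assoc (M N L : SymSeq F) : Hom (comp (comp M N) L) (comp M (comp N L)) where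
  app S _ := assocApp M N L S
  naturality {S T} _ _ d x := by
    refine LinearMap.congr_fun (f := assocApp M N L T ∘ₗ (comp (comp M N) L).map d)
      (g := (comp M (comp N L)).map d ∘ₗ assocApp M N L S) (comp_ext fun k f m n => ?_) x
    obtain ⟨g, hg⟩ : ∃ g : T → Fin k, ∀ s, g (d s) = Equiv.refl _ (f s) :=
      ⟨fun s => f (d.symm s), by simp⟩
    rw [LinearMap.comp_apply, LinearMap.comp_apply,
      ← cls_map (comp M N) L d (Equiv.refl _) f g hg m (PiTensorProduct.tprod F n),
      assocApp_cls, assocApp_cls, assocAux_map]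

/-- The identity map has one-point fibres. -/
def fibIdEquiv {S : Type} (s : S) : Unit ≃ Fib (id : S → S) s where
  toFun _ := ⟨s, rfl⟩
  invFun _ := ()
  left_inv _ := rfl
  right_inv t := Subtype.ext t.2.symm

/-- The map `M = M ∘ U → M ∘ N`, `x ↦ (x; 1, …, 1)`, induced by `U → N`, `1 ↦ one ∈ N(1)`. -/
def insertRight (M N : SymSeq F) (one : N.obj Unit) (S : Type) [Finite S] :
    M.obj S →ₗ[F] (comp M N).obj S :=
  elt M N (id : S → S) ∘ₗ (TensorProduct.mk F _ _).flip
    (PiTensorProduct.tprod F fun s : S => N.map (fibIdEquiv s) one)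

/-- The map `N = U ∘ N → M ∘ N`, `x ↦ (1; x)`, induced by `U → M`, `1 ↦ one ∈ M(1)`. -/
def insertLeft (M N : SymSeq F) (one : M.obj Unit) (S : Type) [Finite S] :
    N.obj S →ₗ[F] (comp M N).obj S :=
  elt M N (fun _ : S => ()) ∘ₗ TensorProduct.mk F _ _ one ∘ₗ
    (PiTensorProduct.subsingletonEquiv (R := F)
        (s := fun k : Unit => N.obj (Fib (fun _ : S => ()) k)) ()).symm.toLinearMap ∘ₗ
      N.map (Equiv.subtypeUnivEquiv (p := fun _ : S => () = ()) fun _ => rfl).symm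

/-- The inverse of a bijective morphism. -/
def Hom.inv {M N : SymSeq F} (φ : Hom M N) (h : ∀ (S : Type) [Finite S], Function.Bijective (φ.app S)) :
    Hom N M where
  app S _ := (LinearEquiv.ofBijective (φ.app S) (h S)).symm.toLinearMap
  naturality {S T} _ _ d x := by
    refine (h T).1 ?_
    rw [φ.naturality]
    exact (LinearEquiv.apply_symm_apply (LinearEquiv.ofBijective (φ.app T) (h T)) _).trans
      (congrArg _ (LinearEquiv.apply_symm_apply (LinearEquiv.ofBijective (φ.app S) (h S)) x).symm)
/-! ### Divided power functors -/

/-- `M(S) ⊗ V^{⊗ S}`. -/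
abbrev GPre (M : SymSeq F) (V : ModuleCat.{u} F) (S : Type) [Finite S] : Type u :=
  M.obj S ⊗[F] PiTensorProduct F fun _ : S => (V : Type u)

/-- The relabelling `V^{⊗ S} → V^{⊗ T}`. -/
def vMap (V : ModuleCat.{u} F) {S T : Type} (d : S ≃ T) :
    (PiTensorProduct F fun _ : S => (V : Type u)) →ₗ[F] PiTensorProduct F fun _ : T => (V : Type u) :=
  (PiTensorProduct.reindex F (fun _ : S => (V : Type u)) d).toLinearMap

theorem vMap_tprod (V : ModuleCat.{u} F) {S T : Type} (d : S ≃ T) (v : S → V) :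
    vMap V d (PiTensorProduct.tprod F v) = PiTensorProduct.tprod F fun t => v (d.symm t) :=
  PiTensorProduct.reindex_tprod d v

/-- Relabelling of `M(S) ⊗ V^{⊗ S}`. -/
def gMap (M : SymSeq F) (V : ModuleCat.{u} F) {S T : Type} [Finite S] [Finite T] (d : S ≃ T) :
    GPre M V S →ₗ[F] GPre M V T :=
  TensorProduct.map (M.map d) (vMap V d)

theorem gMap_refl (M : SymSeq F) (V : ModuleCat.{u} F) (S : Type) [Finite S] :
    gMap M V (Equiv.refl S) = LinearMap.id := by
  refine TensorProduct.ext (LinearMap.ext fun m => tensor_ext fun v => ?_)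
  change M.map (Equiv.refl S) m ⊗ₜ vMap V (Equiv.refl S) (PiTensorProduct.tprod F v) =
    m ⊗ₜ PiTensorProduct.tprod F v
  rw [M.map_refl, vMap_tprod]; rfl

theorem gMap_trans (M : SymSeq F) (V : ModuleCat.{u} F) {S T R : Type} [Finite S] [Finite T]
    [Finite R] (d : S ≃ T) (e : T ≃ R) :
    gMap M V (d.trans e) = gMap M V e ∘ₗ gMap M V d := by
  refine TensorProduct.ext (LinearMap.ext fun m => tensor_ext fun v => ?_)
  change M.map (d.trans e) m ⊗ₜ vMap V (d.trans e) (PiTensorProduct.tprod F v) =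
    M.map e (M.map d m) ⊗ₜ vMap V e (vMap V d (PiTensorProduct.tprod F v))
  rw [M.map_trans, vMap_tprod, vMap_tprod, vMap_tprod]; rfl

/-- The diagonal action on `M(S) ⊗ V^{⊗ S}`. -/
def gRep (M : SymSeq F) (V : ModuleCat.{u} F) (S : Type) [Finite S] :
    Representation F (Equiv.Perm S) (GPre M V S) where
  toFun σ := gMap M V σ
  map_one' := gMap_refl M V S
  map_mul' σ τ := gMap_trans M V τ σ

/-- `Γ(M, V) = ⨁_n (M(n) ⊗ V^{⊗ n})^{Σ_n}`, that is, `M ∘̃ V`. -/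
def Gamma (M : SymSeq F) (V : ModuleCat.{u} F) : ModuleCat.{u} F :=
  ModuleCat.of F (⨁ n : ℕ, (gRep M V (Fin n)).invariants)

/-- The map `M(S) ⊗ V^{⊗ S} → M'(S) ⊗ W^{⊗ S}` induced by `φ : M → M'` and `v : V → W`. -/
def gPair {M M' : SymSeq F} (φ : Hom M M') {V W : ModuleCat.{u} F} (v : V →ₗ[F] W) (S : Type)
    [Finite S] : GPre M V S →ₗ[F] GPre M' W S :=
  TensorProduct.map (φ.app S) (PiTensorProduct.map fun _ => v)

theorem gPair_gMap {M M' : SymSeq F} (φ : Hom M M') {V W : ModuleCat.{u} F} (v : V →ₗ[F] W)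
    {S T : Type} [Finite S] [Finite T] (d : S ≃ T) (x : GPre M V S) :
    gPair φ v T (gMap M V d x) = gMap M' W d (gPair φ v S x) := by
  refine LinearMap.congr_fun (f := gPair φ v T ∘ₗ gMap M V d) (g := gMap M' W d ∘ₗ gPair φ v S)
    (TensorProduct.ext (LinearMap.ext fun m => tensor_ext fun t => ?_)) x
  change φ.app T (M.map d m) ⊗ₜ PiTensorProduct.map _ (vMap V d (PiTensorProduct.tprod F t)) =
    M'.map d (φ.app S m) ⊗ₜ vMap W d (PiTensorProduct.map _ (PiTensorProduct.tprod F t))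
  rw [φ.naturality, vMap_tprod, PiTensorProduct.map_tprod, PiTensorProduct.map_tprod, vMap_tprod]

/-- The restriction of `gPair` to invariants. -/
def gInvPair {M M' : SymSeq F} (φ : Hom M M') {V W : ModuleCat.{u} F} (v : V →ₗ[F] W) (S : Type)
    [Finite S] : (gRep M V S).invariants →ₗ[F] (gRep M' W S).invariants :=
  (gPair φ v S).restrict fun x hx σ => by
    have : gPair φ v S (gRep M V S σ x) = gRep M' W S σ (gPair φ v S x) := gPair_gMap φ v _ x
    rw [← this, hx σ]

theorem coe_gInvPair {M M' : SymSeq F} (φ : Hom M M') {V W : ModuleCat.{u} F} (v : V →ₗ[F] W)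
    (S : Type) [Finite S] (x : (gRep M V S).invariants) :
    (gInvPair φ v S x : GPre M' W S) = gPair φ v S x := rfl

/-- The map `φ ∘̃ v : Γ(M, V) → Γ(M', W)` induced by `φ : M → M'` and `v : V → W`. -/
def gammaPair {M M' : SymSeq F} (φ : Hom M M') {V W : ModuleCat.{u} F} (v : V →ₗ[F] W) :
    Gamma M V →ₗ[F] Gamma M' W :=
  DirectSum.lmap fun n => gInvPair φ v (Fin n)

theorem gammaPair_id (M : SymSeq F) (V : ModuleCat.{u} F) :
    gammaPair (Hom.id M) (LinearMap.id : V →ₗ[F] V) = LinearMap.id := by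
  have : ∀ n, gInvPair (Hom.id M) (LinearMap.id : V →ₗ[F] V) (Fin n) = LinearMap.id := fun n =>
    LinearMap.ext fun y => Subtype.ext (by simp [coe_gInvPair, gPair, Hom.id])
  exact (congrArg _ (funext this)).trans DirectSum.lmap_id

theorem gammaPair_comp {M M' M'' : SymSeq F} (φ : Hom M M') (ψ : Hom M' M'')
    {U V W : ModuleCat.{u} F} (v : U →ₗ[F] V) (w : V →ₗ[F] W) :
    gammaPair (ψ.comp φ) (w ∘ₗ v) = gammaPair ψ w ∘ₗ gammaPair φ v := by
  have : ∀ n, gInvPair (ψ.comp φ) (w ∘ₗ v) (Fin n) =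
      gInvPair ψ w (Fin n) ∘ₗ gInvPair φ v (Fin n) := fun n =>
    LinearMap.ext fun y => Subtype.ext (by
      have h : gPair (ψ.comp φ) (w ∘ₗ v) (Fin n) = gPair ψ w (Fin n) ∘ₗ gPair φ v (Fin n) := by
        simp [gPair, Hom.comp, PiTensorProduct.map_comp, TensorProduct.map_comp]
      exact LinearMap.congr_fun h y.1)
  exact (congrArg _ (funext this)).trans (DirectSum.lmap_comp _ _)

/-- The endofunctor `Γ(M)`. -/
def gammaFunctor (M : SymSeq F) : ModuleCat.{u} F ⥤ ModuleCat.{u} F where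
  obj V := Gamma M V
  map v := ModuleCat.ofHom (gammaPair (Hom.id M) v.hom)
  map_id V := congrArg ModuleCat.ofHom (gammaPair_id M V)
  map_comp v w := congrArg ModuleCat.ofHom (gammaPair_comp (Hom.id M) (Hom.id M) v.hom w.hom)

/-- The map `φ ∘̃ V : Γ(M, V) → Γ(M', V)`. -/
def gammaNat {M M' : SymSeq F} (φ : Hom M M') (V : ModuleCat.{u} F) :
    (gammaFunctor M).obj V ⟶ (gammaFunctor M').obj V :=
  ModuleCat.ofHom (gammaPair φ LinearMap.id)

/-- The component of an element of `Γ(M, V)` in `M(n) ⊗ V^{⊗ n}`. -/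
def gammaCoeff (M : SymSeq F) (V : ModuleCat.{u} F) (n : ℕ) : Gamma M V →ₗ[F] GPre M V (Fin n) :=
  (gRep M V (Fin n)).invariants.subtype ∘ₗ
    DirectSum.component F ℕ (fun n => (gRep M V (Fin n)).invariants) n

/-- The component of an element of `Γ(M, V)` in `M(S) ⊗ V^{⊗ S}`, for a finite set `S`: the
component for `n = |S|`, transported along any bijection of `{1, …, n}` with `S` (the result does
not depend on the bijection, the component being invariant under `Σ_n`). -/
def coeffAt (M : SymSeq F) (V : ModuleCat.{u} F) (S : Type) [Finite S] :
    Gamma M V →ₗ[F] GPre M V S :=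
  gMap M V (Finite.equivFin S).symm ∘ₗ gammaCoeff M V (Nat.card S)

/-- The product over all `f : {1, …, n} → {1, …, k}` of the spaces
`M(k) ⊗ ⨂_i (N(f⁻¹(i)) ⊗ V^{⊗ f⁻¹(i)})`. Both `M ∘̃ (N ∘̃ V)` and `(M ∘̃ N) ∘̃ V` are, canonically,
the same subspace of it. -/
abbrev AssocTarget (M N : SymSeq F) (V : ModuleCat.{u} F) : Type u :=
  ∀ (k n : ℕ) (f : Fin n → Fin k),
    M.obj (Fin k) ⊗[F] PiTensorProduct F fun i : Fin k => GPre N V (Fib f i)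

/-- The inclusion of `M ∘̃ (N ∘̃ V)`: at `f`, take the component in `M(k) ⊗ Γ(N, V)^{⊗ k}` and, in the
`i`-th factor, the component in `N(f⁻¹(i)) ⊗ V^{⊗ f⁻¹(i)}`. -/
def nestedIncl (M N : SymSeq F) (V : ModuleCat.{u} F) :
    Gamma M (Gamma N V) →ₗ[F] AssocTarget M N V :=
  LinearMap.pi fun k => LinearMap.pi fun _ => LinearMap.pi fun f =>
    (PiTensorProduct.map fun i => coeffAt N V (Fib f i)).lTensor (M.obj (Fin k)) ∘ₗ
      gammaCoeff M (Gamma N V) k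

open scoped Classical in
/-- The component of an element of `(M ∘̃ N)(S)` in `M(k) ⊗ ⨂_i N(f⁻¹(i))`. -/
def preCoeff (M N : SymSeq F) {S : Type} [Finite S] {k : ℕ} (f : S → Fin k) :
    (dcomp M N).obj S →ₗ[F] M.obj (Fin k) ⊗[F] FibTensor N f :=
  (DirectSum.component F (S → Fin k) (fun f => FibTensor N f) f).lTensor (M.obj (Fin k)) ∘ₗ
    (preRep M N S (Fin k)).invariants.subtype ∘ₗ
      DirectSum.component F ℕ (fun k => (preRep M N S (Fin k)).invariants) k

/-- The pairing `⨂_i N(f⁻¹(i)) ⊗ V^{⊗ S} → ⨂_i (N(f⁻¹(i)) ⊗ V^{⊗ f⁻¹(i)})` which regroups factors. -/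
def zipFib (N : SymSeq F) (V : ModuleCat.{u} F) {S K : Type} [Finite S] (f : S → K) :
    FibTensor N f →ₗ[F] (PiTensorProduct F fun _ : S => (V : Type u)) →ₗ[F]
      PiTensorProduct F fun i : K => GPre N V (Fib f i) :=
  (PiTensorProduct.map₂ fun i => TensorProduct.mk F (N.obj (Fib f i))
    (PiTensorProduct F fun _ : Fib f i => (V : Type u))).compl₂
      (splitTensor f fun _ => (V : Type u))

/-- The map `(M ∘̃ N)(S) ⊗ V^{⊗ S} → M(k) ⊗ ⨂_i (N(f⁻¹(i)) ⊗ V^{⊗ f⁻¹(i)})`: component at `f`. -/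
def compositeCoeff (M N : SymSeq F) (V : ModuleCat.{u} F) {S : Type} [Finite S] {k : ℕ}
    (f : S → Fin k) : GPre (dcomp M N) V S →ₗ[F]
      M.obj (Fin k) ⊗[F] PiTensorProduct F fun i : Fin k => GPre N V (Fib f i) :=
  (TensorProduct.lift (zipFib N V f)).lTensor (M.obj (Fin k)) ∘ₗ
    (TensorProduct.assoc F (M.obj (Fin k)) (FibTensor N f)
      (PiTensorProduct F fun _ : S => (V : Type u))).toLinearMap ∘ₗ
        (preCoeff M N f).rTensor (PiTensorProduct F fun _ : S => (V : Type u))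

/-- The inclusion of `(M ∘̃ N) ∘̃ V`: at `f`, take the component in `(M ∘̃ N)(n) ⊗ V^{⊗ n}`, its
component in `M(k) ⊗ ⨂_i N(f⁻¹(i)) ⊗ V^{⊗ n}`, and regroup the factors. -/
def compositeIncl (M N : SymSeq F) (V : ModuleCat.{u} F) :
    Gamma (dcomp M N) V →ₗ[F] AssocTarget M N V :=
  LinearMap.pi fun _ => LinearMap.pi fun n => LinearMap.pi fun f =>
    compositeCoeff M N V f ∘ₗ gammaCoeff (dcomp M N) V n

/-- The associator `𝔞 : M ∘̃ (N ∘̃ V) → (M ∘̃ N) ∘̃ V`: the identification of the two subspaces of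
`AssocTarget M N V`, so that `compositeIncl (𝔞 x) = nestedIncl x`. -/
def dassoc (M N : SymSeq F) (V : ModuleCat.{u} F) :
    (gammaFunctor M).obj ((gammaFunctor N).obj V) ⟶ (gammaFunctor (dcomp M N)).obj V :=
  ModuleCat.ofHom ((compositeIncl M N V).leftInverse ∘ₗ nestedIncl M N V)

/-- The inverse associator `𝔞⁻¹ : (M ∘̃ N) ∘̃ V → M ∘̃ (N ∘̃ V)`. -/
def dassocInv (M N : SymSeq F) (V : ModuleCat.{u} F) :
    (gammaFunctor (dcomp M N)).obj V ⟶ (gammaFunctor M).obj ((gammaFunctor N).obj V) :=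
  ModuleCat.ofHom ((nestedIncl M N V).leftInverse ∘ₗ compositeIncl M N V)

end SymSeq

open SymSeq

variable {F : Type u} [Field F]

/-- A symmetric sequence with a unit `η : U → P` (given by the image `one ∈ P(1)` of `1 ∈ F`) and a
multiplication `μ : P ∘ P → P`. -/
structure OperadData (F : Type u) [Field F] where
  seq : SymSeq F
  /-- The image `1 ∈ P(1)` of `1 ∈ F` under the unit morphism `U → P`. -/
  one : seq.obj Unit
  mul : Hom (comp seq seq) seq


/-- Isomorphisms of symmetric sequences. -/
def IsIsoHom {M N : SymSeq F} (φ : Hom M N) : Prop :=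
  ∀ (S : Type) [Finite S], Function.Bijective (φ.app S)

open scoped Classical in
/-- The inverse of an isomorphism of symmetric sequences (and zero otherwise). -/
def homInv {M N : SymSeq F} (φ : Hom M N) : Hom N M :=
  if h : IsIsoHom φ then φ.inv h else ⟨fun _ _ => 0, fun _ _ => by simp⟩

/-- The inverse associator `M ∘ (N ∘ L) → (M ∘ N) ∘ L`. -/
def assocInv (M N L : SymSeq F) : Hom (comp M (comp N L)) (comp (comp M N) L) :=
  homInv (assoc M N L)

/-- The inverse `Tr⁻¹ : M ∘̃ N → M ∘ N` of the trace map, for reduced `N`. -/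
def traceInv (M N : SymSeq F) : Hom (dcomp M N) (comp M N) := homInv (trace M N)

/-- The axioms of a monoid in `(Sym, ∘, U)`: `μ(1; x) = x`, `μ(x; 1, …, 1) = x`, and
`μ (μ ∘ P) = μ (P ∘ μ)` on `(P ∘ P) ∘ P`. -/
structure OperadData.IsOperad (P : OperadData F) : Prop where
  one_mul : ∀ (S : Type) [Finite S] (x : P.seq.obj S),
    P.mul.app S (insertLeft P.seq P.seq P.one S x) = x
  mul_one : ∀ (S : Type) [Finite S] (x : P.seq.obj S),
    P.mul.app S (insertRight P.seq P.seq P.one S x) = x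
  mul_assoc : P.mul.comp (compMap P.mul (Hom.id P.seq)) =
    (P.mul.comp (compMap (Hom.id P.seq) P.mul)).comp (assoc P.seq P.seq P.seq)

/-- An operad. -/
structure Operad (F : Type u) [Field F] extends OperadData F where
  isOperad : toOperadData.IsOperad

/-- An operadic distributive law `Λ : Q ∘ P → P ∘ Q`. The first condition is an equality of morphisms
`(Q ∘ P) ∘ P → P ∘ Q`, namely `Λ (Q ∘ μ_P) = (μ_P ∘ Q) (P ∘ Λ) (Λ ∘ P)`; the third is an equality of
morphisms `Q ∘ (Q ∘ P) → P ∘ Q`, namely `Λ (μ_Q ∘ P) = (P ∘ μ_Q) (Λ ∘ Q) (Q ∘ Λ)`; the other two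
are the compatibilities with the units. -/
structure IsOperadicDistributiveLaw (P Q : OperadData F)
    (Λ : Hom (comp Q.seq P.seq) (comp P.seq Q.seq)) : Prop where
  odl₁ : Λ.comp ((compMap (Hom.id Q.seq) P.mul).comp (assoc Q.seq P.seq P.seq)) =
    (compMap P.mul (Hom.id Q.seq)).comp ((assocInv P.seq P.seq Q.seq).comp
      ((compMap (Hom.id P.seq) Λ).comp ((assoc P.seq Q.seq P.seq).comp
        (compMap Λ (Hom.id P.seq)))))
  odl₂ : ∀ (S : Type) [Finite S] (y : Q.seq.obj S),
    Λ.app S (insertRight Q.seq P.seq P.one S y) = insertLeft P.seq Q.seq P.one S y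
  odl₃ : (Λ.comp (compMap Q.mul (Hom.id P.seq))).comp (assocInv Q.seq Q.seq P.seq) =
    (compMap (Hom.id P.seq) Q.mul).comp ((assoc P.seq Q.seq Q.seq).comp
      ((compMap Λ (Hom.id Q.seq)).comp ((assocInv Q.seq P.seq Q.seq).comp
        (compMap (Hom.id Q.seq) Λ))))
  odl₄ : ∀ (S : Type) [Finite S] (x : P.seq.obj S),
    Λ.app S (insertLeft Q.seq P.seq Q.one S x) = insertRight P.seq Q.seq Q.one S x

/-- The symmetric sequence `P ∘ Q` with the unit `η_P ∘ η_Q` and the multiplication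
`(μ_P ∘ μ_Q) (P ∘ Λ ∘ Q) : (P ∘ Q) ∘ (P ∘ Q) → P ∘ Q`. -/
def prodOperad (P Q : OperadData F) (Λ : Hom (comp Q.seq P.seq) (comp P.seq Q.seq)) :
    OperadData F where
  seq := comp P.seq Q.seq
  one := insertRight P.seq Q.seq Q.one Unit P.one
  mul := (compMap P.mul Q.mul).comp ((assoc (comp P.seq P.seq) Q.seq Q.seq).comp
    ((compMap (assocInv P.seq P.seq Q.seq) (Hom.id Q.seq)).comp
      ((compMap (compMap (Hom.id P.seq) Λ) (Hom.id Q.seq)).comp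
        ((compMap (assoc P.seq Q.seq P.seq) (Hom.id Q.seq)).comp
          (assocInv (comp P.seq Q.seq) P.seq Q.seq)))))

/-- The unit `V → Γ(P, V)`, `v ↦ 1 ⊗ v ∈ P(1) ⊗ V`. -/
def gammaUnit (P : OperadData F) (V : ModuleCat.{u} F) : V ⟶ (gammaFunctor P.seq).obj V :=
  ModuleCat.ofHom (DirectSum.lof F ℕ (fun n => (gRep P.seq V (Fin n)).invariants) 1 ∘ₗ
    (TensorProduct.mk F _ _ (P.seq.map (Equiv.ofUnique Unit (Fin 1)) P.one) ∘ₗ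
      (PiTensorProduct.subsingletonEquiv (R := F) (s := fun _ : Fin 1 => (V : Type u))
        0).symm.toLinearMap).codRestrict (gRep P.seq V (Fin 1)).invariants fun v σ => by
      rw [Subsingleton.elim σ 1, map_one]; rfl)

/-- The multiplication `P ∘̃ (P ∘̃ V) → (P ∘̃ P) ∘̃ V → (P ∘ P) ∘̃ V → P ∘̃ V` of `Γ(P)`, through
the associator, `Tr⁻¹` and `μ_P`. -/
def gammaMul (P : OperadData F) (V : ModuleCat.{u} F) :
    (gammaFunctor P.seq).obj ((gammaFunctor P.seq).obj V) ⟶ (gammaFunctor P.seq).obj V :=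
  dassoc P.seq P.seq V ≫ gammaNat (traceInv P.seq P.seq) V ≫ gammaNat P.mul V

/-- An endofunctor with candidates for the unit and the multiplication of a monad. -/
structure MonadData (C : Type*) [Category C] where
  T : C ⥤ C
  η : ∀ X : C, X ⟶ T.obj X
  μ : ∀ X : C, T.obj (T.obj X) ⟶ T.obj X

/-- The axioms of a monad. -/
structure MonadData.IsMonad {C : Type*} [Category C] (D : MonadData C) : Prop where
  η_naturality : ∀ {X Y : C} (f : X ⟶ Y), f ≫ D.η Y = D.η X ≫ D.T.map f
  μ_naturality : ∀ {X Y : C} (f : X ⟶ Y), D.T.map (D.T.map f) ≫ D.μ Y = D.μ X ≫ D.T.map f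
  assoc : ∀ X, D.T.map (D.μ X) ≫ D.μ X = D.μ (D.T.obj X) ≫ D.μ X
  left_unit : ∀ X, D.η (D.T.obj X) ≫ D.μ X = 𝟙 _
  right_unit : ∀ X, D.T.map (D.η X) ≫ D.μ X = 𝟙 _

/-- The monad with the given data. -/
def MonadData.IsMonad.toMonad {C : Type*} [Category C] {D : MonadData C} (h : D.IsMonad) :
    Monad C where
  toFunctor := D.T
  η := { app := D.η, naturality := fun _ _ f => h.η_naturality f }
  μ := { app := D.μ, naturality := fun _ _ f => h.μ_naturality f }
  assoc := h.assoc
  left_unit := h.left_unit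
  right_unit := h.right_unit

/-- The endofunctor `Γ(P)` with its unit and its multiplication. -/
def gammaData (P : OperadData F) : MonadData (ModuleCat.{u} F) where
  T := gammaFunctor P.seq
  η := gammaUnit P
  μ := gammaMul P

/-- A distributive law `Λ : T ∘ S → S ∘ T` between monads. -/
structure IsDistributiveLaw {C : Type*} [Category C] (S T : Monad C)
    (Λ : ∀ X : C, T.obj (S.obj X) ⟶ S.obj (T.obj X)) : Prop where
  naturality : ∀ {X Y : C} (f : X ⟶ Y), T.map (S.map f) ≫ Λ Y = Λ X ≫ S.map (T.map f)
  dl₁ : ∀ X, T.map (S.μ.app X) ≫ Λ X = Λ (S.obj X) ≫ S.map (Λ X) ≫ S.μ.app (T.obj X)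
  dl₂ : ∀ X, T.map (S.η.app X) ≫ Λ X = S.η.app (T.obj X)
  dl₃ : ∀ X, T.μ.app (S.obj X) ≫ Λ X = T.map (Λ X) ≫ Λ (T.obj X) ≫ S.map (T.μ.app X)
  dl₄ : ∀ X, T.η.app (S.obj X) ≫ Λ X = S.map (T.η.app X)

/-- The monad `S ∘ T` of a distributive law, with unit `η_S ∘ η_T` and multiplication
`(μ_S ∘ μ_T) (S ∘ Λ ∘ T)`. -/
def IsDistributiveLaw.monad {C : Type*} [Category C] {S T : Monad C}
    {Λ : ∀ X : C, T.obj (S.obj X) ⟶ S.obj (T.obj X)} (h : IsDistributiveLaw S T Λ) : Monad C where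
  toFunctor := T.toFunctor ⋙ S.toFunctor
  η := { app := fun X => T.η.app X ≫ S.η.app (T.obj X)
         naturality := fun X Y f => by
          change f ≫ T.η.app Y ≫ S.η.app (T.obj Y) =
            (T.η.app X ≫ S.η.app (T.obj X)) ≫ S.map (T.map f)
          rw [T.unit_naturality_assoc, S.unit_naturality, Category.assoc] }
  μ := { app := fun X => S.map (Λ (T.obj X)) ≫ S.μ.app (T.obj (T.obj X)) ≫ S.map (T.μ.app X)
         naturality := fun X Y f => by
          change S.map (T.map (S.map (T.map f))) ≫ S.map (Λ (T.obj Y)) ≫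
              S.μ.app (T.obj (T.obj Y)) ≫ S.map (T.μ.app Y) =
            (S.map (Λ (T.obj X)) ≫ S.μ.app (T.obj (T.obj X)) ≫ S.map (T.μ.app X)) ≫
              S.map (T.map f)
          simp only [Category.assoc]
          rw [← S.map_comp_assoc, h.naturality, S.map_comp_assoc, S.mu_naturality_assoc,
            ← S.map_comp, ← S.map_comp, T.mu_naturality] }
  assoc X := by
    change S.map (T.map (S.map (Λ (T.obj X)) ≫ S.μ.app (T.obj (T.obj X)) ≫ S.map (T.μ.app X))) ≫
        S.map (Λ (T.obj X)) ≫ S.μ.app (T.obj (T.obj X)) ≫ S.map (T.μ.app X) =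
      (S.map (Λ (T.obj (S.obj (T.obj X)))) ≫ S.μ.app (T.obj (T.obj (S.obj (T.obj X)))) ≫
        S.map (T.μ.app (S.obj (T.obj X)))) ≫
        S.map (Λ (T.obj X)) ≫ S.μ.app (T.obj (T.obj X)) ≫ S.map (T.μ.app X)
    have h₁ : T.map (S.map (Λ (T.obj X)) ≫ S.μ.app (T.obj (T.obj X)) ≫ S.map (T.μ.app X)) ≫
        Λ (T.obj X) = Λ (T.obj (S.obj (T.obj X))) ≫ S.map (T.map (Λ (T.obj X))) ≫
          S.map (Λ (T.obj (T.obj X))) ≫ S.μ.app (T.obj (T.obj (T.obj X))) ≫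
            S.map (T.map (T.μ.app X)) := by
      rw [T.map_comp, T.map_comp, Category.assoc, Category.assoc, h.naturality, reassoc_of% h.dl₁,
        reassoc_of% h.naturality]
    rw [← S.map_comp_assoc, h₁]
    simp only [S.map_comp, Category.assoc]
    rw [S.mu_naturality_assoc, reassoc_of% S.assoc, ← S.map_comp (T.map _), T.assoc,
      ← S.map_comp_assoc (T.μ.app (S.obj (T.obj X))), h.dl₃]
    simp only [S.map_comp, Category.assoc, S.mu_naturality_assoc]
  left_unit X := by
    change (T.η.app (S.obj (T.obj X)) ≫ S.η.app (T.obj (S.obj (T.obj X)))) ≫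
      S.map (Λ (T.obj X)) ≫ S.μ.app (T.obj (T.obj X)) ≫ S.map (T.μ.app X) = 𝟙 (S.obj (T.obj X))
    rw [Category.assoc, ← S.unit_naturality_assoc, reassoc_of% h.dl₄, S.left_unit_assoc,
      ← S.map_comp, T.left_unit]
    exact S.map_id _
  right_unit X := by
    change S.map (T.map (T.η.app X ≫ S.η.app (T.obj X))) ≫
      S.map (Λ (T.obj X)) ≫ S.μ.app (T.obj (T.obj X)) ≫ S.map (T.μ.app X) = 𝟙 (S.obj (T.obj X))
    rw [← S.map_comp_assoc, T.map_comp, Category.assoc, h.dl₂, S.map_comp, Category.assoc,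
      S.right_unit_assoc, ← S.map_comp, T.right_unit]
    exact S.map_id _

/-- The structures of `T`-algebra on an object `A`. -/
@[ext]
structure AlgStr {C : Type*} [Category C] (T : Monad C) (A : C) where
  str : T.obj A ⟶ A
  unit : T.η.app A ≫ str = 𝟙 A
  assoc : T.μ.app A ≫ str = T.map str ≫ str

/-- The pairs of an `S`-algebra structure `a : S A → A` and a `T`-algebra structure `b : T A → A`
which satisfy the compatibility relation `b ∘ T a = a ∘ S b ∘ Λ_A : T S A → A` induced by `Λ`. -/
structure CompatStr {C : Type*} [Category C] (S T : Monad C)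
    (Λ : ∀ X : C, T.obj (S.obj X) ⟶ S.obj (T.obj X)) (A : C) where
  left : AlgStr S A
  right : AlgStr T A
  compat : T.map left.str ≫ right.str = Λ A ≫ S.map right.str ≫ left.str

/-- Morphisms of `T`-algebras. -/
def IsAlgHom {C : Type*} [Category C] {T : Monad C} {A B : C} (a : AlgStr T A) (b : AlgStr T B)
    (g : A ⟶ B) : Prop := T.map g ≫ b.str = a.str ≫ g

/-- The map `Λ̃ : Q ∘̃ (P ∘̃ V) → P ∘̃ (Q ∘̃ V)` induced by `Λ`, the composite of
* the units, to `P ∘̃ (Q ∘̃ (P ∘̃ (Q ∘̃ V)))`;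
* three associators, to `((P ∘̃ Q) ∘̃ (P ∘̃ Q)) ∘̃ V`;
* `(Tr⁻¹ ∘̃ Tr⁻¹) ∘̃ V`, to `((P ∘ Q) ∘̃ (P ∘ Q)) ∘̃ V`;
* `Tr⁻¹ ∘̃ V` and the multiplication of the operad `P ∘ Q`, to `(P ∘ Q) ∘̃ V`;
* `Tr ∘̃ V` and the inverse associator, to `P ∘̃ (Q ∘̃ V)`. -/
def gammaLaw (P Q : OperadData F) (Λ : Hom (comp Q.seq P.seq) (comp P.seq Q.seq))
    (V : ModuleCat.{u} F) :
    (gammaFunctor Q.seq).obj ((gammaFunctor P.seq).obj V) ⟶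
      (gammaFunctor P.seq).obj ((gammaFunctor Q.seq).obj V) :=
  (gammaFunctor Q.seq).map ((gammaFunctor P.seq).map (gammaUnit Q V)) ≫
  gammaUnit P _ ≫
  dassoc P.seq Q.seq ((gammaFunctor P.seq).obj ((gammaFunctor Q.seq).obj V)) ≫
  (gammaFunctor (dcomp P.seq Q.seq)).map (dassoc P.seq Q.seq V) ≫
  dassoc (dcomp P.seq Q.seq) (dcomp P.seq Q.seq) V ≫
  gammaNat (dcompMap (traceInv P.seq Q.seq) (traceInv P.seq Q.seq)) V ≫
  gammaNat (traceInv (comp P.seq Q.seq) (comp P.seq Q.seq)) V ≫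
  gammaNat (prodOperad P Q Λ).mul V ≫
  gammaNat (trace P.seq Q.seq) V ≫
  dassocInv P.seq Q.seq V

/-- The map `(P ∘ Q) ∘̃ V → (P ∘̃ Q) ∘̃ V → P ∘̃ (Q ∘̃ V)` given by the trace map and the inverse
associator. -/
def gammaProdHom (P Q : OperadData F) (V : ModuleCat.{u} F) :
    (gammaFunctor (comp P.seq Q.seq)).obj V ⟶
      (gammaFunctor P.seq).obj ((gammaFunctor Q.seq).obj V) :=
  gammaNat (trace P.seq Q.seq) V ≫ dassocInv P.seq Q.seq V


end DivPow

end

/-!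
Everything rests on a linear bijection `Θ : Γ(M ∘ N, V) ≅ Γ(M, Γ(N, V))`, defined for `N` reduced.
An element of either side has, for each map `f : S → K` of finite sets, a component in
`M(K) ⊗ ⨂_k (N(f⁻¹(k)) ⊗ V^{⊗ f⁻¹(k)})`, compatibly with relabelling. Both sides embed in the space of
such compatible families (`composite_ext`, `nested_ext`), and both images consist of the families
which vanish for large `S`; when `N` is reduced only surjections contribute, so `K` is bounded as
well (`exists_nested_of_composite`, `exists_composite_of_nested`). On the side of `M ∘ N` this uses
that a surjection has no automorphism over its source: the elements of `(M ∘ N)(S)` are sums over the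
partitions of `S`, and the trace map is bijective. On the side of `Γ(M, Γ(N, V))` no averaging is
available, as the characteristic is arbitrary; over a field there is still a projection onto the
invariants of a finite group which differs from the identity by a combination of the operators
`σ - 1`, and these annihilate the families compatible with relabelling (`DecFamily.map_eq_self`).
The associators of `Γ` are defined by preservation of components, and so `Θ`, which is
`Tr ∘̃ V` followed by an inverse associator, is the map which preserves components.

`Θ` is natural in `M`, `N` and `V`, and compatible with the associators (`thetaMap_assoc`) and with
the units (`thetaMap_insertLeft`, `thetaMap_insertRight`). Hence `Γ` is a strong monoidal functor from
reduced symmetric sequences with `∘` to endofunctors with composition. It is faithful and conservative,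
since `M(n)` with its maps can be read off the multilinear part of `Γ(M, F^n)` (`hom_ext_gammaPair`,
`isIsoHom_of_gammaPair`). The compatibility of `Θ` with the associators then shows that these
are isomorphisms, and a reduced `P` with a unit and a multiplication is an operad if and only if `Γ(P)`
is a monad (`isOperad_iff_isMonad`).

The image of an operadic distributive law `Λ` under this functor is a distributive law of monads,
`Θ⁻¹ Γ(Λ) Θ` (`isDistributiveLaw_lawMap`), which turns out to be `Λ̃` (`gammaLaw_eq_lawMap`): the
multiplication of `P ∘ Q` corresponds under `Θ` to the composite multiplication, and inserting the
outer units into it leaves `Λ` only. The composite monad being a monad, so is `Γ(P ∘ Q)`, and therefore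
`P ∘ Q` is an operad. What is left is Beck's description of the algebras over the composite monad of a
distributive law (`AlgStr.compatEquiv`), transported along the isomorphism of monads `Θ`.
-/

noncomputable section

namespace DivPow

namespace SymSeq

variable {F : Type u} [Field F]

/-! ### Coefficients of elements of `M ∘ N` -/

/-- Relabelling of `M(K) ⊗ ⨂_k N(f⁻¹(k))` along bijections `d`, `e` with `g ∘ d = e ∘ f`. -/
def decMap (M N : SymSeq F) {S T K J : Type} [Finite S] [Finite T] [Finite K] [Finite J]
    (d : S ≃ T) (e : K ≃ J) {f : S → K} {g : T → J} (h : ∀ s, g (d s) = e (f s)) :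
    M.obj K ⊗[F] FibTensor N f →ₗ[F] M.obj J ⊗[F] FibTensor N g :=
  TensorProduct.map (M.map e) (fibMap N d e h)

theorem decMap_tmul (M N : SymSeq F) {S T K J : Type} [Finite S] [Finite T] [Finite K] [Finite J]
    (d : S ≃ T) (e : K ≃ J) {f : S → K} {g : T → J} (h : ∀ s, g (d s) = e (f s))
    (m : M.obj K) (t : FibTensor N f) :
    decMap M N d e h (m ⊗ₜ t) = M.map e m ⊗ₜ fibMap N d e h t := rfl

theorem decMap_refl (M N : SymSeq F) {S K : Type} [Finite S] [Finite K] (f : S → K)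
    (h : ∀ s, f (Equiv.refl S s) = Equiv.refl K (f s)) (x : M.obj K ⊗[F] FibTensor N f) :
    decMap M N (Equiv.refl S) (Equiv.refl K) h x = x := by
  have : M.map (Equiv.refl K) = LinearMap.id := LinearMap.ext (M.map_refl K)
  rw [decMap, fibMap_refl, this, TensorProduct.map_id, LinearMap.id_apply]

theorem decMap_trans (M N : SymSeq F) {S T R K J I : Type} [Finite S] [Finite T] [Finite R]
    [Finite K] [Finite J] [Finite I] (d : S ≃ T) (d' : T ≃ R) (e : K ≃ J) (e' : J ≃ I)
    {f : S → K} {g : T → J} {q : R → I} (h : ∀ s, g (d s) = e (f s)) (h' : ∀ s, q (d' s) = e' (g s))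
    (h'' : ∀ s, q (d.trans d' s) = e.trans e' (f s)) (x : M.obj K ⊗[F] FibTensor N f) :
    decMap M N (d.trans d') (e.trans e') h'' x = decMap M N d' e' h' (decMap M N d e h x) := by
  have : M.map (e.trans e') = M.map e' ∘ₗ M.map e := LinearMap.ext (M.map_trans e e')
  rw [decMap, fibMap_trans N d d' e e' h h' h'', this, TensorProduct.map_comp]; rfl

theorem decMap_symm_decMap (M N : SymSeq F) {S T K J : Type} [Finite S] [Finite T] [Finite K]
    [Finite J] (d : S ≃ T) (e : K ≃ J) {f : S → K} {g : T → J} (h : ∀ s, g (d s) = e (f s))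
    (h' : ∀ s, f (d.symm s) = e.symm (g s)) (x : M.obj K ⊗[F] FibTensor N f) :
    decMap M N d.symm e.symm h' (decMap M N d e h x) = x := by
  have h2 : ∀ s, f ((d.trans d.symm) s) = (e.trans e.symm) (f s) := by simp
  rw [← decMap_trans M N d d.symm e e.symm h h' h2]
  have key : ∀ (d₁ : S ≃ S) (e₁ : K ≃ K) (h₁ : ∀ s, f (d₁ s) = e₁ (f s)),
      d₁ = Equiv.refl S → e₁ = Equiv.refl K → decMap M N d₁ e₁ h₁ x = x := by
    rintro _ _ h₁ rfl rfl
    exact decMap_refl M N f h₁ x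
  exact key _ _ h2 (Equiv.self_trans_symm d) (Equiv.self_trans_symm e)

theorem elt_decMap (M N : SymSeq F) {S T K J : Type} [Finite S] [Finite T] [Finite K] [Finite J]
    (d : S ≃ T) (e : K ≃ J) {f : S → K} {g : T → J} (h : ∀ s, g (d s) = e (f s))
    (x : M.obj K ⊗[F] FibTensor N f) :
    elt M N g (decMap M N d e h x) = (comp M N).map d (elt M N f x) :=
  LinearMap.congr_fun (f := elt M N g ∘ₗ decMap M N d e h)
    (g := (comp M N).map d ∘ₗ elt M N f) (TensorProduct.ext' fun m t => elt_map M N d e f g h m t) x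

theorem elt_decMap_refl (M N : SymSeq F) {S K J : Type} [Finite S] [Finite K] [Finite J]
    (e : K ≃ J) {f : S → K} {g : S → J} (h : ∀ s, g (Equiv.refl S s) = e (f s))
    (x : M.obj K ⊗[F] FibTensor N f) :
    elt M N g (decMap M N (Equiv.refl S) e h x) = elt M N f x := by
  rw [elt_decMap, (comp M N).map_refl]

/-- Linear maps out of `M ∘ N` are determined on classes of decorated maps to finite sets. -/
theorem comp_ext_elt {M N : SymSeq F} {S : Type} [Finite S] {W : Type u} [AddCommGroup W]
    [Module F W] {φ ψ : (comp M N).obj S →ₗ[F] W}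
    (h : ∀ (k : ℕ) (f : S → Fin k) (m : M.obj (Fin k)) (n : ∀ i, N.obj (Fib f i)),
      φ (elt M N f (m ⊗ₜ PiTensorProduct.tprod F n)) =
        ψ (elt M N f (m ⊗ₜ PiTensorProduct.tprod F n))) : φ = ψ :=
  comp_ext fun k f m n => by
    have := h k f m n
    rwa [elt_eq_cls] at this

/-- A pure tensor with a vanishing factor vanishes, so `N(∅) = 0` kills the decorations of a
map that misses a point. -/
theorem IsReduced.subsingleton_fibTensor {N : SymSeq F} (hN : N.IsReduced) {S K : Type} [Finite S]
    {f : S → K} (hf : ¬ Function.Surjective f) : Subsingleton (FibTensor N f) := by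
  obtain ⟨k, hk⟩ := not_forall.1 hf
  have := hN (Fib f k) ⟨fun s => hk ⟨s.1, s.2⟩⟩
  have h : (LinearMap.id : FibTensor N f →ₗ[F] FibTensor N f) = 0 := tensor_ext fun n => by
    exact (PiTensorProduct.tprod F).map_coord_zero k (Subsingleton.elim _ _)
  exact ⟨fun x y => (LinearMap.congr_fun h x).trans (LinearMap.congr_fun h y).symm⟩

theorem IsReduced.subsingleton_dec (M : SymSeq F) {N : SymSeq F} (hN : N.IsReduced) {S K : Type}
    [Finite S] [Finite K] {f : S → K} (hf : ¬ Function.Surjective f) :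
    Subsingleton (M.obj K ⊗[F] FibTensor N f) := by
  have := hN.subsingleton_fibTensor hf
  have h : (LinearMap.id : M.obj K ⊗[F] FibTensor N f →ₗ[F] _) = 0 :=
    TensorProduct.ext' fun m t => by
      rw [Subsingleton.elim t 0, TensorProduct.tmul_zero, map_zero, map_zero]
  exact ⟨fun x y => (LinearMap.congr_fun h x).trans (LinearMap.congr_fun h y).symm⟩

/-- Surjections with the same kernel differ by a bijection of their targets. -/
theorem exists_equiv_of_ker_eq {S K J : Type} {g : S → J} {f : S → K}
    (hg : Function.Surjective g) (hf : Function.Surjective f)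
    (h : ∀ s t, g s = g t ↔ f s = f t) : ∃ e : J ≃ K, ∀ s, f (Equiv.refl S s) = e (g s) := by
  choose a ha using hg
  choose b hb using hf
  refine ⟨⟨fun j => f (a j), fun k => g (b k), fun j => ?_, fun k => ?_⟩, fun s => ?_⟩
  · rw [← ha j, h, ha, hb]
  · dsimp only
    rw [← hb k, ← h, hb, ha]
  · exact (h _ _).1 (ha (g s)).symm

/-- The component of an element of `(M ∘̃ N)(S)` in `M(k) ⊗ N^{⊠ k}(S)`. -/
def dcompCoeff (M N : SymSeq F) (S : Type) [Finite S] (k : ℕ) :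
    (dcomp M N).obj S →ₗ[F] Pre M N S (Fin k) :=
  (preRep M N S (Fin k)).invariants.subtype ∘ₗ
    DirectSum.component F ℕ (fun k => (preRep M N S (Fin k)).invariants) k

open scoped Classical in
theorem preCoeff_apply (M N : SymSeq F) {S : Type} [Finite S] {k : ℕ} (f : S → Fin k)
    (y : (dcomp M N).obj S) : preCoeff M N f y =
      (DirectSum.component F (S → Fin k) (fun f => FibTensor N f) f).lTensor (M.obj (Fin k))
        (dcompCoeff M N S k y) := rfl

open scoped Classical in
theorem dcompCoeff_trace_elt (M N : SymSeq F) {S : Type} [Finite S] {k : ℕ} (g : S → Fin k)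
    (m : M.obj (Fin k)) (t : FibTensor N g) :
    dcompCoeff M N S k ((trace M N).app S (elt M N g (m ⊗ₜ t))) =
      ∑ σ, preRep M N S (Fin k) σ (m ⊗ₜ DirectSum.lof F _ (fun f => FibTensor N f) g t) := by
  rw [elt_eq_cls]
  have h1 : (trace M N).app S (cls M N g (m ⊗ₜ t)) = DirectSum.lof F ℕ
      (fun k => (preRep M N S (Fin k)).invariants) k (preNorm M N S (Fin k)
        (Representation.Coinvariants.mk _ (m ⊗ₜ DirectSum.lof F _ _ g t))) :=
    DirectSum.lmap_lof _ _ _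
  rw [h1]
  refine (congrArg Subtype.val (DirectSum.component.lof_self F
    (M := fun k => (preRep M N S (Fin k)).invariants) k _)).trans ?_
  rw [coe_preNorm_mk]

theorem dcompCoeff_trace_elt_of_ne (M N : SymSeq F) {S : Type} [Finite S] {k k' : ℕ} (hk : k' ≠ k)
    (g : S → Fin k') (m : M.obj (Fin k')) (t : FibTensor N g) :
    dcompCoeff M N S k ((trace M N).app S (elt M N g (m ⊗ₜ t))) = 0 := by
  classical
  rw [elt_eq_cls]
  have h1 : (trace M N).app S (cls M N g (m ⊗ₜ t)) = DirectSum.lof F ℕ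
      (fun k => (preRep M N S (Fin k)).invariants) k' (preNorm M N S (Fin k')
        (Representation.Coinvariants.mk _ (m ⊗ₜ DirectSum.lof F _ _ g t))) :=
    DirectSum.lmap_lof _ _ _
  rw [h1]
  refine (congrArg Subtype.val (DirectSum.component.of F
    (M := fun k => (preRep M N S (Fin k)).invariants) k k' _)).trans ?_
  rw [dif_neg hk]; rfl

open scoped Classical in
/-- The component of `∑_σ σ (m ⊗ t)` at `f` collects the `σ` with `f = σ ∘ g`. -/
theorem preCoeff_trace_elt (M N : SymSeq F) {S : Type} [Finite S] {k : ℕ} (f g : S → Fin k)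
    (m : M.obj (Fin k)) (t : FibTensor N g) :
    preCoeff M N f ((trace M N).app S (elt M N g (m ⊗ₜ t))) =
      ∑ σ : Equiv.Perm (Fin k), if h : ∀ s, f (Equiv.refl S s) = σ (g s) then
        decMap M N (Equiv.refl S) σ h (m ⊗ₜ t) else 0 := by
  rw [preCoeff_apply, dcompCoeff_trace_elt, map_sum]
  refine Finset.sum_congr rfl fun σ _ => ?_
  obtain ⟨q, hq⟩ : ∃ q : S → Fin k, ∀ s, q (Equiv.refl S s) = σ (g s) := ⟨fun s => σ (g s), fun _ => rfl⟩
  rw [preRep_lof M N σ g q hq, LinearMap.lTensor_tmul]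
  split_ifs with h
  · obtain rfl : q = f := funext fun s => (hq s).trans (h s).symm
    rw [DirectSum.component.lof_self, decMap_tmul]
  · rw [DirectSum.component.of, dif_neg, TensorProduct.tmul_zero]
    rintro rfl
    exact h hq

theorem preCoeff_trace_elt_of_ne (M N : SymSeq F) {S : Type} [Finite S] {k k' : ℕ} (hk : k' ≠ k)
    (f : S → Fin k) (g : S → Fin k') (m : M.obj (Fin k')) (t : FibTensor N g) :
    preCoeff M N f ((trace M N).app S (elt M N g (m ⊗ₜ t))) = 0 := by
  rw [preCoeff_apply, dcompCoeff_trace_elt_of_ne M N hk, map_zero]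

/-- The coefficient of an element of `(M ∘ N)(S)` at `f : S → K`: the component at `f` of its
image under the trace map, transported from `{1, …, |K|}` to `K`. -/
def coef (M N : SymSeq F) {S K : Type} [Finite S] [Finite K] (f : S → K) :
    (comp M N).obj S →ₗ[F] M.obj K ⊗[F] FibTensor N f :=
  decMap M N (Equiv.refl S) (Finite.equivFin K).symm
      (fun s => ((Finite.equivFin K).symm_apply_apply (f s)).symm) ∘ₗ
    preCoeff M N (fun s => Finite.equivFin K (f s)) ∘ₗ (trace M N).app S

/-- The class of a decorated surjection `f` has coefficient its decoration at `f`. -/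
theorem preCoeff_trace_elt_self (M N : SymSeq F) {S : Type} [Finite S] {k : ℕ} {f : S → Fin k}
    (hf : Function.Surjective f) (x : M.obj (Fin k) ⊗[F] FibTensor N f) :
    preCoeff M N f ((trace M N).app S (elt M N f x)) = x := by
  classical
  refine LinearMap.congr_fun (f := preCoeff M N f ∘ₗ (trace M N).app S ∘ₗ elt M N f)
    (g := LinearMap.id) (TensorProduct.ext' fun m t => ?_) x
  rw [LinearMap.comp_apply, LinearMap.comp_apply, preCoeff_trace_elt,
    Finset.sum_eq_single (Equiv.refl _)]
  · have h : ∀ s, f (Equiv.refl S s) = Equiv.refl (Fin k) (f s) := fun _ => rfl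
    rw [dif_pos h, decMap_refl]; rfl
  · intro σ _ hσ
    rw [dif_neg]
    intro h
    refine hσ (Equiv.ext fun i => ?_)
    obtain ⟨s, rfl⟩ := hf i
    exact (h s).symm
  · exact fun h => absurd (Finset.mem_univ _) h

theorem preCoeff_trace_elt_eq_zero (M N : SymSeq F) {S : Type} [Finite S] {k k' : ℕ}
    (f : S → Fin k) (g : S → Fin k') (h : ¬ ∀ s t, g s = g t ↔ f s = f t)
    (x : M.obj (Fin k') ⊗[F] FibTensor N g) :
    preCoeff M N f ((trace M N).app S (elt M N g x)) = 0 := by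
  classical
  refine LinearMap.congr_fun (f := preCoeff M N f ∘ₗ (trace M N).app S ∘ₗ elt M N g)
    (g := 0) (TensorProduct.ext' fun m t => ?_) x
  rw [LinearMap.comp_apply, LinearMap.comp_apply, LinearMap.zero_apply]
  by_cases hk : k' = k
  · subst hk
    rw [preCoeff_trace_elt]
    refine Finset.sum_eq_zero fun σ _ => dif_neg fun hσ => h fun s t => ?_
    have h1 := hσ s
    have h2 := hσ t
    simp only [Equiv.refl_apply] at h1 h2
    rw [h1, h2, σ.apply_eq_iff_eq]
  · exact preCoeff_trace_elt_of_ne M N hk f g m t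

theorem coef_elt_self (M : SymSeq F) {N : SymSeq F} (hN : N.IsReduced) {S K : Type} [Finite S]
    [Finite K] (f : S → K) (x : M.obj K ⊗[F] FibTensor N f) : coef M N f (elt M N f x) = x := by
  by_cases hf : Function.Surjective f
  · have h : ∀ s, (fun s => Finite.equivFin K (f s)) (Equiv.refl S s) = Finite.equivFin K (f s) :=
      fun _ => rfl
    rw [← elt_decMap_refl M N (g := fun s => Finite.equivFin K (f s)) (Finite.equivFin K) h, coef, LinearMap.comp_apply,
      LinearMap.comp_apply, preCoeff_trace_elt_self M N (f := fun s => Finite.equivFin K (f s))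
        ((Finite.equivFin K).surjective.comp hf)]
    exact decMap_symm_decMap M N (Equiv.refl S) (Finite.equivFin K) h _ x
  · have := hN.subsingleton_dec M hf
    exact Subsingleton.elim _ _

theorem coef_elt_eq_zero (M N : SymSeq F) {S K J : Type} [Finite S] [Finite K] [Finite J]
    (f : S → K) (g : S → J) (h : ¬ ∀ s t, g s = g t ↔ f s = f t) (x : M.obj J ⊗[F] FibTensor N g) :
    coef M N f (elt M N g x) = 0 := by
  have h' : ∀ s, (fun s => Finite.equivFin J (g s)) (Equiv.refl S s) = Finite.equivFin J (g s) :=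
    fun _ => rfl
  rw [← elt_decMap_refl M N (g := fun s => Finite.equivFin J (g s)) (Finite.equivFin J) h', coef, LinearMap.comp_apply,
    LinearMap.comp_apply, preCoeff_trace_elt_eq_zero, map_zero]
  simpa only [EmbeddingLike.apply_eq_iff_eq] using h

/-- For `N` reduced, the class of a decorated map `g` which defines the same partition as the
surjection `f` is zero or the class of a decoration of `f`. -/
theorem exists_elt_eq_or (M : SymSeq F) {N : SymSeq F} (hN : N.IsReduced) {S K J : Type} [Finite S]
    [Finite K] [Finite J] (f : S → K) (hf : Function.Surjective f) (g : S → J) (m : M.obj J)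
    (n : ∀ i, N.obj (Fib g i)) :
    (¬ (∀ s t, g s = g t ↔ f s = f t)) ∨ elt M N g (m ⊗ₜ PiTensorProduct.tprod F n) = 0 ∨
      ∃ (m' : M.obj K) (n' : ∀ i, N.obj (Fib f i)),
        elt M N g (m ⊗ₜ PiTensorProduct.tprod F n) = elt M N f (m' ⊗ₜ PiTensorProduct.tprod F n') := by
  by_cases hg : Function.Surjective g
  · by_cases h : ∀ s t, g s = g t ↔ f s = f t
    · obtain ⟨e, he⟩ := exists_equiv_of_ker_eq hg hf h
      refine Or.inr (Or.inr ⟨M.map e m, fun j => N.map (fibEquiv (Equiv.refl S) e he j) (n (e.symm j)), ?_⟩)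
      rw [← elt_decMap_refl M N e he, decMap_tmul, fibMap_tprod]
    · exact Or.inl h
  · have := hN.subsingleton_dec M hg
    exact Or.inr (Or.inl (by rw [Subsingleton.elim (m ⊗ₜ[F] PiTensorProduct.tprod F n) 0, map_zero]))

theorem coef_map (M : SymSeq F) {N : SymSeq F} (hN : N.IsReduced) {S T K J : Type} [Finite S]
    [Finite T] [Finite K] [Finite J] (d : S ≃ T) (e : K ≃ J) {f : S → K} {g : T → J}
    (h : ∀ s, g (d s) = e (f s)) (z : (comp M N).obj S) :
    coef M N g ((comp M N).map d z) = decMap M N d e h (coef M N f z) := by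
  by_cases hf : Function.Surjective f
  · refine LinearMap.congr_fun (f := coef M N g ∘ₗ (comp M N).map d)
      (g := decMap M N d e h ∘ₗ coef M N f) (comp_ext_elt fun k a m n => ?_) z
    simp only [LinearMap.comp_apply]
    obtain hne | h0 | ⟨m', n', heq⟩ := exists_elt_eq_or M hN f hf a m n
    · rw [coef_elt_eq_zero M N f a hne, map_zero]
      have ha : ∀ s, (fun t => a (d.symm t)) (d s) = Equiv.refl _ (a s) := by simp
      rw [← elt_decMap M N (g := fun t => a (d.symm t)) d (Equiv.refl _) ha, coef_elt_eq_zero]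
      intro h2
      refine hne fun s t => ?_
      have := h2 (d s) (d t)
      simpa [h] using this
    · rw [h0]; simp only [map_zero]
    · rw [heq, ← elt_decMap M N d e h, coef_elt_self M hN, coef_elt_self M hN]
  · have hg : ¬ Function.Surjective g := fun hg => hf fun k => by
      obtain ⟨t, ht⟩ := hg (e k)
      refine ⟨d.symm t, e.injective ?_⟩
      rw [← h, Equiv.apply_symm_apply, ht]
    have := hN.subsingleton_dec M hg
    exact Subsingleton.elim _ _

instance finite_setoid (S : Type) [Finite S] : Finite (Setoid S) :=
  Finite.of_injective (fun r : Setoid S => r.r) fun _ _ h => Setoid.ext fun a b =>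
    iff_of_eq (congrFun (congrFun h a) b)

/-- For `N` reduced, an element of `(M ∘ N)(S)` is the sum, over the partitions of `S`, of the
classes of its coefficients. -/
theorem sum_elt_coef (M : SymSeq F) {N : SymSeq F} (hN : N.IsReduced) {S : Type} [Finite S]
    [Fintype (Setoid S)] :
    ∑ r : Setoid S, elt M N (Quotient.mk r) ∘ₗ coef M N (Quotient.mk r) = LinearMap.id := by
  classical
  refine comp_ext_elt fun k a m n => ?_
  rw [LinearMap.sum_apply, LinearMap.id_apply]
  rw [Finset.sum_eq_single (Setoid.ker a)]
  · have hs : Function.Surjective (Quotient.mk (Setoid.ker a)) := Quotient.mk_surjective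
    obtain hne | h0 | ⟨m', n', heq⟩ := exists_elt_eq_or M hN _ hs a m n
    · refine absurd (fun s t => ?_) hne
      exact (Quotient.eq (r := Setoid.ker a)).symm
    · rw [h0, map_zero]
    · rw [heq, LinearMap.comp_apply, coef_elt_self M hN]
  · intro r _ hr
    rw [LinearMap.comp_apply, coef_elt_eq_zero, map_zero]
    intro h
    refine hr (Setoid.ext fun s t => ?_)
    rw [Setoid.ker_def, h, Quotient.eq]
  · exact fun h => absurd (Finset.mem_univ _) h

theorem comp_ext_coef (M : SymSeq F) {N : SymSeq F} (hN : N.IsReduced) {S : Type} [Finite S]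
    {z w : (comp M N).obj S} (h : ∀ (k : ℕ) (f : S → Fin k), coef M N f z = coef M N f w) :
    z = w := by
  have := Fintype.ofFinite (Setoid S)
  have key : ∀ r : Setoid S, coef M N (Quotient.mk r) z = coef M N (Quotient.mk r) w := fun r => by
    obtain ⟨k, ⟨e⟩⟩ := Finite.exists_equiv_fin (Quotient r)
    have hh : ∀ s, Quotient.mk r (Equiv.refl S s) = e.symm (e (Quotient.mk r s)) := by simp
    have h1 := coef_map M hN (Equiv.refl S) e.symm hh z
    have h2 := coef_map M hN (Equiv.refl S) e.symm hh w
    rw [(comp M N).map_refl] at h1 h2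
    rw [h1, h2, h]
  have h1 := LinearMap.congr_fun (sum_elt_coef M hN (S := S)) z
  have h2 := LinearMap.congr_fun (sum_elt_coef M hN (S := S)) w
  rw [LinearMap.sum_apply] at h1 h2
  refine h1.symm.trans (Eq.trans (Finset.sum_congr rfl fun r _ => ?_) h2)
  rw [LinearMap.comp_apply, LinearMap.comp_apply, key]

/-! ### The trace map is an isomorphism -/

theorem coef_elt_of_equiv (M : SymSeq F) {N : SymSeq F} (hN : N.IsReduced) {S K J : Type} [Finite S]
    [Finite K] [Finite J] {f : S → K} {g : S → J} (e : J ≃ K)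
    (h : ∀ s, f (Equiv.refl S s) = e (g s)) (x : M.obj J ⊗[F] FibTensor N g) :
    coef M N f (elt M N g x) = decMap M N (Equiv.refl S) e h x := by
  rw [← elt_decMap_refl M N e h, coef_elt_self M hN]

theorem coef_elt_quotient_eq_zero (M N : SymSeq F) {S K : Type} [Finite S] [Finite K] (f : S → K)
    {r : Setoid S} (hr : r ≠ Setoid.ker f) :
    coef M N f ∘ₗ elt M N (Quotient.mk r) = 0 := by
  refine LinearMap.ext fun x => coef_elt_eq_zero M N f _ (fun h => hr ?_) x
  refine Setoid.ext fun s t => ?_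
  rw [Setoid.ker_def, ← h, Quotient.eq]

theorem exists_equiv_quotient_ker {S K : Type} {f : S → K} (hf : Function.Surjective f) :
    ∃ e : Quotient (Setoid.ker f) ≃ K, ∀ s, f (Equiv.refl S s) = e (Quotient.mk (Setoid.ker f) s) :=
  exists_equiv_of_ker_eq Quotient.mk_surjective hf fun _ _ => Quotient.eq (r := Setoid.ker f)

open scoped Classical in
/-- The components of `σ w` are those of `w`, relabelled and permuted. -/
theorem component_preRep (M N : SymSeq F) {S : Type} [Finite S] {k : ℕ} (σ : Equiv.Perm (Fin k))
    {f g : S → Fin k} (h : ∀ s, g (Equiv.refl S s) = σ (f s)) (w : Pre M N S (Fin k)) :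
    (DirectSum.component F (S → Fin k) (fun f => FibTensor N f) g).lTensor (M.obj (Fin k))
        (preRep M N S (Fin k) σ w) = decMap M N (Equiv.refl S) σ h
      ((DirectSum.component F (S → Fin k) (fun f => FibTensor N f) f).lTensor (M.obj (Fin k)) w) := by
  refine LinearMap.congr_fun (f := (DirectSum.component F (S → Fin k) (fun f => FibTensor N f) g).lTensor
      (M.obj (Fin k)) ∘ₗ preRep M N S (Fin k) σ) (g := decMap M N (Equiv.refl S) σ h ∘ₗ
        (DirectSum.component F (S → Fin k) (fun f => FibTensor N f) f).lTensor (M.obj (Fin k)))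
    (TensorProduct.ext (LinearMap.ext fun m => DirectSum.linearMap_ext F fun a =>
      LinearMap.ext fun t => ?_)) w
  simp only [LinearMap.compr₂ₛₗ_apply, LinearMap.comp_apply, TensorProduct.mk_apply]
  obtain ⟨b, hb⟩ : ∃ b : S → Fin k, ∀ s, b (Equiv.refl S s) = σ (a s) := ⟨fun s => σ (a s), fun _ => rfl⟩
  rw [preRep_lof M N σ a b hb, LinearMap.lTensor_tmul, LinearMap.lTensor_tmul]
  by_cases ha : a = f
  · subst ha
    obtain rfl : b = g := funext fun s => (hb s).trans (h s).symm
    rw [DirectSum.component.lof_self, DirectSum.component.lof_self, decMap_tmul]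
  · have hbg : b ≠ g := by
      rintro rfl
      exact ha (funext fun s => σ.injective ((hb s).symm.trans (h s)))
    rw [DirectSum.component.of, DirectSum.component.of, dif_neg ha, dif_neg hbg,
      TensorProduct.tmul_zero, TensorProduct.tmul_zero, map_zero]

theorem preCoeff_perm (M N : SymSeq F) {S : Type} [Finite S] {k : ℕ} (σ : Equiv.Perm (Fin k))
    {f g : S → Fin k} (h : ∀ s, g (Equiv.refl S s) = σ (f s)) (y : (dcomp M N).obj S) :
    preCoeff M N g y = decMap M N (Equiv.refl S) σ h (preCoeff M N f y) := by
  rw [preCoeff_apply, preCoeff_apply, ← component_preRep M N σ h]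
  congr 1
  exact ((DirectSum.component F ℕ (fun k => (preRep M N S (Fin k)).invariants) k y).2 σ).symm

theorem dcomp_ext_preCoeff (M N : SymSeq F) {S : Type} [Finite S] {y z : (dcomp M N).obj S}
    (h : ∀ (k : ℕ) (f : S → Fin k), preCoeff M N f y = preCoeff M N f z) : y = z := by
  classical
  have hext : ∀ k, dcompCoeff M N S k y = dcompCoeff M N S k z := fun k => by
    have := Fintype.ofFinite (S → Fin k)
    have key : ∑ f : S → Fin k, (DirectSum.lof F (S → Fin k) (fun f => FibTensor N f) f).lTensor
        (M.obj (Fin k)) ∘ₗ (DirectSum.component F (S → Fin k) (fun f => FibTensor N f) f).lTensor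
        (M.obj (Fin k)) = LinearMap.id := by
      refine TensorProduct.ext (LinearMap.ext fun m => DirectSum.linearMap_ext F fun a =>
        LinearMap.ext fun t => ?_)
      simp only [LinearMap.compr₂ₛₗ_apply, LinearMap.comp_apply, TensorProduct.mk_apply,
        LinearMap.sum_apply, LinearMap.id_apply, LinearMap.lTensor_tmul]
      rw [Finset.sum_eq_single a]
      · rw [DirectSum.component.lof_self]
      · intro b _ hb
        rw [DirectSum.component.of, dif_neg hb.symm, map_zero, TensorProduct.tmul_zero]
      · exact fun h => absurd (Finset.mem_univ _) h
    have h1 := LinearMap.congr_fun key (dcompCoeff M N S k y)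
    have h2 := LinearMap.congr_fun key (dcompCoeff M N S k z)
    rw [LinearMap.sum_apply] at h1 h2
    refine h1.symm.trans (Eq.trans (Finset.sum_congr rfl fun f _ => ?_) h2)
    have := h k f
    rw [preCoeff_apply, preCoeff_apply] at this
    rw [LinearMap.comp_apply, LinearMap.comp_apply]
    congr 1
  exact DirectSum.ext_component F (M := fun k => (preRep M N S (Fin k)).invariants)
    fun k => Subtype.ext (hext k)

theorem coef_fin (M N : SymSeq F) {S : Type} [Finite S] {k : ℕ} (f : S → Fin k)
    (z : (comp M N).obj S) : coef M N f z = preCoeff M N f ((trace M N).app S z) := by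
  rw [coef, LinearMap.comp_apply, LinearMap.comp_apply]
  have hk : Nat.card (Fin k) = k := Nat.card_eq_fintype_card.trans (Fintype.card_fin k)
  have key : ∀ (j : ℕ) (e : Fin k ≃ Fin j) (_ : j = k)
      (h : ∀ s, f (Equiv.refl S s) = e.symm (e (f s))),
      decMap M N (Equiv.refl S) e.symm h
        (preCoeff M N (fun s => e (f s)) ((trace M N).app S z)) =
      preCoeff M N f ((trace M N).app S z) := by
    rintro j e rfl h
    exact (preCoeff_perm M N e.symm h _).symm
  exact key _ _ hk _

/-- An element of the invariants is the trace of the sum, over the partitions of `S`, of the classes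
of its components. -/
theorem bijective_trace_app (M : SymSeq F) {N : SymSeq F} (hN : N.IsReduced) (S : Type) [Finite S] :
    Function.Bijective ((trace M N).app S) := by
  classical
  refine ⟨fun z w h => comp_ext_coef M hN fun k f => ?_, fun y => ?_⟩
  · rw [coef_fin, coef_fin, h]
  · have := Fintype.ofFinite (Setoid S)
    have hq : ∀ r : Setoid S, ∀ s, Quotient.mk r (Equiv.refl S s) =
        (Finite.equivFin (Quotient r)).symm (Finite.equivFin (Quotient r) (Quotient.mk r s)) := by
      simp
    refine ⟨∑ r : Setoid S, elt M N (Quotient.mk r) (decMap M N (Equiv.refl S)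
      (Finite.equivFin (Quotient r)).symm (hq r)
        (preCoeff M N (fun s => Finite.equivFin (Quotient r) (Quotient.mk r s)) y)),
      dcomp_ext_preCoeff M N fun k f => ?_⟩
    rw [← coef_fin, map_sum]
    by_cases hf : Function.Surjective f
    · rw [Finset.sum_eq_single (Setoid.ker f)]
      · obtain ⟨e, he⟩ := exists_equiv_quotient_ker hf
        rw [coef_elt_of_equiv M hN e he]
        have hc : ∀ s, f (Equiv.refl S s) = ((Finite.equivFin (Quotient (Setoid.ker f))).symm.trans e)
            (Finite.equivFin (Quotient (Setoid.ker f)) (Quotient.mk (Setoid.ker f) s)) := fun s => by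
          simpa using he s
        rw [← decMap_trans M N (Equiv.refl S) (Equiv.refl S) _ e (hq _) he hc]
        have key : ∀ (j : ℕ) (a : Quotient (Setoid.ker f) ≃ Fin j) (_ : j = k)
          (h : ∀ s, f (Equiv.refl S s) = (a.symm.trans e) (a (Quotient.mk (Setoid.ker f) s))),
          decMap M N (Equiv.refl S) (a.symm.trans e) h
            (preCoeff M N (fun s => a (Quotient.mk (Setoid.ker f) s)) y) =
          preCoeff M N f y := by
          rintro j a rfl h
          exact (preCoeff_perm M N (a.symm.trans e) h _).symm
        exact key _ _ ((Nat.card_congr e).trans (Nat.card_eq_fintype_card.trans (Fintype.card_fin k))) _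
      · intro r _ hr
        exact LinearMap.congr_fun (coef_elt_quotient_eq_zero M N f hr) _
      · exact fun h => absurd (Finset.mem_univ _) h
    · have := hN.subsingleton_dec M hf
      exact Subsingleton.elim _ _

theorem isIsoHom_trace (M : SymSeq F) {N : SymSeq F} (hN : N.IsReduced) : IsIsoHom (trace M N) :=
  fun S _ => bijective_trace_app M hN S

/-! ### Regrouping tensor factors -/

/-- The pairing `⨂_k A_k ⊗ ⨂_s B_s → ⨂_k (A_k ⊗ ⨂_{s ∈ f⁻¹(k)} B_s)`. -/
def zipFam {S K : Type} (f : S → K) (A : K → Type u) (B : S → Type u)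
    [∀ k, AddCommGroup (A k)] [∀ k, Module F (A k)] [∀ s, AddCommGroup (B s)]
    [∀ s, Module F (B s)] :
    PiTensorProduct F A →ₗ[F] PiTensorProduct F B →ₗ[F]
      PiTensorProduct F fun k => A k ⊗[F] PiTensorProduct F fun s : Fib f k => B s :=
  (PiTensorProduct.map₂ fun k => TensorProduct.mk F (A k)
    (PiTensorProduct F fun s : Fib f k => B s)).compl₂ (splitTensor f B)

section zip

variable {S K : Type} (f : S → K) (A : K → Type u) (B : S → Type u)
    [∀ k, AddCommGroup (A k)] [∀ k, Module F (A k)] [∀ s, AddCommGroup (B s)]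
    [∀ s, Module F (B s)] (X : Type u) [AddCommGroup X] [Module F X]

theorem zipFam_tprod (a : ∀ k, A k) (b : ∀ s, B s) :
    zipFam (F := F) f A B (PiTensorProduct.tprod F a) (PiTensorProduct.tprod F b) =
      PiTensorProduct.tprod F fun k => a k ⊗ₜ PiTensorProduct.tprod F fun s : Fib f k => b s := by
  rw [zipFam, LinearMap.compl₂_apply, splitTensor_tprod, PiTensorProduct.map₂_tprod_tprod]
  rfl

/-- Tensor products of bases are matched by regrouping, so regrouping is bijective. -/
theorem bijective_lift_zipFam [Finite S] [Finite K] :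
    Function.Bijective (TensorProduct.lift (zipFam (F := F) f A B)) := by
  classical
  let bA := fun k => Module.Free.chooseBasis F (A k)
  let bB := fun s => Module.Free.chooseBasis F (B s)
  let b₁ := (Basis.piTensorProduct bA).tensorProduct (Basis.piTensorProduct bB)
  let b₂ := Basis.piTensorProduct fun k =>
    (bA k).tensorProduct (Basis.piTensorProduct fun s : Fib f k => bB s)
  let e : ((∀ k, Module.Free.ChooseBasisIndex F (A k)) ×
      (∀ s, Module.Free.ChooseBasisIndex F (B s))) ≃
      (∀ k, Module.Free.ChooseBasisIndex F (A k) ×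
        ∀ s : Fib f k, Module.Free.ChooseBasisIndex F (B s)) :=
    { toFun := fun p k => (p.1 k, fun s => p.2 s)
      invFun := fun r => (fun k => (r k).1, fun s => (r (f s)).2 ⟨s, rfl⟩)
      left_inv := fun _ => rfl
      right_inv := fun r => funext fun k => Prod.ext rfl (funext fun s => by
        obtain ⟨s, rfl⟩ := s; rfl) }
  have h : TensorProduct.lift (zipFam (F := F) f A B) = (b₁.equiv b₂ e).toLinearMap := by
    refine b₁.ext fun p => ?_
    rw [LinearEquiv.coe_coe, Module.Basis.equiv_apply]
    simp only [b₁, b₂, Module.Basis.tensorProduct_apply', Basis.piTensorProduct_apply,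
      TensorProduct.lift.tmul, zipFam_tprod]
    rfl
  rw [h]
  exact (b₁.equiv b₂ e).bijective

/-- The regrouping `(X ⊗ ⨂_k A_k) ⊗ ⨂_s B_s → X ⊗ ⨂_k (A_k ⊗ ⨂_{s ∈ f⁻¹(k)} B_s)`. -/
def zip : (X ⊗[F] PiTensorProduct F A) ⊗[F] PiTensorProduct F B →ₗ[F]
    X ⊗[F] PiTensorProduct F fun k => A k ⊗[F] PiTensorProduct F fun s : Fib f k => B s :=
  (TensorProduct.lift (zipFam f A B)).lTensor X ∘ₗ (TensorProduct.assoc F _ _ _).toLinearMap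

theorem zip_tmul (x : X) (a : ∀ k, A k) (b : ∀ s, B s) :
    zip (F := F) f A B X ((x ⊗ₜ PiTensorProduct.tprod F a) ⊗ₜ PiTensorProduct.tprod F b) =
      x ⊗ₜ PiTensorProduct.tprod F fun k => a k ⊗ₜ PiTensorProduct.tprod F fun s : Fib f k => b s := by
  rw [← zipFam_tprod]; rfl

theorem bijective_zip [Finite S] [Finite K] : Function.Bijective (zip (F := F) f A B X) :=
  ((LinearEquiv.ofBijective _ (bijective_lift_zipFam f A B)).lTensor X).bijective.comp
    (TensorProduct.assoc F _ _ _).bijective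

end zip

/-- Linear maps out of `(X ⊗ ⨂_k A_k) ⊗ ⨂_s B_s` are determined on pure tensors. -/
theorem zip_ext {S K : Type} {A : K → Type u} {B : S → Type u}
    [∀ k, AddCommGroup (A k)] [∀ k, Module F (A k)] [∀ s, AddCommGroup (B s)]
    [∀ s, Module F (B s)] {X W : Type u} [AddCommGroup X] [Module F X] [AddCommGroup W] [Module F W]
    {φ ψ : (X ⊗[F] PiTensorProduct F A) ⊗[F] PiTensorProduct F B →ₗ[F] W}
    (h : ∀ x a b, φ ((x ⊗ₜ PiTensorProduct.tprod F a) ⊗ₜ PiTensorProduct.tprod F b) =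
      ψ ((x ⊗ₜ PiTensorProduct.tprod F a) ⊗ₜ PiTensorProduct.tprod F b)) : φ = ψ :=
  TensorProduct.ext (TensorProduct.ext (LinearMap.ext fun x => tensor_ext fun a =>
    tensor_ext fun b => h x a b))

theorem tmul_ext {K : Type} {A : K → Type u}
    [∀ k, AddCommGroup (A k)] [∀ k, Module F (A k)]
    {X W : Type u} [AddCommGroup X] [Module F X] [AddCommGroup W] [Module F W]
    {φ ψ : X ⊗[F] PiTensorProduct F A →ₗ[F] W}
    (h : ∀ x a, φ (x ⊗ₜ PiTensorProduct.tprod F a) = ψ (x ⊗ₜ PiTensorProduct.tprod F a)) : φ = ψ :=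
  TensorProduct.ext (LinearMap.ext fun x => tensor_ext fun a => h x a)

/-! ### Coefficients of elements of `Γ(M, V)` -/

/-- The symmetric sequence `S ↦ N(S) ⊗ V^{⊗ S}`. -/
abbrev gSeq (N : SymSeq F) (V : ModuleCat.{u} F) : SymSeq F where
  obj S _ := ModuleCat.of F (GPre N V S)
  map d := gMap N V d
  map_refl S _ x := LinearMap.congr_fun (gMap_refl N V S) x
  map_trans d e x := LinearMap.congr_fun (gMap_trans N V d e) x

theorem gMap_tmul (N : SymSeq F) (V : ModuleCat.{u} F) {S T : Type} [Finite S] [Finite T]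
    (d : S ≃ T) (n : N.obj S) (v : S → V) :
    gMap N V d (n ⊗ₜ PiTensorProduct.tprod F v) =
      N.map d n ⊗ₜ PiTensorProduct.tprod F fun t => v (d.symm t) := by
  rw [gMap, TensorProduct.map_tmul, vMap_tprod]

theorem gammaCoeff_perm (N : SymSeq F) (V : ModuleCat.{u} F) {n : ℕ} (σ : Equiv.Perm (Fin n))
    (x : Gamma N V) : gMap N V σ (gammaCoeff N V n x) = gammaCoeff N V n x :=
  (DirectSum.component F ℕ (fun n => (gRep N V (Fin n)).invariants) n x).2 σ

theorem coeffAt_eq (N : SymSeq F) (V : ModuleCat.{u} F) {S : Type} [Finite S] {n : ℕ}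
    (e : Fin n ≃ S) (x : Gamma N V) : coeffAt N V S x = gMap N V e (gammaCoeff N V n x) := by
  obtain rfl : n = Nat.card S := (Nat.card_eq_of_equiv_fin e.symm).symm
  have h := LinearMap.congr_fun (gMap_trans N V (e.trans (Finite.equivFin S))
    (Finite.equivFin S).symm) (gammaCoeff N V (Nat.card S) x)
  rw [LinearMap.comp_apply, gammaCoeff_perm, Equiv.trans_assoc, Equiv.self_trans_symm,
    Equiv.trans_refl] at h
  exact h.symm

theorem coeffAt_fin (N : SymSeq F) (V : ModuleCat.{u} F) (n : ℕ) (x : Gamma N V) :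
    coeffAt N V (Fin n) x = gammaCoeff N V n x := by
  rw [coeffAt_eq N V (Equiv.refl _), gMap_refl, LinearMap.id_apply]

theorem coeffAt_map (N : SymSeq F) (V : ModuleCat.{u} F) {S T : Type} [Finite S] [Finite T]
    (d : S ≃ T) (x : Gamma N V) : gMap N V d (coeffAt N V S x) = coeffAt N V T x := by
  rw [coeffAt_eq N V ((Finite.equivFin S).symm.trans d), gMap_trans]; rfl

theorem gamma_ext (N : SymSeq F) (V : ModuleCat.{u} F) {x y : Gamma N V}
    (h : ∀ n, gammaCoeff N V n x = gammaCoeff N V n y) : x = y :=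
  DirectSum.ext_component F (M := fun n => (gRep N V (Fin n)).invariants) fun n => Subtype.ext (h n)

/-- The element of `Γ(N, V)` with one component. -/
def gammaOf (N : SymSeq F) (V : ModuleCat.{u} F) (n : ℕ) :
    (gRep N V (Fin n)).invariants →ₗ[F] Gamma N V :=
  DirectSum.lof F ℕ (fun n => (gRep N V (Fin n)).invariants) n

theorem gammaCoeff_gammaOf (N : SymSeq F) (V : ModuleCat.{u} F) (n : ℕ)
    (x : (gRep N V (Fin n)).invariants) : gammaCoeff N V n (gammaOf N V n x) = x :=
  congrArg Subtype.val (DirectSum.component.lof_self F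
    (M := fun n => (gRep N V (Fin n)).invariants) n x)

theorem gammaCoeff_gammaOf_of_ne (N : SymSeq F) (V : ModuleCat.{u} F) {n m : ℕ} (h : n ≠ m)
    (x : (gRep N V (Fin n)).invariants) : gammaCoeff N V m (gammaOf N V n x) = 0 := by
  refine (congrArg Subtype.val (DirectSum.component.of F
    (M := fun n => (gRep N V (Fin n)).invariants) m n x)).trans ?_
  rw [dif_neg h]; rfl

theorem exists_gammaCoeff_eq_zero (N : SymSeq F) (V : ModuleCat.{u} F) (x : Gamma N V) :
    ∃ B, ∀ n, B ≤ n → gammaCoeff N V n x = 0 := by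
  classical
  let y : Π₀ n, (gRep N V (Fin n)).invariants := x
  refine ⟨y.support.sup id + 1, fun n hn => ?_⟩
  have : y n = 0 := by
    by_contra h
    have h1 : n ≤ y.support.sup id := Finset.le_sup (f := id) (DFinsupp.mem_support_iff.2 h)
    omega
  exact congrArg Subtype.val this

/-- For an action of a finite group, some projection onto the invariants differs from the identity
by a combination of the maps `x ↦ g x - x`. -/
theorem exists_invariants_projection {G X : Type*} [Group G] [Fintype G] [AddCommGroup X]
    [Module F X] (ρ : Representation F G X) :
    ∃ (p : X →ₗ[F] ρ.invariants) (s : G → X →ₗ[F] X), (∀ x : ρ.invariants, p x = x) ∧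
      ρ.invariants.subtype ∘ₗ p = LinearMap.id + ∑ g, s g ∘ₗ (ρ g - LinearMap.id) := by
  classical
  have hi : LinearMap.ker ρ.invariants.subtype = ⊥ := Submodule.ker_subtype _
  let p := ρ.invariants.subtype.leftInverse
  have hp : ∀ x : ρ.invariants, p x = x := LinearMap.leftInverse_apply_of_inj hi
  let D : X →ₗ[F] (G → X) := LinearMap.pi fun g => ρ g - LinearMap.id
  -- `p - 1` vanishes on the invariants, which are the kernel of `D`, and so factors through `D`
  let q := (LinearMap.ker D).liftQ D le_rfl
  have hq : LinearMap.ker q = ⊥ := Submodule.ker_liftQ_eq_bot _ _ _ le_rfl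
  let r := (LinearMap.ker D).liftQ (ρ.invariants.subtype ∘ₗ p - LinearMap.id) fun x hx => by
    have hx' : x ∈ ρ.invariants := fun g => sub_eq_zero.1 (congrFun hx g)
    rw [LinearMap.mem_ker, LinearMap.sub_apply, LinearMap.comp_apply, hp ⟨x, hx'⟩]
    exact sub_self x
  refine ⟨p, fun g => r ∘ₗ q.leftInverse ∘ₗ LinearMap.single F (fun _ => X) g, hp, ?_⟩
  refine LinearMap.ext fun x => ?_
  have h1 : q.leftInverse (D x) = Submodule.Quotient.mk x :=
    LinearMap.leftInverse_apply_of_inj hq (Submodule.Quotient.mk x)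
  have h2 : D x = ∑ g, LinearMap.single F (fun _ => X) g ((ρ g - LinearMap.id : X →ₗ[F] X) x) :=
    (LinearMap.sum_single_apply (fun _ => X) (D x)).symm
  have h3 : r (q.leftInverse (D x)) =
      (ρ.invariants.subtype ∘ₗ p - LinearMap.id : X →ₗ[F] X) x := by rw [h1]; rfl
  rw [h2, map_sum, map_sum] at h3
  rw [LinearMap.add_apply, LinearMap.sum_apply]
  simp only [LinearMap.comp_apply] at h3 ⊢
  rw [h3]
  simp

/-- A projection onto the component of arity `n` of `Γ(N, V)`. -/
theorem exists_gammaSec (N : SymSeq F) (V : ModuleCat.{u} F) (n : ℕ) :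
    ∃ (p : GPre N V (Fin n) →ₗ[F] (gRep N V (Fin n)).invariants)
      (s : Equiv.Perm (Fin n) → GPre N V (Fin n) →ₗ[F] GPre N V (Fin n)),
      (∀ x : (gRep N V (Fin n)).invariants, p x = x) ∧
      (gRep N V (Fin n)).invariants.subtype ∘ₗ p =
        LinearMap.id + ∑ g, s g ∘ₗ (gMap N V g - LinearMap.id) :=
  exists_invariants_projection (gRep N V (Fin n))

/-- A linear map `N(n) ⊗ V^{⊗ n} → Γ(N, V)` which is the inclusion on invariants. -/
def gammaSec (N : SymSeq F) (V : ModuleCat.{u} F) (n : ℕ) : GPre N V (Fin n) →ₗ[F] Gamma N V :=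
  gammaOf N V n ∘ₗ (exists_gammaSec N V n).choose

theorem gammaCoeff_gammaSec_of_ne (N : SymSeq F) (V : ModuleCat.{u} F) {n m : ℕ} (h : n ≠ m)
    (x : GPre N V (Fin n)) : gammaCoeff N V m (gammaSec N V n x) = 0 :=
  gammaCoeff_gammaOf_of_ne N V h _

theorem gammaSec_gammaCoeff (N : SymSeq F) (V : ModuleCat.{u} F) (n : ℕ) (x : Gamma N V) :
    gammaCoeff N V n (gammaSec N V n (gammaCoeff N V n x)) = gammaCoeff N V n x := by
  rw [gammaSec, LinearMap.comp_apply, gammaCoeff_gammaOf]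
  exact congrArg Subtype.val ((exists_gammaSec N V n).choose_spec.choose_spec.1
    (DirectSum.component F ℕ (fun n => (gRep N V (Fin n)).invariants) n x))

theorem exists_gammaCoeff_comp_gammaSec (N : SymSeq F) (V : ModuleCat.{u} F) (n : ℕ) :
    ∃ s : Equiv.Perm (Fin n) → GPre N V (Fin n) →ₗ[F] GPre N V (Fin n),
      gammaCoeff N V n ∘ₗ gammaSec N V n =
        LinearMap.id + ∑ g, s g ∘ₗ (gMap N V g - LinearMap.id) := by
  refine ⟨_, Eq.trans ?_ (exists_gammaSec N V n).choose_spec.choose_spec.2⟩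
  exact LinearMap.ext fun x => gammaCoeff_gammaOf N V n _

/-- The truncation of `Γ(N, V)` in arities less than `B`. -/
def gammaTrunc (N : SymSeq F) (V : ModuleCat.{u} F) (B : ℕ) : Gamma N V →ₗ[F] Gamma N V :=
  ∑ n ∈ Finset.range B, gammaSec N V n ∘ₗ gammaCoeff N V n

theorem exists_gammaTrunc_eq (N : SymSeq F) (V : ModuleCat.{u} F) (x : Gamma N V) :
    ∃ B, ∀ C, B ≤ C → gammaTrunc N V C x = x := by
  obtain ⟨B, hB⟩ := exists_gammaCoeff_eq_zero N V x
  refine ⟨B, fun C hC => gamma_ext N V fun n => ?_⟩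
  rw [gammaTrunc, LinearMap.sum_apply, map_sum]
  by_cases hn : n < C
  · rw [Finset.sum_eq_single n]
    · exact gammaSec_gammaCoeff N V n x
    · intro m _ hm
      exact gammaCoeff_gammaSec_of_ne N V hm _
    · exact fun h => absurd (Finset.mem_range.2 hn) h
  · rw [hB n (hC.trans (not_lt.1 hn))]
    refine Finset.sum_eq_zero fun m hm => gammaCoeff_gammaSec_of_ne N V ?_ _
    rintro rfl
    exact hn (Finset.mem_range.1 hm)

theorem coeffAt_gammaSec_of_ne (N : SymSeq F) (V : ModuleCat.{u} F) {S : Type} [Finite S] {n : ℕ}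
    (h : n ≠ Nat.card S) : coeffAt N V S ∘ₗ gammaSec N V n = 0 := by
  refine LinearMap.ext fun x => ?_
  rw [coeffAt, LinearMap.comp_apply, LinearMap.comp_apply, gammaCoeff_gammaSec_of_ne N V h, map_zero,
    LinearMap.zero_apply]

/-- The composite `GPre N V S ≃ GPre N V n → Γ(N, V) → GPre N V S` differs from the identity by a
combination of the maps `σ - 1`. -/
theorem exists_coeffAt_comp_gammaSec (N : SymSeq F) (V : ModuleCat.{u} F) {S : Type} [Finite S]
    [Fintype (Equiv.Perm S)] {n : ℕ} (d : S ≃ Fin n) :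
    ∃ s : Equiv.Perm S → GPre N V S →ₗ[F] GPre N V S,
      coeffAt N V S ∘ₗ gammaSec N V n ∘ₗ gMap N V d =
        LinearMap.id + ∑ g, s g ∘ₗ (gMap N V g - LinearMap.id) := by
  obtain ⟨s, hs⟩ := exists_gammaCoeff_comp_gammaSec N V n
  have h0 : coeffAt N V S = gMap N V d.symm ∘ₗ gammaCoeff N V n :=
    LinearMap.ext fun x => coeffAt_eq N V d.symm x
  refine ⟨fun g => gMap N V d.symm ∘ₗ s (d.permCongr g) ∘ₗ gMap N V d, ?_⟩
  have h1 : gMap N V d.symm ∘ₗ gMap N V d = LinearMap.id := by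
    rw [← gMap_trans, Equiv.self_trans_symm, gMap_refl]
  have h2 : ∀ g : Equiv.Perm S, gMap N V (d.permCongr g) ∘ₗ gMap N V d =
      gMap N V d ∘ₗ gMap N V g := fun g => by
    rw [← gMap_trans, ← gMap_trans]
    congr 1
    ext x
    simp
  rw [h0, LinearMap.comp_assoc, ← LinearMap.comp_assoc (gMap N V d), hs, LinearMap.add_comp,
    LinearMap.comp_add, LinearMap.id_comp, h1]
  congr 1
  rw [← Equiv.sum_comp d.permCongr]
  refine LinearMap.ext fun x => ?_
  simp only [LinearMap.comp_apply, LinearMap.sum_apply, map_sum]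
  refine Finset.sum_congr rfl fun g _ => ?_
  have h3 := LinearMap.congr_fun (h2 g) x
  simp only [LinearMap.comp_apply] at h3
  simp only [LinearMap.sub_apply, LinearMap.id_apply, h3, map_sub]

/-! ### Coefficients of elements of `Γ(M, Γ(N, V))` -/

/-- The map `Γ(N, V)^{⊗ K} → ⨂_k (N(f⁻¹(k)) ⊗ V^{⊗ f⁻¹(k)})` taking components in each factor. -/
def fibCoeff (N : SymSeq F) (V : ModuleCat.{u} F) {S K : Type} [Finite S] (f : S → K) :
    (PiTensorProduct F fun _ : K => (Gamma N V : Type u)) →ₗ[F] FibTensor (gSeq N V) f :=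
  PiTensorProduct.map fun k => coeffAt N V (Fib f k)

theorem fibCoeff_tprod (N : SymSeq F) (V : ModuleCat.{u} F) {S K : Type} [Finite S] (f : S → K)
    (x : K → Gamma N V) : fibCoeff N V f (PiTensorProduct.tprod F x) =
      PiTensorProduct.tprod F fun k => coeffAt N V (Fib f k) (x k) :=
  PiTensorProduct.map_tprod _ _

theorem fibCoeff_gMap (M N : SymSeq F) (V : ModuleCat.{u} F) {S T K J : Type} [Finite S] [Finite T]
    [Finite K] [Finite J] (d : S ≃ T) (e : K ≃ J) {f : S → K} {g : T → J}
    (h : ∀ s, g (d s) = e (f s)) (w : GPre M (Gamma N V) K) :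
    (fibCoeff N V g).lTensor (M.obj J) (gMap M (Gamma N V) e w) =
      decMap M (gSeq N V) d e h ((fibCoeff N V f).lTensor (M.obj K) w) := by
  refine LinearMap.congr_fun (f := (fibCoeff N V g).lTensor (M.obj J) ∘ₗ gMap M (Gamma N V) e)
    (g := decMap M (gSeq N V) d e h ∘ₗ (fibCoeff N V f).lTensor (M.obj K))
    (tmul_ext fun m x => ?_) w
  rw [LinearMap.comp_apply, LinearMap.comp_apply, gMap_tmul, LinearMap.lTensor_tmul,
    LinearMap.lTensor_tmul, decMap_tmul, fibCoeff_tprod, fibCoeff_tprod, fibMap_tprod]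
  congr 2
  funext j
  exact (coeffAt_map N V (fibEquiv d e h j) (x (e.symm j))).symm

/-- Elements of `A ⊗ Γ(N, V)^{⊗ K}` are fixed by truncating all factors in high arities. -/
theorem exists_trunc_lTensor (N : SymSeq F) (V : ModuleCat.{u} F) {A : Type u} [AddCommGroup A]
    [Module F A] {K : Type} [Finite K]
    (w : A ⊗[F] PiTensorProduct F fun _ : K => (Gamma N V : Type u)) :
    ∃ B, ∀ C, B ≤ C → (PiTensorProduct.map fun _ : K => gammaTrunc N V C).lTensor A w = w := by
  have := Fintype.ofFinite K
  induction w with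
  | zero => exact ⟨0, fun _ _ => map_zero _⟩
  | add x y hx hy =>
    obtain ⟨B, hB⟩ := hx
    obtain ⟨B', hB'⟩ := hy
    exact ⟨max B B', fun C hC => by
      rw [map_add, hB C (le_trans (le_max_left _ _) hC), hB' C (le_trans (le_max_right _ _) hC)]⟩
  | tmul a t =>
    induction t using PiTensorProduct.induction_on with
    | smul_tprod r x =>
      choose B hB using fun k => exists_gammaTrunc_eq N V (x k)
      refine ⟨Finset.univ.sup B, fun C hC => ?_⟩
      rw [LinearMap.lTensor_tmul, map_smul, PiTensorProduct.map_tprod]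
      congr 3
      funext k
      exact hB k C ((Finset.le_sup (Finset.mem_univ k)).trans hC)
    | add x y hx hy =>
      obtain ⟨B, hB⟩ := hx
      obtain ⟨B', hB'⟩ := hy
      exact ⟨max B B', fun C hC => by
        rw [TensorProduct.tmul_add, map_add, hB C (le_trans (le_max_left _ _) hC),
          hB' C (le_trans (le_max_right _ _) hC)]⟩

/-- The fibres of the projection of a disjoint union to its set of indices. -/
def sigmaFib {K : Type} (φ : K → ℕ) (i : K) :
    Fib (Sigma.fst : (Σ k, Fin (φ k)) → K) i ≃ Fin (φ i) :=
  (Equiv.ofBijective (fun a : Fin (φ i) => (⟨⟨i, a⟩, rfl⟩ : Fib (Sigma.fst : (Σ k, Fin (φ k)) → K) i))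
    ⟨fun a b h => by simpa using h, fun ⟨⟨j, a⟩, h⟩ => by cases h; exact ⟨a, rfl⟩⟩).symm

theorem map_sum_range {K : Type} [Fintype K] [DecidableEq K] {X Y : Type u} [AddCommGroup X]
    [Module F X] [AddCommGroup Y] [Module F Y] (c : ℕ → X →ₗ[F] Y) (B : ℕ) :
    (PiTensorProduct.map fun _ : K => ∑ n ∈ Finset.range B, c n) =
      ∑ φ ∈ Fintype.piFinset fun _ : K => Finset.range B,
        PiTensorProduct.map fun k => c (φ k) :=
  (PiTensorProduct.mapMultilinear F (fun _ : K => X) (fun _ : K => Y)).map_sum_finset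
    (fun _ n => c n) fun _ => Finset.range B

/-- Elements of `A ⊗ Γ(N, V)^{⊗ K}` are determined by their components at maps `S → K`. -/
theorem ext_fibCoeff (N : SymSeq F) (V : ModuleCat.{u} F) {A : Type u} [AddCommGroup A]
    [Module F A] {K : Type} [Finite K]
    {w w' : A ⊗[F] PiTensorProduct F fun _ : K => (Gamma N V : Type u)}
    (h : ∀ (S : Type) [Finite S] (f : S → K), (fibCoeff N V f).lTensor A w =
      (fibCoeff N V f).lTensor A w') : w = w' := by
  classical
  have := Fintype.ofFinite K
  obtain ⟨B, hB⟩ := exists_trunc_lTensor N V w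
  obtain ⟨B', hB'⟩ := exists_trunc_lTensor N V w'
  -- projecting the factors to the arities `φ` only involves the component at `∐_k {1, …, φ k} → K`
  have key : ∀ φ : K → ℕ, (PiTensorProduct.map fun k => gammaSec N V (φ k) ∘ₗ
      gammaCoeff N V (φ k)) = PiTensorProduct.map (fun k => gammaSec N V (φ k) ∘ₗ
        gMap N V (sigmaFib φ k)) ∘ₗ fibCoeff N V (Sigma.fst : (Σ k, Fin (φ k)) → K) := fun φ => by
    rw [fibCoeff, ← PiTensorProduct.map_comp]
    congr 1
    funext k
    rw [LinearMap.comp_assoc]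
    congr 1
    refine LinearMap.ext fun x => ?_
    rw [LinearMap.comp_apply, coeffAt_map, coeffAt_fin]
  rw [← hB (max B B') (le_max_left _ _), ← hB' (max B B') (le_max_right _ _)]
  simp only [gammaTrunc]
  rw [map_sum_range]
  have hs : ∀ t : A ⊗[F] PiTensorProduct F fun _ : K => (Gamma N V : Type u),
      (∑ φ ∈ Fintype.piFinset fun _ : K => Finset.range (max B B'),
        PiTensorProduct.map fun k => gammaSec N V (φ k) ∘ₗ gammaCoeff N V (φ k)).lTensor A t =
      ∑ φ ∈ Fintype.piFinset fun _ : K => Finset.range (max B B'),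
        (PiTensorProduct.map fun k => gammaSec N V (φ k) ∘ₗ gammaCoeff N V (φ k)).lTensor A t :=
    fun t => by
      rw [← LinearMap.coe_lTensorHom, map_sum, LinearMap.sum_apply]
  rw [hs, hs]
  refine Finset.sum_congr rfl fun φ _ => ?_
  rw [key, LinearMap.lTensor_comp, LinearMap.comp_apply, LinearMap.comp_apply, h]

/-- A family of elements of `M(K) ⊗ ⨂_k R(f⁻¹(k))`, for all maps `f : S → K` of finite sets,
compatible with relabelling. -/
structure DecFamily (M R : SymSeq F) where
  val : ∀ {S K : Type} [Finite S] [Finite K] (f : S → K), M.obj K ⊗[F] FibTensor R f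
  map_val : ∀ {S T K J : Type} [Finite S] [Finite T] [Finite K] [Finite J] (d : S ≃ T) (e : K ≃ J)
    {f : S → K} {g : T → J} (h : ∀ s, g (d s) = e (f s)), decMap M R d e h (val f) = val g

theorem decMap_refl_right (M R : SymSeq F) {S T K : Type} [Finite S] [Finite T] [Finite K]
    (d : S ≃ T) {f : S → K} {g : T → K} (h : ∀ s, g (d s) = Equiv.refl K (f s))
    (x : M.obj K ⊗[F] FibTensor R f) : decMap M R d (Equiv.refl K) h x =
      (PiTensorProduct.map fun k => (R.map (fibEquiv d (Equiv.refl K) h k) :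
        R.obj (Fib f k) →ₗ[F] R.obj (Fib g k))).lTensor (M.obj K) x := by
  refine LinearMap.congr_fun (f := decMap M R d (Equiv.refl K) h)
    (g := (PiTensorProduct.map fun k => (R.map (fibEquiv d (Equiv.refl K) h k) :
        R.obj (Fib f k) →ₗ[F] R.obj (Fib g k))).lTensor (M.obj K)) (tmul_ext fun m n => ?_) x
  rw [decMap_tmul, fibMap_tprod, M.map_refl, LinearMap.lTensor_tmul, PiTensorProduct.map_tprod]
  rfl

/-- The values of a compatible family are invariant under the permutations of a single fibre. -/
theorem DecFamily.map_update_perm {M R : SymSeq F} (x : DecFamily M R) {S K : Type} [Finite S]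
    [Finite K] [DecidableEq K] (f : S → K) (i : K) (σ : Equiv.Perm (Fib f i)) :
    (PiTensorProduct.map (Function.update (fun k => (LinearMap.id : R.obj (Fib f k) →ₗ[F] _)) i
      (R.map σ))).lTensor (M.obj K) (x.val f) = x.val f := by
  classical
  have h : ∀ s, f (Equiv.Perm.ofSubtype σ s) = Equiv.refl K (f s) := fun s => by
    by_cases hs : f s = i
    · rw [Equiv.Perm.ofSubtype_apply_of_mem σ hs, (σ ⟨s, hs⟩).2]; exact hs.symm
    · rw [Equiv.Perm.ofSubtype_apply_of_not_mem σ hs]; rfl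
  have h1 := x.map_val (Equiv.Perm.ofSubtype σ) (Equiv.refl K) h
  rw [decMap_refl_right] at h1
  refine Eq.trans ?_ h1
  congr 3
  funext k
  by_cases hk : k = i
  · subst hk
    rw [Function.update_self]
    congr 1
    ext s
    exact (Equiv.Perm.ofSubtype_apply_coe σ s).symm
  · rw [Function.update_of_ne hk]
    have : (fibEquiv (Equiv.Perm.ofSubtype σ) (Equiv.refl K) h k : Fib f k ≃ Fib f k) =
        Equiv.refl _ := by
      ext s
      refine Equiv.Perm.ofSubtype_apply_of_not_mem σ (a := s.1) fun hs => hk (s.2.symm.trans hs)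
    exact LinearMap.ext fun y => ((congrArg (fun e => R.map e y) this).trans (R.map_refl _ y)).symm

/-- A linear map differing from the identity, in each factor, by a combination of the maps `σ - 1`
fixes the values of a compatible family. -/
theorem DecFamily.map_eq_self {M R : SymSeq F} (x : DecFamily M R) {S K : Type} [Finite S]
    [Finite K] (f : S → K) [∀ k, Fintype (Equiv.Perm (Fib f k))]
    (E : ∀ k, R.obj (Fib f k) →ₗ[F] R.obj (Fib f k))
    (hE : ∀ k, ∃ s : Equiv.Perm (Fib f k) → R.obj (Fib f k) →ₗ[F] R.obj (Fib f k),
      E k = LinearMap.id + ∑ g, s g ∘ₗ (R.map g - LinearMap.id)) :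
    (PiTensorProduct.map E).lTensor (M.obj K) (x.val f) = x.val f := by
  classical
  have := Fintype.ofFinite K
  let I : ∀ k, R.obj (Fib f k) →ₗ[F] R.obj (Fib f k) := fun _ => LinearMap.id
  have h1 : ∀ i, (PiTensorProduct.map (Function.update I i (E i))).lTensor (M.obj K) (x.val f) =
      x.val f := fun i => by
    obtain ⟨s, hs⟩ := hE i
    let L : (R.obj (Fib f i) →ₗ[F] R.obj (Fib f i)) →ₗ[F] M.obj K ⊗[F] FibTensor R f :=
      LinearMap.applyₗ (x.val f) ∘ₗ LinearMap.lTensorHom (M.obj K) ∘ₗ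
        (PiTensorProduct.mapMultilinear F (fun k => R.obj (Fib f k))
          (fun k => R.obj (Fib f k))).toLinearMap I i
    have hL : ∀ y, L y = (PiTensorProduct.map (Function.update I i y)).lTensor (M.obj K) (x.val f) :=
      fun _ => rfl
    have hid : L LinearMap.id = x.val f := by
      rw [hL, Function.update_eq_self i I, PiTensorProduct.map_id, LinearMap.lTensor_id,
        LinearMap.id_apply]
    have hg : ∀ g, L (R.map g) = x.val f := fun g => (hL _).trans (x.map_update_perm f i g)
    rw [← hL, hs, map_add, map_sum, hid]
    refine add_eq_left.2 (Finset.sum_eq_zero fun g _ => ?_)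
    have h2 : PiTensorProduct.map (Function.update I i (s g ∘ₗ (R.map g - LinearMap.id))) =
        PiTensorProduct.map (Function.update I i (s g)) ∘ₗ
          PiTensorProduct.map (Function.update I i (R.map g - LinearMap.id)) := by
      rw [← PiTensorProduct.map_comp]
      congr 1
      funext k
      by_cases hk : k = i
      · subst hk; simp only [Function.update_self]
      · simp only [Function.update_of_ne hk]; rfl
    rw [hL, h2, LinearMap.lTensor_comp, LinearMap.comp_apply, ← hL, map_sub, hid, hg, sub_self,
      map_zero]
  have h2 : ∀ T : Finset K, (PiTensorProduct.map fun k => if k ∈ T then E k else I k).lTensor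
      (M.obj K) (x.val f) = x.val f := fun T => by
    induction T using Finset.induction_on with
    | empty =>
      simp only [Finset.notMem_empty, if_false]
      rw [PiTensorProduct.map_id, LinearMap.lTensor_id, LinearMap.id_apply]
    | insert a T ha ih =>
      have h3 : (PiTensorProduct.map fun k => if k ∈ insert a T then E k else I k) =
          PiTensorProduct.map (Function.update I a (E a)) ∘ₗ
            PiTensorProduct.map fun k => if k ∈ T then E k else I k := by
        rw [← PiTensorProduct.map_comp]
        congr 1
        funext k
        by_cases hk : k = a
        · subst hk
          rw [if_pos (Finset.mem_insert_self _ _), if_neg ha, Function.update_self]; rfl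
        · rw [Function.update_of_ne hk]
          simp only [Finset.mem_insert, hk, false_or]; rfl
      rw [h3, LinearMap.lTensor_comp, LinearMap.comp_apply, ih, h1]
  simpa using h2 Finset.univ

theorem map_eq_zero_of_factor {K : Type} {X Y : K → Type u} [∀ k, AddCommGroup (X k)]
    [∀ k, Module F (X k)] [∀ k, AddCommGroup (Y k)] [∀ k, Module F (Y k)]
    {φ : ∀ k, X k →ₗ[F] Y k} (i : K) (h : φ i = 0) : PiTensorProduct.map φ = 0 :=
  tensor_ext fun x => by
    rw [PiTensorProduct.map_tprod, LinearMap.zero_apply]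
    exact (PiTensorProduct.tprod F).map_coord_zero i (by rw [h, LinearMap.zero_apply])

/-- A compatible family which vanishes for large `S` consists of the components of elements of
`M(K) ⊗ Γ(N, V)^{⊗ K}`. -/
theorem DecFamily.exists_fibCoeff_eq {M N : SymSeq F} {V : ModuleCat.{u} F}
    (x : DecFamily M (gSeq N V)) (B : ℕ) (hB : ∀ {S K : Type} [Finite S] [Finite K] (f : S → K),
      B ≤ Nat.card S → x.val f = 0) (K : Type) [Finite K] :
    ∃ y : GPre M (Gamma N V) K, ∀ {S : Type} [Finite S] (f : S → K),
      (fibCoeff N V f).lTensor (M.obj K) y = x.val f := by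
  classical
  have := Fintype.ofFinite K
  refine ⟨∑ φ ∈ Fintype.piFinset fun _ : K => Finset.range B,
    (PiTensorProduct.map fun k => gammaSec N V (φ k) ∘ₗ gMap N V (sigmaFib φ k)).lTensor (M.obj K)
      (x.val (Sigma.fst : (Σ k, Fin (φ k)) → K)), fun {S} _ f => ?_⟩
  -- only the summand of the arities of the fibres of `f` has a component at `f`
  have hz : ∀ φ : K → ℕ, φ ≠ (fun k => Nat.card (Fib f k)) →
      (fibCoeff N V f).lTensor (M.obj K) ((PiTensorProduct.map fun k => gammaSec N V (φ k) ∘ₗ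
        gMap N V (sigmaFib φ k)).lTensor (M.obj K)
          (x.val (Sigma.fst : (Σ k, Fin (φ k)) → K))) = 0 := fun φ hφ => by
    obtain ⟨i, hi⟩ := Function.ne_iff.1 hφ
    rw [← LinearMap.comp_apply, ← LinearMap.lTensor_comp, fibCoeff, ← PiTensorProduct.map_comp,
      map_eq_zero_of_factor i, LinearMap.lTensor_zero, LinearMap.zero_apply]
    rw [← LinearMap.comp_assoc, coeffAt_gammaSec_of_ne N V hi, LinearMap.zero_comp]
  rw [map_sum]
  by_cases hf : ∀ k, Nat.card (Fib f k) < B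
  · rw [Finset.sum_eq_single fun k => Nat.card (Fib f k)]
    · let b : ∀ k, Fib f k ≃ Fin (Nat.card (Fib f k)) := fun k => Finite.equivFin _
      let δ : S ≃ Σ k, Fin (Nat.card (Fib f k)) :=
        (Equiv.sigmaFiberEquiv f).symm.trans (Equiv.sigmaCongrRight b)
      have hδ : ∀ s, Sigma.fst (δ s) = Equiv.refl K (f s) := fun _ => rfl
      have := fun k => Fintype.ofFinite (Equiv.Perm (Fib f k))
      rw [← x.map_val δ (Equiv.refl K) hδ, decMap_refl_right, ← LinearMap.comp_apply,
        ← LinearMap.lTensor_comp, ← LinearMap.comp_apply, ← LinearMap.lTensor_comp, fibCoeff,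
        ← PiTensorProduct.map_comp, ← PiTensorProduct.map_comp]
      refine x.map_eq_self f _ fun k => ?_
      obtain ⟨s, hs⟩ := exists_coeffAt_comp_gammaSec N V
        ((fibEquiv δ (Equiv.refl K) hδ k).trans (sigmaFib (fun k => Nat.card (Fib f k)) k))
      refine ⟨s, Eq.trans ?_ hs⟩
      rw [gMap_trans]
      rfl
    · exact fun φ _ hφ => hz φ hφ
    · refine fun h => absurd ?_ h
      exact Fintype.mem_piFinset.2 fun k => Finset.mem_range.2 (hf k)
  · push Not at hf
    obtain ⟨k, hk⟩ := hf
    rw [hB f (hk.trans (Nat.card_le_card_of_injective _ Subtype.val_injective))]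
    refine Finset.sum_eq_zero fun φ hφ => hz φ ?_
    rintro rfl
    have := Finset.mem_range.1 (Fintype.mem_piFinset.1 hφ k)
    omega

/-- The component at `f : S → K` of an element of `Γ(M, Γ(N, V))`. -/
def nestedCoeff (M N : SymSeq F) (V : ModuleCat.{u} F) {S K : Type} [Finite S] [Finite K]
    (f : S → K) : Gamma M (Gamma N V) →ₗ[F] M.obj K ⊗[F] FibTensor (gSeq N V) f :=
  (fibCoeff N V f).lTensor (M.obj K) ∘ₗ coeffAt M (Gamma N V) K

theorem nestedIncl_apply (M N : SymSeq F) (V : ModuleCat.{u} F) (b : Gamma M (Gamma N V)) (k n : ℕ)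
    (f : Fin n → Fin k) : nestedIncl M N V b k n f = nestedCoeff M N V f b := by
  rw [nestedCoeff, LinearMap.comp_apply, coeffAt_fin]; rfl

theorem decMap_nestedCoeff (M N : SymSeq F) (V : ModuleCat.{u} F) {S T K J : Type} [Finite S]
    [Finite T] [Finite K] [Finite J] (d : S ≃ T) (e : K ≃ J) {f : S → K} {g : T → J}
    (h : ∀ s, g (d s) = e (f s)) (b : Gamma M (Gamma N V)) :
    decMap M (gSeq N V) d e h (nestedCoeff M N V f b) = nestedCoeff M N V g b := by
  rw [nestedCoeff, LinearMap.comp_apply, ← fibCoeff_gMap, coeffAt_map]; rfl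

theorem nested_ext (M N : SymSeq F) (V : ModuleCat.{u} F) {b b' : Gamma M (Gamma N V)}
    (h : ∀ {S K : Type} [Finite S] [Finite K] (f : S → K),
      nestedCoeff M N V f b = nestedCoeff M N V f b') : b = b' := by
  refine gamma_ext M (Gamma N V) fun k => ?_
  rw [← coeffAt_fin, ← coeffAt_fin]
  exact ext_fibCoeff N V fun S _ f => h f

/-- A compatible family which is known on maps between the sets `{1, …, n}` is known. -/
theorem DecFamily.ext_fin {M R : SymSeq F} {x y : DecFamily M R}
    (h : ∀ (k n : ℕ) (f : Fin n → Fin k), x.val f = y.val f) {S K : Type} [Finite S] [Finite K]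
    (f : S → K) : x.val f = y.val f := by
  obtain ⟨n, ⟨d⟩⟩ := Finite.exists_equiv_fin S
  obtain ⟨k, ⟨e⟩⟩ := Finite.exists_equiv_fin K
  have hh : ∀ s, f (d.symm s) = e.symm ((fun s => e (f (d.symm s))) s) := by simp
  rw [← x.map_val d.symm e.symm hh, ← y.map_val d.symm e.symm hh, h]

/-- The components of an element of `Γ(M, Γ(N, V))`. -/
def nestedFamily (M N : SymSeq F) (V : ModuleCat.{u} F) (b : Gamma M (Gamma N V)) :
    DecFamily M (gSeq N V) where
  val f := nestedCoeff M N V f b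
  map_val d e _ _ h := decMap_nestedCoeff M N V d e h b

theorem injective_nestedIncl (M N : SymSeq F) (V : ModuleCat.{u} F) :
    Function.Injective (nestedIncl M N V) := fun b b' h => nested_ext M N V fun f => by
  refine DecFamily.ext_fin (x := nestedFamily M N V b) (y := nestedFamily M N V b')
    (fun k n f => ?_) f
  change nestedCoeff M N V f b = nestedCoeff M N V f b'
  rw [← nestedIncl_apply, ← nestedIncl_apply, h]

/-- Every compatible family of components vanishing for large `S` and `K` comes from an element of
`Γ(M, Γ(N, V))`. -/
theorem DecFamily.exists_nestedCoeff_eq {M N : SymSeq F} {V : ModuleCat.{u} F}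
    (x : DecFamily M (gSeq N V)) (B C : ℕ) (hB : ∀ {S K : Type} [Finite S] [Finite K] (f : S → K),
      B ≤ Nat.card S → x.val f = 0) (hC : ∀ {S K : Type} [Finite S] [Finite K] (f : S → K),
      C ≤ Nat.card K → x.val f = 0) :
    ∃ b : Gamma M (Gamma N V), ∀ {S K : Type} [Finite S] [Finite K] (f : S → K),
      nestedCoeff M N V f b = x.val f := by
  classical
  choose y hy using fun k => x.exists_fibCoeff_eq B hB (Fin k)
  have hinv : ∀ k, y k ∈ (gRep M (Gamma N V) (Fin k)).invariants := fun k σ =>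
    ext_fibCoeff N V fun S _ f => by
      have h : ∀ s, f (Equiv.refl S s) = σ (σ.symm (f s)) := by simp
      refine (fibCoeff_gMap M N V (Equiv.refl S) σ (f := fun s => σ.symm (f s)) h (y k)).trans ?_
      rw [hy, hy]
      exact x.map_val (Equiv.refl S) σ h
  let b : Gamma M (Gamma N V) := ∑ k ∈ Finset.range C, gammaOf M (Gamma N V) k ⟨y k, hinv k⟩
  refine ⟨b, fun f => DecFamily.ext_fin (x := nestedFamily M N V b) (y := x) (fun k n f => ?_) f⟩
  change nestedCoeff M N V f b = x.val f
  rw [nestedCoeff, LinearMap.comp_apply, coeffAt_fin, map_sum]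
  by_cases hk : k < C
  · rw [Finset.sum_eq_single k, gammaCoeff_gammaOf, hy]
    · exact fun j _ hj => gammaCoeff_gammaOf_of_ne M _ hj _
    · exact fun h => absurd (Finset.mem_range.2 hk) h
  · rw [Finset.sum_eq_zero, map_zero, hC f]
    · rw [Nat.card_eq_fintype_card, Fintype.card_fin]
      exact not_lt.1 hk
    · intro j hj
      refine gammaCoeff_gammaOf_of_ne M _ ?_ _
      rintro rfl
      exact hk (Finset.mem_range.1 hj)

/-- The components of an element of `Γ(M, Γ(N, V))` vanish for large `S`. -/
theorem exists_nestedCoeff_eq_zero (M N : SymSeq F) (V : ModuleCat.{u} F)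
    (b : Gamma M (Gamma N V)) : ∃ B, ∀ {S K : Type} [Finite S] [Finite K] (f : S → K),
      B ≤ Nat.card S → nestedCoeff M N V f b = 0 := by
  classical
  obtain ⟨C, hC⟩ := exists_gammaCoeff_eq_zero M (Gamma N V) b
  choose B hB using fun k => exists_trunc_lTensor N V (coeffAt M (Gamma N V) (Fin k) b)
  let D := (Finset.range C).sup fun k => k * B k + 1
  refine ⟨D, fun {S K} _ _ f hS => ?_⟩
  obtain ⟨k, ⟨e⟩⟩ := Finite.exists_equiv_fin K
  have hf : ∀ s, f (Equiv.refl S s) = e.symm (e (f s)) := by simp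
  rw [← decMap_nestedCoeff M N V (Equiv.refl S) e.symm hf b]
  refine (congrArg _ ?_).trans (map_zero _)
  rw [nestedCoeff, LinearMap.comp_apply]
  by_cases hk : k < C
  -- more than `k * B k` points in `k` fibres: some fibre has too many points for its factor
  · have h1 : k * B k < Nat.card S := Nat.lt_of_succ_le
      ((Finset.le_sup (f := fun k => k * B k + 1) (Finset.mem_range.2 hk)).trans hS)
    have := Fintype.ofFinite S
    obtain ⟨i, hi⟩ := Fintype.exists_lt_card_fiber_of_mul_lt_card (fun s => e (f s)) (n := B k)
      (by rwa [Fintype.card_fin, ← Nat.card_eq_fintype_card])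
    have hi' : B k ≤ Nat.card (Fib (fun s => e (f s)) i) := by
      rw [Nat.card_eq_fintype_card, Fintype.card_subtype]
      exact hi.le
    rw [← hB k (B k) le_rfl, ← LinearMap.comp_apply, ← LinearMap.lTensor_comp, fibCoeff,
      ← PiTensorProduct.map_comp, map_eq_zero_of_factor i, LinearMap.lTensor_zero,
      LinearMap.zero_apply]
    refine LinearMap.ext fun x => ?_
    rw [LinearMap.comp_apply, gammaTrunc, LinearMap.sum_apply, map_sum, LinearMap.zero_apply]
    refine Finset.sum_eq_zero fun n hn => ?_
    refine LinearMap.congr_fun (coeffAt_gammaSec_of_ne N V (n := n) ?_) _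
    have := Finset.mem_range.1 hn
    omega
  · rw [coeffAt_fin, hC k (not_lt.1 hk), map_zero]

/-! ### Coefficients of elements of `Γ(M ∘ N, V)` -/

/-- Regrouping `(M(K) ⊗ ⨂_k N(f⁻¹(k))) ⊗ V^{⊗ S} ≅ M(K) ⊗ ⨂_k (N(f⁻¹(k)) ⊗ V^{⊗ f⁻¹(k)})`. -/
def zipDec (M N : SymSeq F) (V : ModuleCat.{u} F) {S K : Type} [Finite S] [Finite K] (f : S → K) :
    (M.obj K ⊗[F] FibTensor N f) ⊗[F] (PiTensorProduct F fun _ : S => (V : Type u)) →ₗ[F]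
      M.obj K ⊗[F] FibTensor (gSeq N V) f :=
  zip f (fun k => N.obj (Fib f k)) (fun _ => V) (M.obj K)

theorem zipDec_tmul (M N : SymSeq F) (V : ModuleCat.{u} F) {S K : Type} [Finite S] [Finite K]
    (f : S → K) (m : M.obj K) (n : ∀ k, N.obj (Fib f k)) (v : S → V) :
    zipDec M N V f ((m ⊗ₜ PiTensorProduct.tprod F n) ⊗ₜ PiTensorProduct.tprod F v) =
      m ⊗ₜ PiTensorProduct.tprod F fun k =>
        (n k ⊗ₜ PiTensorProduct.tprod F fun s : Fib f k => v s : GPre N V (Fib f k)) :=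
  zip_tmul f _ _ _ m n v

theorem bijective_zipDec (M N : SymSeq F) (V : ModuleCat.{u} F) {S K : Type} [Finite S] [Finite K]
    (f : S → K) : Function.Bijective (zipDec M N V f) := bijective_zip _ _ _ _

theorem zipDec_map (M N : SymSeq F) (V : ModuleCat.{u} F) {S T K J : Type} [Finite S]
    [Finite T] [Finite K] [Finite J] (d : S ≃ T) (e : K ≃ J) {f : S → K} {g : T → J}
    (h : ∀ s, g (d s) = e (f s))
    (x : (M.obj K ⊗[F] FibTensor N f) ⊗[F] (PiTensorProduct F fun _ : S => (V : Type u))) :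
    zipDec M N V g (TensorProduct.map (decMap M N d e h) (vMap V d) x) =
      decMap M (gSeq N V) d e h (zipDec M N V f x) := by
  refine LinearMap.congr_fun (f := zipDec M N V g ∘ₗ TensorProduct.map (decMap M N d e h) (vMap V d))
    (g := decMap M (gSeq N V) d e h ∘ₗ zipDec M N V f) (zip_ext fun m n v => ?_) x
  rw [LinearMap.comp_apply, LinearMap.comp_apply, TensorProduct.map_tmul, decMap_tmul, fibMap_tprod,
    vMap_tprod, zipDec_tmul, zipDec_tmul, decMap_tmul, fibMap_tprod]
  congr 2
  funext j
  exact (gMap_tmul N V (fibEquiv d e h j) (n (e.symm j)) (fun s => v s)).symm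

/-- The coefficient at `f : S → K` of an element of `(M ∘ N)(S) ⊗ V^{⊗ S}`. -/
def gCoef (M N : SymSeq F) (V : ModuleCat.{u} F) {S K : Type} [Finite S] [Finite K] (f : S → K) :
    GPre (comp M N) V S →ₗ[F] M.obj K ⊗[F] FibTensor (gSeq N V) f :=
  zipDec M N V f ∘ₗ (coef M N f).rTensor _

theorem gCoef_gMap (M : SymSeq F) {N : SymSeq F} (hN : N.IsReduced) (V : ModuleCat.{u} F)
    {S T K J : Type} [Finite S]
    [Finite T] [Finite K] [Finite J] (d : S ≃ T) (e : K ≃ J) {f : S → K} {g : T → J}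
    (h : ∀ s, g (d s) = e (f s)) (x : GPre (comp M N) V S) :
    gCoef M N V g (gMap (comp M N) V d x) = decMap M (gSeq N V) d e h (gCoef M N V f x) := by
  have hc : coef M N g ∘ₗ (comp M N).map d = decMap M N d e h ∘ₗ coef M N f :=
    LinearMap.ext (coef_map M hN d e h)
  rw [gCoef, LinearMap.comp_apply, gCoef, LinearMap.comp_apply, ← zipDec_map]
  congr 1
  rw [gMap, LinearMap.rTensor, LinearMap.rTensor, ← LinearMap.comp_apply, ← LinearMap.comp_apply,
    ← TensorProduct.map_comp, ← TensorProduct.map_comp, hc, LinearMap.id_comp, LinearMap.comp_id]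

/-- The component at `f : S → K` of an element of `Γ(M ∘ N, V)`. -/
def compositeCoef (M N : SymSeq F) (V : ModuleCat.{u} F) {S K : Type} [Finite S] [Finite K]
    (f : S → K) : Gamma (comp M N) V →ₗ[F] M.obj K ⊗[F] FibTensor (gSeq N V) f :=
  gCoef M N V f ∘ₗ coeffAt (comp M N) V S

theorem decMap_compositeCoef (M : SymSeq F) {N : SymSeq F} (hN : N.IsReduced) (V : ModuleCat.{u} F)
    {S T K J : Type} [Finite S]
    [Finite T] [Finite K] [Finite J] (d : S ≃ T) (e : K ≃ J) {f : S → K} {g : T → J}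
    (h : ∀ s, g (d s) = e (f s)) (a : Gamma (comp M N) V) :
    decMap M (gSeq N V) d e h (compositeCoef M N V f a) = compositeCoef M N V g a := by
  rw [compositeCoef, LinearMap.comp_apply, ← gCoef_gMap M hN, coeffAt_map]; rfl

/-- The components of an element of `Γ(M ∘ N, V)`. -/
def compositeFamily (M : SymSeq F) {N : SymSeq F} (hN : N.IsReduced) (V : ModuleCat.{u} F)
    (a : Gamma (comp M N) V) : DecFamily M (gSeq N V) where
  val f := compositeCoef M N V f a
  map_val d e _ _ h := decMap_compositeCoef M hN V d e h a

theorem sum_rTensor_elt_coef (M : SymSeq F) {N : SymSeq F} (hN : N.IsReduced) {S : Type} [Finite S]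
    [Fintype (Setoid S)] {Y : Type u} [AddCommGroup Y] [Module F Y]
    (x : (comp M N).obj S ⊗[F] Y) :
    ∑ r : Setoid S, (elt M N (Quotient.mk r)).rTensor Y ((coef M N (Quotient.mk r)).rTensor Y x) =
      x := by
  have h := congrArg (fun φ => LinearMap.rTensorHom (R := F) Y φ x) (sum_elt_coef M hN (S := S))
  simp only [map_sum, LinearMap.coe_rTensorHom, LinearMap.sum_apply, LinearMap.rTensor_id,
    LinearMap.id_apply, LinearMap.rTensor_comp, LinearMap.comp_apply] at h
  exact h

/-- Elements of `(M ∘ N)(S) ⊗ V^{⊗ S}` are determined by their coefficients. -/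
theorem ext_gCoef (M : SymSeq F) {N : SymSeq F} (hN : N.IsReduced) (V : ModuleCat.{u} F)
    {S : Type} [Finite S] {x y : GPre (comp M N) V S}
    (h : ∀ {K : Type} [Finite K] (f : S → K), gCoef M N V f x = gCoef M N V f y) : x = y := by
  have := Fintype.ofFinite (Setoid S)
  rw [← sum_rTensor_elt_coef M hN x, ← sum_rTensor_elt_coef M hN y]
  refine Finset.sum_congr rfl fun r _ => ?_
  rw [(bijective_zipDec M N V (Quotient.mk r)).1 (h (Quotient.mk r))]

theorem composite_ext (M : SymSeq F) {N : SymSeq F} (hN : N.IsReduced) (V : ModuleCat.{u} F)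
    {a a' : Gamma (comp M N) V} (h : ∀ {S K : Type} [Finite S] [Finite K] (f : S → K),
      compositeCoef M N V f a = compositeCoef M N V f a') : a = a' := by
  refine gamma_ext (comp M N) V fun n => ext_gCoef M hN V fun f => ?_
  rw [← coeffAt_fin, ← coeffAt_fin]
  exact h f

theorem IsReduced.subsingleton_dec_gSeq (M : SymSeq F) {N : SymSeq F} (hN : N.IsReduced)
    (V : ModuleCat.{u} F) {S K : Type} [Finite S] [Finite K] {f : S → K}
    (hf : ¬ Function.Surjective f) : Subsingleton (M.obj K ⊗[F] FibTensor (gSeq N V) f) := by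
  refine IsReduced.subsingleton_dec M (N := gSeq N V) (fun S _ hS => ?_) hf
  have := hN S hS
  have h : (LinearMap.id : GPre N V S →ₗ[F] _) = 0 := TensorProduct.ext' fun n v => by
    rw [Subsingleton.elim n 0, TensorProduct.zero_tmul, map_zero, map_zero]
  exact ⟨fun x y => (LinearMap.congr_fun h x).trans (LinearMap.congr_fun h y).symm⟩

/-- The components of an element of `Γ(M ∘ N, V)` vanish for large `S`. -/
theorem exists_compositeCoef_eq_zero (M N : SymSeq F) (V : ModuleCat.{u} F)
    (a : Gamma (comp M N) V) : ∃ B, ∀ {S K : Type} [Finite S] [Finite K] (f : S → K),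
      B ≤ Nat.card S → compositeCoef M N V f a = 0 := by
  obtain ⟨B, hB⟩ := exists_gammaCoeff_eq_zero (comp M N) V a
  refine ⟨B, fun f hS => ?_⟩
  rw [compositeCoef, LinearMap.comp_apply, coeffAt, LinearMap.comp_apply, hB _ hS, map_zero, map_zero]

theorem DecFamily.exists_gCoef_eq {M N : SymSeq F} (hN : N.IsReduced) {V : ModuleCat.{u} F}
    (x : DecFamily M (gSeq N V)) (S : Type) [Finite S] : ∃ y : GPre (comp M N) V S,
      ∀ {K : Type} [Finite K] (f : S → K), gCoef M N V f y = x.val f := by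
  classical
  have := Fintype.ofFinite (Setoid S)
  choose z hz using fun r : Setoid S => (bijective_zipDec M N V (Quotient.mk r)).2
    (x.val (Quotient.mk r))
  refine ⟨∑ r : Setoid S, (elt M N (Quotient.mk r)).rTensor _ (z r), fun {K} _ f => ?_⟩
  by_cases hf : Function.Surjective f
  · rw [map_sum, Finset.sum_eq_single (Setoid.ker f)]
    · obtain ⟨e, he⟩ := exists_equiv_quotient_ker hf
      have hc : coef M N f ∘ₗ elt M N (Quotient.mk (Setoid.ker f)) =
          decMap M N (Equiv.refl S) e he := LinearMap.ext (coef_elt_of_equiv M hN e he)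
      have hv : vMap V (Equiv.refl S) = LinearMap.id := tensor_ext fun v => vMap_tprod V _ v
      rw [← x.map_val (Equiv.refl S) e he, ← hz, ← zipDec_map, gCoef, LinearMap.comp_apply,
        ← LinearMap.comp_apply (LinearMap.rTensor _ _), ← LinearMap.rTensor_comp, hc, hv]
      rfl
    · intro r _ hr
      rw [gCoef, LinearMap.comp_apply,
        ← LinearMap.comp_apply (LinearMap.rTensor _ _), ← LinearMap.rTensor_comp,
        coef_elt_quotient_eq_zero M N f hr, LinearMap.rTensor_zero, LinearMap.zero_apply, map_zero]
    · exact fun h => absurd (Finset.mem_univ _) h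
  · have := hN.subsingleton_dec_gSeq M V hf
    exact Subsingleton.elim _ _

/-- Every compatible family of components vanishing for large `S` comes from an element of
`Γ(M ∘ N, V)`. -/
theorem DecFamily.exists_compositeCoef_eq {M N : SymSeq F} (hN : N.IsReduced) {V : ModuleCat.{u} F}
    (x : DecFamily M (gSeq N V)) (B : ℕ) (hB : ∀ {S K : Type} [Finite S] [Finite K] (f : S → K),
      B ≤ Nat.card S → x.val f = 0) :
    ∃ a : Gamma (comp M N) V, ∀ {S K : Type} [Finite S] [Finite K] (f : S → K),
      compositeCoef M N V f a = x.val f := by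
  classical
  choose y hy using fun n => x.exists_gCoef_eq hN (Fin n)
  have hinv : ∀ n, y n ∈ (gRep (comp M N) V (Fin n)).invariants := fun n σ =>
    ext_gCoef M hN V fun {K} _ f => by
      have h : ∀ s, f (σ s) = Equiv.refl K (f (σ s)) := fun _ => rfl
      refine (gCoef_gMap M hN V σ (Equiv.refl K) (f := fun s => f (σ s)) h (y n)).trans ?_
      rw [hy, hy]
      exact x.map_val σ (Equiv.refl K) h
  let a : Gamma (comp M N) V := ∑ n ∈ Finset.range B, gammaOf (comp M N) V n ⟨y n, hinv n⟩
  refine ⟨a, fun f => DecFamily.ext_fin (x := compositeFamily M hN V a) (y := x)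
    (fun k n f => ?_) f⟩
  change compositeCoef M N V f a = x.val f
  rw [compositeCoef, LinearMap.comp_apply, coeffAt_fin, map_sum]
  by_cases hn : n < B
  · rw [Finset.sum_eq_single n, gammaCoeff_gammaOf, hy]
    · exact fun j _ hj => gammaCoeff_gammaOf_of_ne _ _ hj _
    · exact fun h => absurd (Finset.mem_range.2 hn) h
  · rw [Finset.sum_eq_zero, map_zero, hB f]
    · rw [Nat.card_eq_fintype_card, Fintype.card_fin]
      exact not_lt.1 hn
    · intro j hj
      refine gammaCoeff_gammaOf_of_ne _ _ ?_ _
      rintro rfl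
      exact hn (Finset.mem_range.1 hj)

/-! ### The identification of `Γ(M ∘ N, V)` with `Γ(M, Γ(N, V))` -/

theorem exists_nested_of_composite (M : SymSeq F) {N : SymSeq F} (hN : N.IsReduced)
    (V : ModuleCat.{u} F) (a : Gamma (comp M N) V) :
    ∃ b : Gamma M (Gamma N V), ∀ {S K : Type} [Finite S] [Finite K] (f : S → K),
      nestedCoeff M N V f b = compositeCoef M N V f a := by
  obtain ⟨B, hB⟩ := exists_compositeCoef_eq_zero M N V a
  refine (compositeFamily M hN V a).exists_nestedCoeff_eq B B hB fun {S K} _ _ f hK => ?_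
  by_cases hf : Function.Surjective f
  · exact hB f (hK.trans (Nat.card_le_card_of_surjective f hf))
  · have := hN.subsingleton_dec_gSeq M V hf
    exact Subsingleton.elim _ _

theorem exists_composite_of_nested (M : SymSeq F) {N : SymSeq F} (hN : N.IsReduced)
    (V : ModuleCat.{u} F) (b : Gamma M (Gamma N V)) :
    ∃ a : Gamma (comp M N) V, ∀ {S K : Type} [Finite S] [Finite K] (f : S → K),
      nestedCoeff M N V f b = compositeCoef M N V f a := by
  obtain ⟨B, hB⟩ := exists_nestedCoeff_eq_zero M N V b
  obtain ⟨a, ha⟩ := (nestedFamily M N V b).exists_compositeCoef_eq hN B hB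
  exact ⟨a, fun f => (ha f).symm⟩

theorem gammaCoeff_gammaPair {M M' : SymSeq F} (φ : Hom M M') {V W : ModuleCat.{u} F}
    (v : V →ₗ[F] W) (n : ℕ) (x : Gamma M V) :
    gammaCoeff M' W n (gammaPair φ v x) = gPair φ v (Fin n) (gammaCoeff M V n x) := rfl

theorem coeffAt_gammaPair {M M' : SymSeq F} (φ : Hom M M') {V W : ModuleCat.{u} F}
    (v : V →ₗ[F] W) (S : Type) [Finite S] (x : Gamma M V) :
    coeffAt M' W S (gammaPair φ v x) = gPair φ v S (coeffAt M V S x) := by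
  rw [coeffAt, LinearMap.comp_apply, gammaCoeff_gammaPair, ← gPair_gMap]; rfl

theorem compositeCoeff_eq (M N : SymSeq F) (V : ModuleCat.{u} F) {S : Type} [Finite S] {k : ℕ}
    (f : S → Fin k) (y : GPre (dcomp M N) V S) : compositeCoeff M N V f y =
      zipDec M N V f ((preCoeff M N f).rTensor _ y) := rfl

theorem compositeIncl_trace (M N : SymSeq F) (V : ModuleCat.{u} F) (a : Gamma (comp M N) V)
    (k n : ℕ) (f : Fin n → Fin k) :
    compositeIncl M N V (gammaPair (trace M N) LinearMap.id a) k n f = compositeCoef M N V f a := by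
  change compositeCoeff M N V f (gammaCoeff (dcomp M N) V n _) = _
  rw [gammaCoeff_gammaPair, compositeCoeff_eq, compositeCoef, LinearMap.comp_apply, gCoef,
    LinearMap.comp_apply, coeffAt_fin]
  congr 1
  have h : coef M N f = preCoeff M N f ∘ₗ (trace M N).app (Fin n) := LinearMap.ext (coef_fin M N f)
  rw [gPair, PiTensorProduct.map_id, h, LinearMap.rTensor_comp]
  rfl

theorem Hom.ext_apply {M N : SymSeq F} {φ ψ : Hom M N}
    (h : ∀ (S : Type) [Finite S] (x : M.obj S), φ.app S x = ψ.app S x) : φ = ψ :=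
  Hom.ext (funext fun S => funext fun _ => LinearMap.ext fun x => h S x)

theorem homInv_comp {M N : SymSeq F} {φ : Hom M N} (h : IsIsoHom φ) :
    (homInv φ).comp φ = Hom.id M := by
  refine Hom.ext_apply fun S _ x => ?_
  rw [homInv, dif_pos h]
  exact LinearEquiv.symm_apply_apply (LinearEquiv.ofBijective (φ.app S) (h S)) x

theorem comp_homInv {M N : SymSeq F} {φ : Hom M N} (h : IsIsoHom φ) :
    φ.comp (homInv φ) = Hom.id N := by
  refine Hom.ext_apply fun S _ x => ?_
  rw [homInv, dif_pos h]
  exact LinearEquiv.apply_symm_apply (LinearEquiv.ofBijective (φ.app S) (h S)) x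

theorem gammaPair_homInv {M N : SymSeq F} {φ : Hom M N} (h : IsIsoHom φ) (V : ModuleCat.{u} F)
    (x : Gamma N V) : gammaPair φ (LinearMap.id : V →ₗ[F] V)
      (gammaPair (homInv φ) (LinearMap.id : V →ₗ[F] V) x) = x := by
  rw [← LinearMap.comp_apply, ← gammaPair_comp, comp_homInv h, LinearMap.id_comp, gammaPair_id]; rfl

theorem homInv_gammaPair {M N : SymSeq F} {φ : Hom M N} (h : IsIsoHom φ) (V : ModuleCat.{u} F)
    (x : Gamma M V) : gammaPair (homInv φ) (LinearMap.id : V →ₗ[F] V)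
      (gammaPair φ (LinearMap.id : V →ₗ[F] V) x) = x := by
  rw [← LinearMap.comp_apply, ← gammaPair_comp, homInv_comp h, LinearMap.id_comp, gammaPair_id]; rfl

theorem injective_compositeIncl (M : SymSeq F) {N : SymSeq F} (hN : N.IsReduced)
    (V : ModuleCat.{u} F) : Function.Injective (compositeIncl M N V) := fun x y h => by
  rw [← gammaPair_homInv (isIsoHom_trace M hN) V x, ← gammaPair_homInv (isIsoHom_trace M hN) V y]
    at h ⊢
  congr 1
  refine composite_ext M hN V fun f => DecFamily.ext_fin
    (x := compositeFamily M hN V _) (y := compositeFamily M hN V _) (fun k n f => ?_) f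
  change compositeCoef M N V f _ = compositeCoef M N V f _
  rw [← compositeIncl_trace, ← compositeIncl_trace, h]

theorem exists_compositeIncl_eq (M : SymSeq F) {N : SymSeq F} (hN : N.IsReduced)
    (V : ModuleCat.{u} F) (b : Gamma M (Gamma N V)) :
    ∃ x, compositeIncl M N V x = nestedIncl M N V b := by
  obtain ⟨a, ha⟩ := exists_composite_of_nested M hN V b
  refine ⟨gammaPair (trace M N) LinearMap.id a, funext fun k => funext fun n => funext fun f => ?_⟩
  rw [compositeIncl_trace, nestedIncl_apply, ha]

theorem exists_nestedIncl_eq (M : SymSeq F) {N : SymSeq F} (hN : N.IsReduced)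
    (V : ModuleCat.{u} F) (x : Gamma (dcomp M N) V) :
    ∃ b, nestedIncl M N V b = compositeIncl M N V x := by
  rw [← gammaPair_homInv (isIsoHom_trace M hN) V x]
  obtain ⟨b, hb⟩ := exists_nested_of_composite M hN V
    (gammaPair (homInv (trace M N)) LinearMap.id x)
  refine ⟨b, funext fun k => funext fun n => funext fun f => ?_⟩
  rw [compositeIncl_trace, nestedIncl_apply, hb]

/-- The linear map underlying the associator. -/
def dassocMap (M N : SymSeq F) (V : ModuleCat.{u} F) :
    Gamma M (Gamma N V) →ₗ[F] Gamma (dcomp M N) V :=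
  (compositeIncl M N V).leftInverse ∘ₗ nestedIncl M N V

/-- The linear map underlying the inverse associator. -/
def dassocInvMap (M N : SymSeq F) (V : ModuleCat.{u} F) :
    Gamma (dcomp M N) V →ₗ[F] Gamma M (Gamma N V) :=
  (nestedIncl M N V).leftInverse ∘ₗ compositeIncl M N V

theorem compositeIncl_dassocMap (M : SymSeq F) {N : SymSeq F} (hN : N.IsReduced)
    (V : ModuleCat.{u} F) (b : Gamma M (Gamma N V)) :
    compositeIncl M N V (dassocMap M N V b) = nestedIncl M N V b := by
  obtain ⟨x, hx⟩ := exists_compositeIncl_eq M hN V b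
  rw [dassocMap, LinearMap.comp_apply, ← hx, LinearMap.leftInverse_apply_of_inj
    (LinearMap.ker_eq_bot.2 (injective_compositeIncl M hN V))]

theorem nestedIncl_dassocInvMap (M : SymSeq F) {N : SymSeq F} (hN : N.IsReduced)
    (V : ModuleCat.{u} F) (x : Gamma (dcomp M N) V) :
    nestedIncl M N V (dassocInvMap M N V x) = compositeIncl M N V x := by
  obtain ⟨b, hb⟩ := exists_nestedIncl_eq M hN V x
  rw [dassocInvMap, LinearMap.comp_apply, ← hb, LinearMap.leftInverse_apply_of_inj
    (LinearMap.ker_eq_bot.2 (injective_nestedIncl M N V))]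

theorem dassocInvMap_dassocMap (M : SymSeq F) {N : SymSeq F} (hN : N.IsReduced)
    (V : ModuleCat.{u} F) : Function.LeftInverse (dassocInvMap M N V) (dassocMap M N V) := fun b =>
  injective_nestedIncl M N V (by rw [nestedIncl_dassocInvMap M hN, compositeIncl_dassocMap M hN])

theorem dassocMap_dassocInvMap (M : SymSeq F) {N : SymSeq F} (hN : N.IsReduced)
    (V : ModuleCat.{u} F) : Function.RightInverse (dassocInvMap M N V) (dassocMap M N V) := fun x =>
  injective_compositeIncl M hN V
    (by rw [compositeIncl_dassocMap M hN, nestedIncl_dassocInvMap M hN])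

/-- The map `Γ(M ∘ N, V) → Γ(M, Γ(N, V))` given by the trace map and the inverse associator. -/
def thetaMap (M N : SymSeq F) (V : ModuleCat.{u} F) :
    Gamma (comp M N) V →ₗ[F] Gamma M (Gamma N V) :=
  dassocInvMap M N V ∘ₗ gammaPair (trace M N) LinearMap.id

/-- The map `thetaMap` is the one which preserves components. -/
theorem nestedCoeff_thetaMap (M : SymSeq F) {N : SymSeq F} (hN : N.IsReduced)
    (V : ModuleCat.{u} F) {S K : Type} [Finite S] [Finite K] (f : S → K) (a : Gamma (comp M N) V) :
    nestedCoeff M N V f (thetaMap M N V a) = compositeCoef M N V f a := by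
  refine DecFamily.ext_fin (x := nestedFamily M N V _) (y := compositeFamily M hN V a)
    (fun k n f => ?_) f
  change nestedCoeff M N V f _ = compositeCoef M N V f a
  rw [← nestedIncl_apply, ← compositeIncl_trace, thetaMap, LinearMap.comp_apply,
    nestedIncl_dassocInvMap M hN V]

theorem bijective_thetaMap (M : SymSeq F) {N : SymSeq F} (hN : N.IsReduced) (V : ModuleCat.{u} F) :
    Function.Bijective (thetaMap M N V) := by
  rw [thetaMap, LinearMap.coe_comp]
  refine Function.Bijective.comp ⟨(dassocMap_dassocInvMap M hN V).injective,
    (dassocInvMap_dassocMap M hN V).surjective⟩ ?_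
  exact ⟨Function.LeftInverse.injective (homInv_gammaPair (isIsoHom_trace M hN) V),
    Function.RightInverse.surjective (gammaPair_homInv (isIsoHom_trace M hN) V)⟩

/-! ### Naturality of the identification -/

/-- The map `M(K) ⊗ ⨂_k R(f⁻¹(k)) → M'(K) ⊗ ⨂_k R'(f⁻¹(k))` induced by `φ` and by maps in each
factor. -/
def decPair {M M' : SymSeq F} (φ : Hom M M') {K : Type} [Finite K] {X Y : K → Type u}
    [∀ k, AddCommGroup (X k)] [∀ k, Module F (X k)] [∀ k, AddCommGroup (Y k)] [∀ k, Module F (Y k)]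
    (ψ : ∀ k, X k →ₗ[F] Y k) :
    M.obj K ⊗[F] PiTensorProduct F X →ₗ[F] M'.obj K ⊗[F] PiTensorProduct F Y :=
  TensorProduct.map (φ.app K) (PiTensorProduct.map ψ)

theorem decPair_tmul {M M' : SymSeq F} (φ : Hom M M') {K : Type} [Finite K] {X Y : K → Type u}
    [∀ k, AddCommGroup (X k)] [∀ k, Module F (X k)] [∀ k, AddCommGroup (Y k)] [∀ k, Module F (Y k)]
    (ψ : ∀ k, X k →ₗ[F] Y k) (m : M.obj K) (x : ∀ k, X k) :
    decPair φ ψ (m ⊗ₜ PiTensorProduct.tprod F x) =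
      φ.app K m ⊗ₜ PiTensorProduct.tprod F fun k => ψ k (x k) := by
  rw [decPair, TensorProduct.map_tmul, PiTensorProduct.map_tprod]

theorem gPair_tmul {M M' : SymSeq F} (φ : Hom M M') {V W : ModuleCat.{u} F} (v : V →ₗ[F] W)
    {S : Type} [Finite S] (m : M.obj S) (x : S → V) :
    gPair φ v S (m ⊗ₜ PiTensorProduct.tprod F x) =
      φ.app S m ⊗ₜ PiTensorProduct.tprod F fun s => v (x s) := by
  rw [gPair, TensorProduct.map_tmul, PiTensorProduct.map_tprod]

theorem nestedCoeff_gammaPair {M M' N N' : SymSeq F} (φ : Hom M M') (ψ : Hom N N')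
    {V W : ModuleCat.{u} F} (v : V →ₗ[F] W) {S K : Type} [Finite S] [Finite K] (f : S → K)
    (b : Gamma M (Gamma N V)) :
    nestedCoeff M' N' W f (gammaPair φ (gammaPair ψ v) b) =
      decPair φ (fun k => gPair ψ v (Fib f k)) (nestedCoeff M N V f b) := by
  rw [nestedCoeff, LinearMap.comp_apply, coeffAt_gammaPair, nestedCoeff, LinearMap.comp_apply]
  refine LinearMap.congr_fun (f := (fibCoeff N' W f).lTensor (M'.obj K) ∘ₗ
      gPair φ (gammaPair ψ v) K) (g := decPair φ (fun k => gPair ψ v (Fib f k)) ∘ₗ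
        (fibCoeff N V f).lTensor (M.obj K)) (tmul_ext fun m x => ?_) _
  rw [LinearMap.comp_apply, LinearMap.comp_apply, gPair_tmul, LinearMap.lTensor_tmul,
    LinearMap.lTensor_tmul, fibCoeff_tprod, fibCoeff_tprod, decPair_tmul]
  congr 2
  funext k
  exact coeffAt_gammaPair ψ v (Fib f k) (x k)

theorem compMap_elt {M M' N N' : SymSeq F} (φ : Hom M M') (ψ : Hom N N') {S K : Type} [Finite S]
    [Finite K] (f : S → K) (x : M.obj K ⊗[F] FibTensor N f) :
    (compMap φ ψ).app S (elt M N f x) =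
      elt M' N' f (decPair φ (fun k => ψ.app (Fib f k)) x) := by
  classical
  refine LinearMap.congr_fun (f := (compMap φ ψ).app S ∘ₗ elt M N f)
    (g := elt M' N' f ∘ₗ decPair φ fun k => ψ.app (Fib f k)) (tmul_ext fun m n => ?_) x
  obtain ⟨k, ⟨e⟩⟩ := Finite.exists_equiv_fin K
  obtain ⟨g, hg⟩ : ∃ g : S → Fin k, ∀ s, g (Equiv.refl S s) = e (f s) := ⟨fun s => e (f s), fun _ => rfl⟩
  rw [LinearMap.comp_apply, LinearMap.comp_apply, decPair_tmul, elt_tmul M N f e g hg,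
    elt_tmul M' N' f e g hg, fibMap_tprod, fibMap_tprod, ← φ.naturality]
  simp only [← ψ.naturality]
  refine (DirectSum.lmap_lof _ _ _).trans ?_
  have h : prePair φ ψ S (Fin k) (M.map e m ⊗ₜ DirectSum.lof F _ (fun f => FibTensor N f) g
      (PiTensorProduct.tprod F fun j => N.map (fibEquiv (Equiv.refl S) e hg j) (n (e.symm j)))) =
      φ.app (Fin k) (M.map e m) ⊗ₜ DirectSum.lof F _ (fun f => FibTensor N' f) g
        (PiTensorProduct.tprod F fun j => ψ.app (Fib g j)
          (N.map (fibEquiv (Equiv.refl S) e hg j) (n (e.symm j)))) := by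
    rw [prePair, TensorProduct.map_tmul, DirectSum.lmap_lof, PiTensorProduct.map_tprod]
  exact congrArg (fun y => DirectSum.lof F ℕ (fun k => (preRep M' N' S (Fin k)).Coinvariants) k
    (Representation.Coinvariants.mk _ y)) h

theorem coef_compMap {M M' N N' : SymSeq F} (hN : N.IsReduced) (hN' : N'.IsReduced)
    (φ : Hom M M') (ψ : Hom N N') {S K : Type} [Finite S] [Finite K] (f : S → K)
    (z : (comp M N).obj S) : coef M' N' f ((compMap φ ψ).app S z) =
      decPair φ (fun k => ψ.app (Fib f k)) (coef M N f z) := by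
  by_cases hf : Function.Surjective f
  · refine LinearMap.congr_fun (f := coef M' N' f ∘ₗ (compMap φ ψ).app S)
      (g := decPair φ (fun k => ψ.app (Fib f k)) ∘ₗ coef M N f) (comp_ext_elt fun k a m n => ?_) z
    simp only [LinearMap.comp_apply]
    obtain hne | h0 | ⟨m', n', heq⟩ := exists_elt_eq_or M hN f hf a m n
    · rw [compMap_elt, coef_elt_eq_zero M N f a hne, coef_elt_eq_zero M' N' f a hne, map_zero]
    · rw [h0]; simp only [map_zero]
    · rw [heq, compMap_elt, coef_elt_self M hN, coef_elt_self M' hN']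
  · have := hN'.subsingleton_dec M' hf
    exact Subsingleton.elim _ _

theorem compositeCoef_gammaPair {M M' N N' : SymSeq F} (hN : N.IsReduced) (hN' : N'.IsReduced)
    (φ : Hom M M') (ψ : Hom N N')
    {V W : ModuleCat.{u} F} (v : V →ₗ[F] W) {S K : Type} [Finite S] [Finite K] (f : S → K)
    (a : Gamma (comp M N) V) :
    compositeCoef M' N' W f (gammaPair (compMap φ ψ) v a) =
      decPair φ (fun k => gPair ψ v (Fib f k)) (compositeCoef M N V f a) := by
  rw [compositeCoef, LinearMap.comp_apply, coeffAt_gammaPair, compositeCoef, LinearMap.comp_apply,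
    gCoef, LinearMap.comp_apply, gCoef, LinearMap.comp_apply]
  generalize coeffAt (comp M N) V S a = y
  have h1 : ∀ y, zipDec M' N' W f (TensorProduct.map (decPair φ fun k => ψ.app (Fib f k))
      (PiTensorProduct.map fun _ => v) y) =
      decPair φ (fun k => gPair ψ v (Fib f k)) (zipDec M N V f y) := fun y => by
    refine LinearMap.congr_fun (f := zipDec M' N' W f ∘ₗ TensorProduct.map
      (decPair φ fun k => ψ.app (Fib f k)) (PiTensorProduct.map fun _ => v))
      (g := decPair φ (fun k => gPair ψ v (Fib f k)) ∘ₗ zipDec M N V f)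
      (zip_ext fun m n x => ?_) y
    rw [LinearMap.comp_apply, LinearMap.comp_apply, TensorProduct.map_tmul, decPair_tmul,
      PiTensorProduct.map_tprod, zipDec_tmul, zipDec_tmul, decPair_tmul]
    congr 2
    funext k
    exact (gPair_tmul ψ v (n k) (fun s : Fib f k => x s)).symm
  rw [← h1]
  congr 1
  have hc : coef M' N' f ∘ₗ (compMap φ ψ).app S =
      decPair φ (fun k => ψ.app (Fib f k)) ∘ₗ coef M N f :=
    LinearMap.ext (coef_compMap hN hN' φ ψ f)
  rw [gPair, LinearMap.rTensor, LinearMap.rTensor, ← LinearMap.comp_apply, ← LinearMap.comp_apply,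
    ← TensorProduct.map_comp, ← TensorProduct.map_comp, hc, LinearMap.id_comp, LinearMap.comp_id]

theorem thetaMap_gammaPair {M M' N N' : SymSeq F} (hN : N.IsReduced) (hN' : N'.IsReduced)
    (φ : Hom M M') (ψ : Hom N N') {V W : ModuleCat.{u} F} (v : V →ₗ[F] W)
    (a : Gamma (comp M N) V) : thetaMap M' N' W (gammaPair (compMap φ ψ) v a) =
      gammaPair φ (gammaPair ψ v) (thetaMap M N V a) :=
  nested_ext M' N' W fun f => by
    refine (nestedCoeff_thetaMap M' hN' W f _).trans ?_
    rw [compositeCoef_gammaPair hN hN', ← nestedCoeff_thetaMap M hN, nestedCoeff_gammaPair]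

/-! ### Compatibility of the identification with the associators -/

theorem assoc_elt_aux (M N L : SymSeq F) {S K : Type} [Finite S] [Finite K] (h : S → K)
    (y : (comp M N).obj K) (t : FibTensor L h) :
    (assoc M N L).app S (elt (comp M N) L h (y ⊗ₜ t)) = assocAux M N L h y t := by
  obtain ⟨k, ⟨e⟩⟩ := Finite.exists_equiv_fin K
  obtain ⟨g, hg⟩ : ∃ g : S → Fin k, ∀ s, g (Equiv.refl S s) = e (h s) := ⟨fun s => e (h s), fun _ => rfl⟩
  rw [elt_tmul (comp M N) L h e g hg]
  refine (assocApp_cls M N L g _ _).trans ?_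
  rw [assocAux_map M N L (Equiv.refl S) e h g hg, (comp M (comp N L)).map_refl]

/-- The associator on decorated maps to arbitrary finite sets. -/
theorem assoc_elt (M N L : SymSeq F) {S K J : Type} [Finite S] [Finite K] [Finite J] (h : S → K)
    (f : K → J) (m : M.obj J) (n : ∀ j, N.obj (Fib f j)) (l : ∀ k, L.obj (Fib h k)) :
    (assoc M N L).app S (elt (comp M N) L h (elt M N f (m ⊗ₜ PiTensorProduct.tprod F n) ⊗ₜ
      PiTensorProduct.tprod F l)) = elt M (comp N L) (f ∘ h) (m ⊗ₜ PiTensorProduct.tprod F fun j =>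
        elt N L (fibRestrict h f j)
          (n j ⊗ₜ PiTensorProduct.tprod F fun k : Fib f j => L.map (fibFib h f j k) (l k))) := by
  rw [assoc_elt_aux]
  obtain ⟨k, ⟨e⟩⟩ := Finite.exists_equiv_fin J
  obtain ⟨g, hg⟩ : ∃ g : K → Fin k, ∀ s, g (Equiv.refl K s) = e (f s) := ⟨fun s => e (f s), fun _ => rfl⟩
  have hh : ∀ s, h (Equiv.refl S s) = Equiv.refl K (h s) := fun _ => rfl
  have h1 := assocElt_refl M N L (Equiv.refl K) e h h f g hh hg m n l
  rw [fibMap_refl, LinearMap.id_apply] at h1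
  rw [elt_tmul M N f e g hg, assocAux_cls, h1, ← assocFib_tprod]
  rfl

section coherence

variable (M N L : SymSeq F) (V : ModuleCat.{u} F) {S K J : Type} [Finite S] [Finite K] [Finite J]
  (h : S → K) (f : K → J)

/-- The space of components of elements of `Γ(M, Γ(N, Γ(L, V)))` at `S → K → J`. -/
abbrev TripleDec : Type u :=
  M.obj J ⊗[F] PiTensorProduct F fun j => N.obj (Fib f j) ⊗[F]
    PiTensorProduct F fun k : Fib f j => GPre L V (Fib h k)

/-- The regrouping of the decorations of `h` according to the fibres of `f`. -/
def zipTriple : (M.obj J ⊗[F] FibTensor N f) ⊗[F] FibTensor (gSeq L V) h →ₗ[F]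
    TripleDec M N L V h f :=
  zip f (fun j => N.obj (Fib f j)) (fun k => GPre L V (Fib h k)) (M.obj J)

theorem zipTriple_tmul (m : M.obj J) (n : ∀ j, N.obj (Fib f j)) (l : ∀ k, GPre L V (Fib h k)) :
    zipTriple M N L V h f ((m ⊗ₜ PiTensorProduct.tprod F n) ⊗ₜ PiTensorProduct.tprod F l) =
      m ⊗ₜ PiTensorProduct.tprod F fun j => n j ⊗ₜ PiTensorProduct.tprod F fun k : Fib f j => l k :=
  zip_tmul f _ _ _ m n l

theorem bijective_zipTriple : Function.Bijective (zipTriple M N L V h f) := bijective_zip _ _ _ _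

/-- The component at `h : S → K` of an element of `M(J) ⊗ ⨂_j (N(f⁻¹(j)) ⊗ Γ(L, V)^{⊗ f⁻¹(j)})`. -/
def innerCoeff : M.obj J ⊗[F] FibTensor (gSeq N (Gamma L V)) f →ₗ[F] TripleDec M N L V h f :=
  (PiTensorProduct.map fun j => ((PiTensorProduct.map fun k : Fib f j =>
    coeffAt L V (Fib h k)).lTensor (N.obj (Fib f j)) :
      GPre N (Gamma L V) (Fib f j) →ₗ[F] _)).lTensor (M.obj J)

theorem innerCoeff_zipDec
    (x : (M.obj J ⊗[F] FibTensor N f) ⊗[F] PiTensorProduct F fun _ : K => (Gamma L V : Type u)) :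
    innerCoeff M N L V h f (zipDec M N (Gamma L V) f x) =
      zipTriple M N L V h f ((fibCoeff L V h).lTensor _ x) := by
  refine LinearMap.congr_fun (f := innerCoeff M N L V h f ∘ₗ zipDec M N (Gamma L V) f)
    (g := zipTriple M N L V h f ∘ₗ (fibCoeff L V h).lTensor _) (zip_ext fun m n x => ?_) x
  rw [LinearMap.comp_apply, LinearMap.comp_apply, zipDec_tmul, LinearMap.lTensor_tmul,
    fibCoeff_tprod, zipTriple_tmul, innerCoeff, LinearMap.lTensor_tmul, PiTensorProduct.map_tprod]
  congr 2
  funext j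
  rw [LinearMap.lTensor_tmul, PiTensorProduct.map_tprod]

theorem ext_innerCoeff {x y : M.obj J ⊗[F] FibTensor (gSeq N (Gamma L V)) f}
    (hxy : ∀ {S : Type} [Finite S] (h : S → K),
      innerCoeff M N L V h f x = innerCoeff M N L V h f y) : x = y := by
  obtain ⟨x, rfl⟩ := (bijective_zipDec M N (Gamma L V) f).2 x
  obtain ⟨y, rfl⟩ := (bijective_zipDec M N (Gamma L V) f).2 y
  congr 1
  refine ext_fibCoeff L V fun S _ h => (bijective_zipTriple M N L V h f).1 ?_
  rw [← innerCoeff_zipDec, ← innerCoeff_zipDec, hxy]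

/-- The identification of the fibres of the restrictions of `h` with those of `h`, on decorations. -/
def fibFibMap (j : J) : N.obj (Fib f j) ⊗[F] FibTensor (gSeq L V) (fibRestrict h f j) →ₗ[F]
    N.obj (Fib f j) ⊗[F] PiTensorProduct F fun k : Fib f j => GPre L V (Fib h k) :=
  (PiTensorProduct.map fun k : Fib f j => gMap L V (fibFib h f j k).symm).lTensor (N.obj (Fib f j))

theorem lTensor_coeffAt_eq {J : Type} (f : K → J) (j : J) (w : Gamma N (Gamma L V)) :
    (PiTensorProduct.map fun k : Fib f j => coeffAt L V (Fib h k)).lTensor (N.obj (Fib f j))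
      (coeffAt N (Gamma L V) (Fib f j) w) =
      fibFibMap N L V h f j (nestedCoeff N L V (fibRestrict h f j) w) := by
  rw [nestedCoeff, LinearMap.comp_apply, fibFibMap, fibCoeff]
  generalize coeffAt N (Gamma L V) (Fib f j) w = y
  rw [← LinearMap.comp_apply, ← LinearMap.lTensor_comp, ← PiTensorProduct.map_comp]
  congr 3
  funext k
  exact LinearMap.ext fun x => (coeffAt_map L V (fibFib h f j k).symm x).symm

/-- Components of components: the decoration of `f ∘ h` by elements of `N ∘ L` is expanded along the
restrictions of `h` to the fibres. -/
def expand : M.obj J ⊗[F] FibTensor (gSeq (comp N L) V) (f ∘ h) →ₗ[F] TripleDec M N L V h f :=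
  (PiTensorProduct.map fun j => (fibFibMap N L V h f j ∘ₗ gCoef N L V (fibRestrict h f j) :
    GPre (comp N L) V (Fib (f ∘ h) j) →ₗ[F] _)).lTensor (M.obj J)

variable {L} in
theorem innerCoeff_nested (hL : L.IsReduced) (u : Gamma M (Gamma (comp N L) V)) :
    innerCoeff M N L V h f (nestedCoeff M N (Gamma L V) f
      (gammaPair (Hom.id M) (thetaMap N L V) u)) =
      expand M N L V h f (nestedCoeff M (comp N L) V (f ∘ h) u) := by
  rw [nestedCoeff, LinearMap.comp_apply, coeffAt_gammaPair, nestedCoeff, LinearMap.comp_apply]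
  refine LinearMap.congr_fun (f := innerCoeff M N L V h f ∘ₗ
    (fibCoeff N (Gamma L V) f).lTensor (M.obj J) ∘ₗ gPair (Hom.id M) (thetaMap N L V) J)
    (g := expand M N L V h f ∘ₗ (fibCoeff (comp N L) V (f ∘ h)).lTensor (M.obj J))
    (tmul_ext fun m w => ?_) (coeffAt M (Gamma (comp N L) V) J u)
  rw [LinearMap.comp_apply, LinearMap.comp_apply, LinearMap.comp_apply, gPair_tmul,
    LinearMap.lTensor_tmul, LinearMap.lTensor_tmul, fibCoeff_tprod, fibCoeff_tprod, innerCoeff,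
    expand, LinearMap.lTensor_tmul, LinearMap.lTensor_tmul, PiTensorProduct.map_tprod,
    PiTensorProduct.map_tprod]
  refine congrArg (m ⊗ₜ[F] ·) (congrArg _ (funext fun j => ?_))
  rw [lTensor_coeffAt_eq, nestedCoeff_thetaMap N hL]
  rfl

end coherence

theorem rTensor_elt_ext {M N : SymSeq F} {S : Type} [Finite S] {B : S → Type u}
    [∀ s, AddCommGroup (B s)] [∀ s, Module F (B s)] {W : Type u} [AddCommGroup W] [Module F W]
    {φ ψ : (comp M N).obj S ⊗[F] PiTensorProduct F B →ₗ[F] W}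
    (h : ∀ (k : ℕ) (f : S → Fin k) (m : M.obj (Fin k)) (n : ∀ i, N.obj (Fib f i)) (b : ∀ s, B s),
      φ (elt M N f (m ⊗ₜ PiTensorProduct.tprod F n) ⊗ₜ PiTensorProduct.tprod F b) =
        ψ (elt M N f (m ⊗ₜ PiTensorProduct.tprod F n) ⊗ₜ PiTensorProduct.tprod F b)) : φ = ψ :=
  TensorProduct.ext (comp_ext_elt fun k f m n => tensor_ext fun b => h k f m n b)

theorem gCoef_tmul (M N : SymSeq F) (V : ModuleCat.{u} F) {S K : Type} [Finite S] [Finite K]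
    (f : S → K) (z : (comp M N).obj S) (v : S → V) :
    gCoef M N V f (z ⊗ₜ PiTensorProduct.tprod F v) =
      zipDec M N V f (coef M N f z ⊗ₜ PiTensorProduct.tprod F v) := rfl

theorem gCoef_elt (M : SymSeq F) {N : SymSeq F} (hN : N.IsReduced) (V : ModuleCat.{u} F)
    {S K : Type} [Finite S] [Finite K] (f : S → K) (m : M.obj K) (n : ∀ k, N.obj (Fib f k))
    (v : S → V) :
    gCoef M N V f (elt M N f (m ⊗ₜ PiTensorProduct.tprod F n) ⊗ₜ PiTensorProduct.tprod F v) =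
      m ⊗ₜ PiTensorProduct.tprod F fun k =>
        (n k ⊗ₜ PiTensorProduct.tprod F fun s : Fib f k => v s : GPre N V (Fib f k)) := by
  rw [gCoef_tmul, coef_elt_self M hN, zipDec_tmul]

theorem gCoef_elt_eq_zero (M N : SymSeq F) (V : ModuleCat.{u} F) {S K J : Type} [Finite S]
    [Finite K] [Finite J] (f : S → K) (g : S → J) (h : ¬ ∀ s t, g s = g t ↔ f s = f t)
    (x : M.obj J ⊗[F] FibTensor N g) (v : S → V) :
    gCoef M N V f (elt M N g x ⊗ₜ PiTensorProduct.tprod F v) = 0 := by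
  rw [gCoef_tmul, coef_elt_eq_zero M N f g h, TensorProduct.zero_tmul, map_zero]

theorem expand_tmul (M N L : SymSeq F) (V : ModuleCat.{u} F) {S K J : Type} [Finite S] [Finite K]
    [Finite J] (h : S → K) (f : K → J) (m : M.obj J) (x : ∀ j, GPre (comp N L) V (Fib (f ∘ h) j)) :
    expand M N L V h f (m ⊗ₜ PiTensorProduct.tprod F x) = m ⊗ₜ PiTensorProduct.tprod F fun j =>
      fibFibMap N L V h f j (gCoef N L V (fibRestrict h f j) (x j)) := by
  rw [expand, LinearMap.lTensor_tmul, PiTensorProduct.map_tprod]; rfl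

/-- The expansion of a class supported on other partitions than those defined by `h` and `f ∘ h`
vanishes. -/
theorem expand_gCoef_eq_zero (M N L : SymSeq F) (hNL : (comp N L).IsReduced) (V : ModuleCat.{u} F)
    {S K J K' J' : Type} [Finite S] [Finite K] [Finite J] [Finite K'] [Finite J'] (h : S → K)
    (f : K → J) (hh : Function.Surjective h) (hf : Function.Surjective f) (b : S → K') (a : K' → J')
    (hne : ¬ ((∀ s t, b s = b t ↔ h s = h t) ∧ ∀ s t, (a ∘ b) s = (a ∘ b) t ↔ (f ∘ h) s = (f ∘ h) t))
    (m : M.obj J') (n : ∀ j, N.obj (Fib a j)) (l : ∀ k, L.obj (Fib b k)) (v : S → V) :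
    expand M N L V h f (gCoef M (comp N L) V (f ∘ h) ((assoc M N L).app S (elt (comp M N) L b
      (elt M N a (m ⊗ₜ PiTensorProduct.tprod F n) ⊗ₜ PiTensorProduct.tprod F l)) ⊗ₜ
        PiTensorProduct.tprod F v)) = 0 := by
  rw [assoc_elt]
  by_cases hk : ∀ s t, (a ∘ b) s = (a ∘ b) t ↔ (f ∘ h) s = (f ∘ h) t
  swap
  · rw [gCoef_elt_eq_zero M (comp N L) V _ _ hk, map_zero]
  have hb' : ¬ ∀ s t, b s = b t ↔ h s = h t := fun hb => hne ⟨hb, hk⟩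
  by_cases hab : Function.Surjective (a ∘ b)
  swap
  · have := hNL.subsingleton_dec M hab
    rw [Subsingleton.elim (m ⊗ₜ[F] PiTensorProduct.tprod F fun j => _) 0, map_zero,
      TensorProduct.zero_tmul, map_zero, map_zero]
  obtain ⟨β, hβ⟩ := exists_equiv_of_ker_eq hab (hf.comp hh) hk
  rw [← elt_decMap_refl M (comp N L) β hβ, decMap_tmul, fibMap_tprod, gCoef_elt M hNL, expand_tmul]
  -- two points separated by exactly one of `b`, `h` lie in the same fibre of `f ∘ h`
  obtain ⟨s, t, hst, hfst⟩ : ∃ s t, ¬ (b s = b t ↔ h s = h t) ∧ (f ∘ h) s = (f ∘ h) t := by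
    push Not at hb'
    obtain ⟨s, t, hst⟩ := hb'
    refine ⟨s, t, fun hc => ?_, ?_⟩
    · tauto
    · rcases hst with ⟨h1, -⟩ | ⟨-, h1⟩
      · exact (hk s t).1 (congrArg a h1)
      · exact congrArg f h1
  have h0 : fibFibMap N L V h f ((f ∘ h) s) (gCoef N L V (fibRestrict h f ((f ∘ h) s))
      ((comp N L).map (fibEquiv (Equiv.refl S) β hβ ((f ∘ h) s)) (elt N L
        (fibRestrict b a (β.symm ((f ∘ h) s))) (n (β.symm ((f ∘ h) s)) ⊗ₜ
          PiTensorProduct.tprod F fun k : Fib a (β.symm ((f ∘ h) s)) =>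
            L.map (fibFib b a (β.symm ((f ∘ h) s)) k) (l k))) ⊗ₜ
        PiTensorProduct.tprod F fun s' : Fib (f ∘ h) ((f ∘ h) s) => v s')) = 0 := by
    have hr : ∀ s', (fun s' => fibRestrict b a (β.symm ((f ∘ h) s))
        ((fibEquiv (Equiv.refl S) β hβ ((f ∘ h) s)).symm s'))
          (fibEquiv (Equiv.refl S) β hβ ((f ∘ h) s) s') = Equiv.refl _
            (fibRestrict b a (β.symm ((f ∘ h) s)) s') := fun s' => by
      simp only [Equiv.symm_apply_apply, Equiv.refl_apply]
    rw [← elt_decMap N L (g := fun s' => fibRestrict b a (β.symm ((f ∘ h) s))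
        ((fibEquiv (Equiv.refl S) β hβ ((f ∘ h) s)).symm s'))
      (fibEquiv (Equiv.refl S) β hβ ((f ∘ h) s)) (Equiv.refl _) hr,
      gCoef_elt_eq_zero, map_zero]
    intro hc
    refine hst ?_
    have := hc ⟨s, rfl⟩ ⟨t, hfst.symm⟩
    exact ⟨fun h1 => congrArg Subtype.val (this.1 (Subtype.ext h1)),
      fun h1 => congrArg Subtype.val (this.2 (Subtype.ext h1))⟩
  rw [(PiTensorProduct.tprod F).map_coord_zero ((f ∘ h) s) h0, TensorProduct.tmul_zero]

/-- Components of elements of `((M ∘ N) ∘ L)(S) ⊗ V^{⊗ S}` do not depend on the bracketing. -/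
theorem zipTriple_coef (M N L : SymSeq F) (hN : N.IsReduced) (hL : L.IsReduced)
    (hNL : (comp N L).IsReduced) (V : ModuleCat.{u} F)
    {S K J : Type} [Finite S] [Finite K] [Finite J] (h : S → K) (f : K → J)
    (z : GPre (comp (comp M N) L) V S) :
    zipTriple M N L V h f ((coef M N f).rTensor _ (gCoef (comp M N) L V h z)) =
      expand M N L V h f (gCoef M (comp N L) V (f ∘ h) (gPair (assoc M N L) LinearMap.id S z)) := by
  by_cases hh : Function.Surjective h
  swap
  · have := hL.subsingleton_dec_gSeq (comp M N) V hh
    have h2 : Subsingleton ((M.obj J ⊗[F] FibTensor N f) ⊗[F] FibTensor (gSeq L V) h) := by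
      have h3 : (LinearMap.id : (M.obj J ⊗[F] FibTensor N f) ⊗[F] FibTensor (gSeq L V) h →ₗ[F] _) =
          0 := by
        have := IsReduced.subsingleton_fibTensor (N := gSeq L V) (fun S _ hS => by
          have := hL S hS
          have h : (LinearMap.id : GPre L V S →ₗ[F] _) = 0 := TensorProduct.ext' fun n v => by
            rw [Subsingleton.elim n 0, TensorProduct.zero_tmul, map_zero, map_zero]
          exact ⟨fun x y => (LinearMap.congr_fun h x).trans (LinearMap.congr_fun h y).symm⟩) hh
        exact TensorProduct.ext' fun x y => by
          rw [Subsingleton.elim y 0, TensorProduct.tmul_zero, map_zero, map_zero]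
      exact ⟨fun x y => (LinearMap.congr_fun h3 x).trans (LinearMap.congr_fun h3 y).symm⟩
    have := (bijective_zipTriple M N L V h f).2.subsingleton
    exact Subsingleton.elim _ _
  by_cases hf : Function.Surjective f
  swap
  · have := hN.subsingleton_dec M hf
    have h2 : Subsingleton ((M.obj J ⊗[F] FibTensor N f) ⊗[F] FibTensor (gSeq L V) h) := by
      have h3 : (LinearMap.id : (M.obj J ⊗[F] FibTensor N f) ⊗[F] FibTensor (gSeq L V) h →ₗ[F] _) =
          0 := TensorProduct.ext' fun x y => by
        rw [Subsingleton.elim x 0, TensorProduct.zero_tmul, map_zero, map_zero]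
      exact ⟨fun x y => (LinearMap.congr_fun h3 x).trans (LinearMap.congr_fun h3 y).symm⟩
    have := (bijective_zipTriple M N L V h f).2.subsingleton
    exact Subsingleton.elim _ _
  have hgp : ∀ (y : (comp (comp M N) L).obj S) (v : S → V),
      gPair (assoc M N L) LinearMap.id S (y ⊗ₜ PiTensorProduct.tprod F v) =
        (assoc M N L).app S y ⊗ₜ PiTensorProduct.tprod F v := fun y v => gPair_tmul _ _ y v
  let Φ : GPre (comp (comp M N) L) V S →ₗ[F] TripleDec M N L V h f :=
    zipTriple M N L V h f ∘ₗ (coef M N f).rTensor _ ∘ₗ gCoef (comp M N) L V h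
  let Ψ : GPre (comp (comp M N) L) V S →ₗ[F] TripleDec M N L V h f :=
    expand M N L V h f ∘ₗ gCoef M (comp N L) V (f ∘ h) ∘ₗ gPair (assoc M N L) LinearMap.id S
  -- the case of a class supported on the partition of `S` defined by `h`
  have hmain : ∀ (y : (comp M N).obj K) (l : ∀ k, L.obj (Fib h k)) (v : S → V),
      Φ (elt (comp M N) L h (y ⊗ₜ PiTensorProduct.tprod F l) ⊗ₜ PiTensorProduct.tprod F v) =
        Ψ (elt (comp M N) L h (y ⊗ₜ PiTensorProduct.tprod F l) ⊗ₜ PiTensorProduct.tprod F v) := by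
    intro y l v
    let I : (comp M N).obj K →ₗ[F] GPre (comp (comp M N) L) V S :=
      (TensorProduct.mk F _ _).flip (PiTensorProduct.tprod F v) ∘ₗ elt (comp M N) L h ∘ₗ
        (TensorProduct.mk F _ _).flip (PiTensorProduct.tprod F l)
    refine LinearMap.congr_fun (f := Φ ∘ₗ I) (g := Ψ ∘ₗ I) (comp_ext_elt fun j a m n => ?_) y
    change zipTriple M N L V h f ((coef M N f).rTensor _ (gCoef (comp M N) L V h
      (elt (comp M N) L h (elt M N a (m ⊗ₜ PiTensorProduct.tprod F n) ⊗ₜ PiTensorProduct.tprod F l)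
        ⊗ₜ PiTensorProduct.tprod F v))) = expand M N L V h f (gCoef M (comp N L) V (f ∘ h)
      (gPair (assoc M N L) LinearMap.id S (elt (comp M N) L h (elt M N a
        (m ⊗ₜ PiTensorProduct.tprod F n) ⊗ₜ PiTensorProduct.tprod F l) ⊗ₜ
          PiTensorProduct.tprod F v)))
    rw [hgp, gCoef_elt _ hL, LinearMap.rTensor_tmul]
    obtain hne | h0 | ⟨m', n', heq⟩ := exists_elt_eq_or M hN f hf a m n
    · rw [coef_elt_eq_zero M N f a hne, TensorProduct.zero_tmul, map_zero,
        expand_gCoef_eq_zero M N L hNL V h f hh hf]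
      rintro ⟨-, h2⟩
      refine hne fun s t => ?_
      obtain ⟨s, rfl⟩ := hh s
      obtain ⟨t, rfl⟩ := hh t
      exact h2 s t
    · rw [h0]
      simp only [map_zero, TensorProduct.zero_tmul]
    · rw [heq, assoc_elt, coef_elt_self M hN, zipTriple_tmul, gCoef_elt M hNL, expand_tmul]
      refine congrArg (m' ⊗ₜ[F] ·) (congrArg _ (funext fun j => ?_))
      have hc := gCoef_elt N hL V (fibRestrict h f j) (n' j)
        (fun k => L.map (fibFib h f j k) (l k)) (fun s => v s)
      refine Eq.trans ?_ (congrArg (fibFibMap N L V h f j) hc).symm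
      rw [fibFibMap, LinearMap.lTensor_tmul, PiTensorProduct.map_tprod]
      refine congrArg (n' j ⊗ₜ[F] ·) (congrArg _ (funext fun k => ?_))
      rw [gMap_tmul]
      have hl : L.map (fibFib h f j k).symm (L.map (fibFib h f j k) (l k)) = l k := by
        rw [← L.map_trans, Equiv.self_trans_symm, L.map_refl]
      rw [hl]
      rfl
  refine LinearMap.congr_fun (f := Φ) (g := Ψ) (rTensor_elt_ext fun k b y l v => ?_) z
  obtain hne | h0 | ⟨m', n', heq⟩ := exists_elt_eq_or (comp M N) hL h hh b y l
  · have h1 : Φ (elt (comp M N) L b (y ⊗ₜ PiTensorProduct.tprod F l) ⊗ₜ PiTensorProduct.tprod F v) =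
        0 := by
      change zipTriple M N L V h f ((coef M N f).rTensor _ (gCoef (comp M N) L V h
        (elt (comp M N) L b (y ⊗ₜ PiTensorProduct.tprod F l) ⊗ₜ PiTensorProduct.tprod F v))) = 0
      rw [gCoef_elt_eq_zero (comp M N) L V h b hne, map_zero, map_zero]
    rw [h1]
    let I : (comp M N).obj (Fin k) →ₗ[F] GPre (comp (comp M N) L) V S :=
      (TensorProduct.mk F _ _).flip (PiTensorProduct.tprod F v) ∘ₗ elt (comp M N) L b ∘ₗ
        (TensorProduct.mk F _ _).flip (PiTensorProduct.tprod F l)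
    refine LinearMap.congr_fun (f := 0) (g := Ψ ∘ₗ I) (comp_ext_elt fun j a m n => ?_) y
    refine Eq.symm ?_
    change expand M N L V h f (gCoef M (comp N L) V (f ∘ h)
      (gPair (assoc M N L) LinearMap.id S (elt (comp M N) L b (elt M N a
        (m ⊗ₜ PiTensorProduct.tprod F n) ⊗ₜ PiTensorProduct.tprod F l) ⊗ₜ
          PiTensorProduct.tprod F v))) = 0
    rw [hgp]
    exact expand_gCoef_eq_zero M N L hNL V h f hh hf b a (fun h2 => hne h2.1) m n l v
  · rw [h0, TensorProduct.zero_tmul, map_zero, map_zero]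
  · rw [heq]
    exact hmain m' n' v

/-- The identifications `Γ(M ∘ N, V) ≅ Γ(M, Γ(N, V))` are compatible with the associators of `∘`. -/
theorem thetaMap_assoc (M N L : SymSeq F) (hN : N.IsReduced) (hL : L.IsReduced)
    (hNL : (comp N L).IsReduced) (V : ModuleCat.{u} F) (x : Gamma (comp (comp M N) L) V) :
    thetaMap M N (Gamma L V) (thetaMap (comp M N) L V x) =
      gammaPair (Hom.id M) (thetaMap N L V) (thetaMap M (comp N L) V
        (gammaPair (assoc M N L) LinearMap.id x)) := by
  refine nested_ext M N (Gamma L V) fun {K J} _ _ f => ext_innerCoeff M N L V f fun {S} _ h => ?_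
  rw [innerCoeff_nested M N V h f hL, nestedCoeff_thetaMap M hN, nestedCoeff_thetaMap M hNL,
    compositeCoef, LinearMap.comp_apply, compositeCoef, LinearMap.comp_apply, coeffAt_gammaPair,
    gCoef, LinearMap.comp_apply, innerCoeff_zipDec, ← zipTriple_coef M N L hN hL hNL]
  congr 1
  have h1 := nestedCoeff_thetaMap (comp M N) hL V h x
  rw [nestedCoeff, LinearMap.comp_apply, compositeCoef, LinearMap.comp_apply] at h1
  rw [← h1]
  generalize coeffAt (comp M N) (Gamma L V) K (thetaMap (comp M N) L V x) = y
  rw [← LinearMap.comp_apply, ← LinearMap.comp_apply, LinearMap.lTensor_comp_rTensor,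
    LinearMap.rTensor_comp_lTensor]

theorem IsReduced.comp {M N : SymSeq F} (hM : M.IsReduced) (hN : N.IsReduced) :
    (comp M N).IsReduced := fun S _ hS => by
  have h : (LinearMap.id : (SymSeq.comp M N).obj S →ₗ[F] _) = 0 := comp_ext_elt fun k f m n => by
    rw [LinearMap.id_apply, LinearMap.zero_apply]
    rcases Nat.eq_zero_or_pos k with rfl | hk
    · have := hM (Fin 0) inferInstance
      rw [Subsingleton.elim m 0, TensorProduct.zero_tmul, map_zero]
    · have := hN.subsingleton_dec M (f := f) fun hf => hS.elim (hf ⟨0, hk⟩).choose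
      rw [Subsingleton.elim (m ⊗ₜ[F] PiTensorProduct.tprod F n) 0, map_zero]
  exact ⟨fun x y => (LinearMap.congr_fun h x).trans (LinearMap.congr_fun h y).symm⟩

/-! ### Compatibility of the identification with the units -/

/-- The only fibre of the map `S → {*}`. -/
def wholeFib (S : Type) (k : Unit) : S ≃ Fib (fun _ : S => ()) k :=
  (Equiv.subtypeUnivEquiv (p := fun _ : S => () = k) fun _ => rfl).symm

theorem insertLeft_apply (M N : SymSeq F) (one : M.obj Unit) (S : Type) [Finite S] (x : N.obj S) :
    insertLeft M N one S x = elt M N (fun _ : S => ()) (one ⊗ₜ PiTensorProduct.tprod F fun k =>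
      N.map (wholeFib S k) x) := by
  refine congrArg (fun t => elt M N (fun _ : S => ()) (one ⊗ₜ t)) ?_
  refine (LinearEquiv.symm_apply_eq _).2 ?_
  rw [PiTensorProduct.subsingletonEquiv_apply_tprod]
  rfl

theorem insertRight_apply (M N : SymSeq F) (one : N.obj Unit) (S : Type) [Finite S] (x : M.obj S) :
    insertRight M N one S x = elt M N (id : S → S) (x ⊗ₜ PiTensorProduct.tprod F fun s =>
      N.map (fibIdEquiv s) one) := rfl

/-- The morphism `N = U ∘ N → M ∘ N` induced by a map `U → M`. -/
def insertLeftHom (M N : SymSeq F) (one : M.obj Unit) : Hom N (comp M N) where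
  app S _ := insertLeft M N one S
  naturality {S T} _ _ d x := by
    have h : ∀ s : S, (fun _ : T => ()) (d s) = Equiv.refl Unit ((fun _ : S => ()) s) := fun _ => rfl
    rw [insertLeft_apply, insertLeft_apply, ← elt_map M N d (Equiv.refl Unit) _ (fun _ : T => ()) h, M.map_refl,
      fibMap_tprod]
    refine congrArg (fun t => elt M N (fun _ : T => ()) (one ⊗ₜ PiTensorProduct.tprod F t))
      (funext fun k => ?_)
    rw [← N.map_trans, ← N.map_trans]
    rfl

/-- The morphism `M = M ∘ U → M ∘ N` induced by a map `U → N`. -/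
def insertRightHom (M N : SymSeq F) (one : N.obj Unit) : Hom M (comp M N) where
  app S _ := insertRight M N one S
  naturality {S T} _ _ d x := by
    have h : ∀ s : S, (id : T → T) (d s) = d ((id : S → S) s) := fun _ => rfl
    rw [insertRight_apply, insertRight_apply, ← elt_map M N d d (id : S → S) (id : T → T) h, fibMap_tprod]
    refine congrArg (fun t => elt M N (id : T → T) (M.map d x ⊗ₜ PiTensorProduct.tprod F t))
      (funext fun k => ?_)
    rw [← N.map_trans]
    congr 2
    exact Equiv.ext fun _ => Subtype.ext (d.apply_symm_apply k).symm

/-- The linear map underlying the unit of `Γ(P)`. -/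
def gammaUnitMap (P : OperadData F) (V : ModuleCat.{u} F) : V →ₗ[F] Gamma P.seq V :=
  (gammaUnit P V).hom

theorem coeffAt_gammaUnitMap (P : OperadData F) (V : ModuleCat.{u} F) {S : Type} [Finite S]
    (u : Unit ≃ S) (v : V) : coeffAt P.seq V S (gammaUnitMap P V v) =
      P.seq.map u P.one ⊗ₜ PiTensorProduct.tprod F fun _ => v := by
  have h : gammaCoeff P.seq V 1 (gammaUnitMap P V v) =
      P.seq.map (Equiv.ofUnique Unit (Fin 1)) P.one ⊗ₜ PiTensorProduct.tprod F fun _ => v := by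
    refine (gammaCoeff_gammaOf P.seq V 1 _).trans ?_
    refine congrArg (P.seq.map (Equiv.ofUnique Unit (Fin 1)) P.one ⊗ₜ[F] ·) ?_
    exact PiTensorProduct.subsingletonEquiv_symm_apply' _ _
  rw [coeffAt_eq P.seq V ((Equiv.ofUnique Unit (Fin 1)).symm.trans u), h, gMap_tmul,
    ← P.seq.map_trans]
  rfl

theorem coeffAt_gammaUnitMap_of_ne (P : OperadData F) (V : ModuleCat.{u} F) {S : Type} [Finite S]
    (h : IsEmpty (Unit ≃ S)) : coeffAt P.seq V S ∘ₗ gammaUnitMap P V = 0 := by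
  refine LinearMap.ext fun v => ?_
  have h1 : 1 ≠ Nat.card S := fun h1 =>
    h.elim ((Equiv.ofUnique Unit (Fin 1)).trans (Finite.equivFinOfCardEq h1.symm).symm)
  rw [LinearMap.comp_apply, coeffAt, LinearMap.comp_apply]
  refine (congrArg _ (gammaCoeff_gammaOf_of_ne P.seq V h1 _)).trans (map_zero _)

/-- The identification turns the inclusion `N = U ∘ N → P ∘ N` into the unit of `Γ(P)`. -/
theorem thetaMap_insertLeft (P : OperadData F) {N : SymSeq F} (hN : N.IsReduced)
    (V : ModuleCat.{u} F) (a : Gamma N V) :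
    thetaMap P.seq N V (gammaPair (insertLeftHom P.seq N P.one) LinearMap.id a) =
      gammaUnitMap P (Gamma N V) a := by
  refine nested_ext P.seq N V fun {S K} _ _ f => ?_
  by_cases hK : Nonempty (Unit ≃ K)
  · obtain ⟨e⟩ := hK
    have hf : ∀ s, f (Equiv.refl S s) = e ((fun _ : S => ()) s) := fun s =>
      e.symm.injective (Subsingleton.elim _ _)
    rw [← decMap_nestedCoeff P.seq N V (Equiv.refl S) e hf,
      ← decMap_nestedCoeff P.seq N V (Equiv.refl S) e hf]
    congr 1
    rw [nestedCoeff_thetaMap P.seq hN, compositeCoef, LinearMap.comp_apply, coeffAt_gammaPair,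
      nestedCoeff, LinearMap.comp_apply, coeffAt_gammaUnitMap P _ (Equiv.refl Unit),
      LinearMap.lTensor_tmul, fibCoeff_tprod, P.seq.map_refl]
    have hc : ∀ k : Unit, coeffAt N V (Fib (fun _ : S => ()) k) a =
        gMap N V (wholeFib S k) (coeffAt N V S a) := fun k => (coeffAt_map N V _ a).symm
    simp only [hc]
    generalize coeffAt N V S a = y
    have hs : ∀ y, (PiTensorProduct.tprod F fun k : Unit => gMap N V (wholeFib S k) y) =
        (PiTensorProduct.subsingletonEquiv (R := F)
          (s := fun k : Unit => GPre N V (Fib (fun _ : S => ()) k)) ()).symm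
            (gMap N V (wholeFib S ()) y) := fun y =>
      ((LinearEquiv.symm_apply_eq _).2
        (PiTensorProduct.subsingletonEquiv_apply_tprod (R := F) () _).symm).symm
    refine Eq.trans ?_ (congrArg (P.one ⊗ₜ[F] ·) (hs y)).symm
    refine LinearMap.congr_fun (f := gCoef P.seq N V (fun _ : S => ()) ∘ₗ
      gPair (insertLeftHom P.seq N P.one) LinearMap.id S) (g := TensorProduct.mk F _ _ P.one ∘ₗ
        (PiTensorProduct.subsingletonEquiv (R := F)
          (s := fun k : Unit => GPre N V (Fib (fun _ : S => ()) k)) ()).symm.toLinearMap ∘ₗ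
            gMap N V (wholeFib S ())) (tmul_ext fun n v => ?_) y
    rw [LinearMap.comp_apply, gPair_tmul]
    refine Eq.trans ?_ (congrArg (P.one ⊗ₜ[F] ·) (hs _))
    refine (congrArg (fun z => gCoef P.seq N V (fun _ : S => ()) (z ⊗ₜ PiTensorProduct.tprod F v))
      (insertLeft_apply P.seq N P.one S n)).trans ?_
    rw [gCoef_elt P.seq hN]
    refine congrArg (fun t => P.one ⊗ₜ PiTensorProduct.tprod F t) (funext fun k => ?_)
    rw [gMap_tmul]
    rfl
  · have hK' := not_nonempty_iff.1 hK
    have h0 : nestedCoeff P.seq N V f (gammaUnitMap P (Gamma N V) a) = 0 := by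
      rw [nestedCoeff, LinearMap.comp_apply]
      exact (congrArg _ (LinearMap.congr_fun (coeffAt_gammaUnitMap_of_ne P (Gamma N V) hK') a)).trans
        (map_zero _)
    rw [h0]
    by_cases hf : Function.Surjective f
    swap
    · have := hN.subsingleton_dec_gSeq P.seq V hf
      exact Subsingleton.elim _ _
    rw [nestedCoeff_thetaMap P.seq hN, compositeCoef, LinearMap.comp_apply, coeffAt_gammaPair]
    refine LinearMap.congr_fun (f := gCoef P.seq N V f ∘ₗ
      gPair (insertLeftHom P.seq N P.one) LinearMap.id S) (g := 0) (tmul_ext fun n v => ?_) _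
    rw [LinearMap.comp_apply, gPair_tmul]
    rcases isEmpty_or_nonempty S with hS | ⟨⟨s₀⟩⟩
    · have := hN S hS
      rw [Subsingleton.elim n 0, map_zero, TensorProduct.zero_tmul, map_zero,
        TensorProduct.zero_tmul, map_zero]
    · refine (congrArg (fun z => gCoef P.seq N V f (z ⊗ₜ PiTensorProduct.tprod F v))
        (insertLeft_apply P.seq N P.one S n)).trans ?_
      refine gCoef_elt_eq_zero P.seq N V f _ (fun h => hK'.elim ?_) _ _
      refine ⟨fun _ => f s₀, fun _ => (), fun _ => rfl, fun k => ?_⟩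
      obtain ⟨s, rfl⟩ := hf k
      exact (h s₀ s).1 rfl

/-- The identification turns the inclusion `M = M ∘ U → M ∘ P` into the unit of `Γ(P)`, inside
`Γ(M, -)`. -/
theorem thetaMap_insertRight (M : SymSeq F) (P : OperadData F) (hP : P.seq.IsReduced)
    (V : ModuleCat.{u} F) (a : Gamma M V) :
    thetaMap M P.seq V (gammaPair (insertRightHom M P.seq P.one) LinearMap.id a) =
      gammaPair (Hom.id M) (gammaUnitMap P V) a := by
  refine nested_ext M P.seq V fun {S K} _ _ f => ?_
  by_cases hf : Function.Surjective f
  swap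
  · have := hP.subsingleton_dec_gSeq M V hf
    exact Subsingleton.elim _ _
  by_cases hi : Function.Injective f
  · have hk : ∀ s, f ((Equiv.refl S) s) = Equiv.ofBijective f ⟨hi, hf⟩ ((id : S → S) s) := fun _ => rfl
    rw [← decMap_nestedCoeff M P.seq V _ _ hk, ← decMap_nestedCoeff M P.seq V _ _ hk]
    congr 1
    rw [nestedCoeff_thetaMap M hP, compositeCoef, LinearMap.comp_apply, coeffAt_gammaPair,
      nestedCoeff, LinearMap.comp_apply, coeffAt_gammaPair]
    refine LinearMap.congr_fun (f := gCoef M P.seq V (id : S → S) ∘ₗ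
      gPair (insertRightHom M P.seq P.one) LinearMap.id S) (g :=
        (fibCoeff P.seq V (id : S → S)).lTensor (M.obj S) ∘ₗ
          gPair (Hom.id M) (gammaUnitMap P V) S) (tmul_ext fun m v => ?_) _
    rw [LinearMap.comp_apply, LinearMap.comp_apply, gPair_tmul, gPair_tmul, LinearMap.lTensor_tmul,
      fibCoeff_tprod]
    refine (congrArg (fun z => gCoef M P.seq V (id : S → S) (z ⊗ₜ PiTensorProduct.tprod F v))
      (insertRight_apply M P.seq P.one S m)).trans ?_
    rw [gCoef_elt M hP]
    refine congrArg (fun t => m ⊗ₜ PiTensorProduct.tprod F t) (funext fun s => ?_)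
    rw [coeffAt_gammaUnitMap P V (fibIdEquiv s)]
    refine congrArg (fun t => P.seq.map (fibIdEquiv s) P.one ⊗ₜ PiTensorProduct.tprod F t)
      (funext fun t => ?_)
    exact congrArg v t.2
  · obtain ⟨s, t, hst, hne⟩ : ∃ s t, f s = f t ∧ s ≠ t := by
      simpa [Function.Injective] using hi
    rw [nestedCoeff_thetaMap M hP, compositeCoef, LinearMap.comp_apply, coeffAt_gammaPair,
      nestedCoeff, LinearMap.comp_apply, coeffAt_gammaPair]
    have h0 : fibCoeff P.seq V f ∘ₗ PiTensorProduct.map (fun _ => gammaUnitMap P V) = 0 := by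
      rw [fibCoeff, ← PiTensorProduct.map_comp]
      refine map_eq_zero_of_factor (f s) (coeffAt_gammaUnitMap_of_ne P V ⟨fun e => hne ?_⟩)
      have := e.symm.injective (Subsingleton.elim (e.symm ⟨s, rfl⟩) (e.symm ⟨t, hst.symm⟩))
      exact congrArg Subtype.val this
    have h1 : (fibCoeff P.seq V f).lTensor (M.obj K) ∘ₗ gPair (Hom.id M) (gammaUnitMap P V) K = 0 :=
      tmul_ext fun m v => by
        rw [LinearMap.comp_apply, gPair, TensorProduct.map_tmul, LinearMap.lTensor_tmul]
        have := LinearMap.congr_fun h0 (PiTensorProduct.tprod F v)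
        rw [LinearMap.comp_apply] at this
        rw [this, LinearMap.zero_apply, TensorProduct.tmul_zero, LinearMap.zero_apply]
    refine Eq.trans ?_ (LinearMap.congr_fun h1 _).symm
    refine LinearMap.congr_fun (f := gCoef M P.seq V f ∘ₗ
      gPair (insertRightHom M P.seq P.one) LinearMap.id S) (g := 0) (tmul_ext fun m v => ?_) _
    rw [LinearMap.comp_apply, gPair_tmul]
    refine (congrArg (fun z => gCoef M P.seq V f (z ⊗ₜ PiTensorProduct.tprod F v))
      (insertRight_apply M P.seq P.one S m)).trans ?_
    exact gCoef_elt_eq_zero M P.seq V f _ (fun h => hne ((h s t).2 hst)) _ _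

/-! ### Recovering a symmetric sequence from its divided power functor -/

/-- The space `F^n`. -/
abbrev stdSpace (F : Type u) [Field F] (n : ℕ) : ModuleCat.{u} F := ModuleCat.of F (Fin n → F)

/-- The standard basis of `F^n`. -/
def stdVec (F : Type u) [Field F] (n : ℕ) (i : Fin n) : stdSpace F n :=
  (Pi.single i (1 : F) : Fin n → F)

/-- The element `∑_σ σ (m ⊗ e₁ ⊗ ⋯ ⊗ e_n)` of `Γ(M, F^n)`. -/
def multilinearPart (M : SymSeq F) (n : ℕ) (m : M.obj (Fin n)) : Gamma M (stdSpace F n) :=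
  gammaOf M (stdSpace F n) n ⟨∑ σ : Equiv.Perm (Fin n), gRep M (stdSpace F n) (Fin n) σ
    (m ⊗ₜ PiTensorProduct.tprod F (stdVec F n)), fun τ => by
      rw [map_sum]
      refine (Finset.sum_congr rfl fun σ _ => ?_).trans (Equiv.sum_comp (Equiv.mulLeft τ) fun σ =>
        gRep M (stdSpace F n) (Fin n) σ (m ⊗ₜ PiTensorProduct.tprod F (stdVec F n)))
      rw [Equiv.coe_mulLeft, map_mul]
      rfl⟩

/-- The coefficient of `e₁ ⊗ ⋯ ⊗ e_n` in the tensor power of `F^n`. -/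
def diagCoeff (F : Type u) [Field F] (n : ℕ) :
    (PiTensorProduct F fun _ : Fin n => (stdSpace F n : Type u)) →ₗ[F] F :=
  PiTensorProduct.lift ((MultilinearMap.mkPiAlgebra F (Fin n) F).compLinearMap
    fun i => (LinearMap.proj i : (Fin n → F) →ₗ[F] F))

theorem diagCoeff_tprod (n : ℕ) (v : Fin n → stdSpace F n) :
    diagCoeff F n (PiTensorProduct.tprod F v) = ∏ i, (v i : Fin n → F) i := by
  rw [diagCoeff, PiTensorProduct.lift.tprod]
  rfl

/-- The coefficient of `e₁ ⊗ ⋯ ⊗ e_n` in the component of arity `n` of an element of `Γ(M, F^n)`. -/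
def multilinearCoeff (M : SymSeq F) (n : ℕ) : Gamma M (stdSpace F n) →ₗ[F] M.obj (Fin n) :=
  (TensorProduct.rid F (M.obj (Fin n))).toLinearMap ∘ₗ (diagCoeff F n).lTensor (M.obj (Fin n)) ∘ₗ
    gammaCoeff M (stdSpace F n) n

theorem multilinearCoeff_multilinearPart (M : SymSeq F) (n : ℕ) (m : M.obj (Fin n)) :
    multilinearCoeff M n (multilinearPart M n m) = m := by
  have h : ∀ σ : Equiv.Perm (Fin n), TensorProduct.rid F (M.obj (Fin n))
      ((diagCoeff F n).lTensor (M.obj (Fin n)) (gRep M (stdSpace F n) (Fin n) σ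
        (m ⊗ₜ PiTensorProduct.tprod F (stdVec F n)))) =
      (∏ i, (Pi.single (σ.symm i) (1 : F) : Fin n → F) i) • M.map σ m := fun σ => by
    change TensorProduct.rid F (M.obj (Fin n)) ((diagCoeff F n).lTensor (M.obj (Fin n))
      (gMap M (stdSpace F n) σ (m ⊗ₜ PiTensorProduct.tprod F (stdVec F n)))) = _
    rw [gMap_tmul, LinearMap.lTensor_tmul, diagCoeff_tprod, TensorProduct.rid_tmul]
    rfl
  rw [multilinearCoeff, LinearMap.comp_apply, LinearMap.comp_apply, multilinearPart,
    gammaCoeff_gammaOf]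
  rw [map_sum, map_sum, LinearEquiv.coe_coe]
  simp only [h]
  rw [Finset.sum_eq_single (Equiv.refl _)]
  · rw [M.map_refl, Finset.prod_eq_one, one_smul]
    intro i _
    rw [Equiv.refl_symm, Equiv.refl_apply, Pi.single_eq_same]
  · intro σ _ hσ
    obtain ⟨i, hi⟩ : ∃ i, σ.symm i ≠ i := by
      by_contra! hc
      exact hσ (Equiv.ext fun i => (σ.symm_apply_eq.1 (hc i)).symm)
    rw [Finset.prod_eq_zero (Finset.mem_univ i) (Pi.single_eq_of_ne hi.symm _), zero_smul]
  · exact fun h => absurd (Finset.mem_univ _) h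

theorem gammaPair_multilinearPart {M N : SymSeq F} (φ : Hom M N) (n : ℕ) (m : M.obj (Fin n)) :
    gammaPair φ LinearMap.id (multilinearPart M n m) = multilinearPart N n (φ.app (Fin n) m) := by
  refine gamma_ext N _ fun k => ?_
  rw [gammaCoeff_gammaPair]
  by_cases hk : n = k
  · subst hk
    rw [multilinearPart, multilinearPart, gammaCoeff_gammaOf, gammaCoeff_gammaOf, map_sum]
    refine Finset.sum_congr rfl fun σ _ => ?_
    refine (gPair_gMap φ _ σ _).trans (congrArg _ ?_)
    rw [gPair_tmul]
    rfl
  · rw [multilinearPart, multilinearPart, gammaCoeff_gammaOf_of_ne _ _ hk,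
      gammaCoeff_gammaOf_of_ne _ _ hk, map_zero]

theorem multilinearCoeff_gammaPair {M N : SymSeq F} (φ : Hom M N) (n : ℕ)
    (x : Gamma M (stdSpace F n)) : multilinearCoeff N n (gammaPair φ LinearMap.id x) =
      φ.app (Fin n) (multilinearCoeff M n x) := by
  simp only [multilinearCoeff, LinearMap.comp_apply, gammaCoeff_gammaPair]
  generalize gammaCoeff M (stdSpace F n) n x = y
  refine LinearMap.congr_fun (f := (TensorProduct.rid F (N.obj (Fin n))).toLinearMap ∘ₗ
    (diagCoeff F n).lTensor (N.obj (Fin n)) ∘ₗ gPair φ LinearMap.id (Fin n))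
    (g := φ.app (Fin n) ∘ₗ (TensorProduct.rid F (M.obj (Fin n))).toLinearMap ∘ₗ
      (diagCoeff F n).lTensor (M.obj (Fin n))) (tmul_ext fun m v => ?_) y
  simp only [LinearMap.comp_apply]
  rw [gPair_tmul, LinearMap.lTensor_tmul, LinearMap.lTensor_tmul]
  simp [TensorProduct.rid_tmul]

theorem app_eq_conj {M N : SymSeq F} (φ : Hom M N) {S T : Type} [Finite S] [Finite T] (e : S ≃ T)
    (x : M.obj S) : φ.app S x = N.map e.symm (φ.app T (M.map e x)) := by
  rw [← φ.naturality, ← M.map_trans, Equiv.self_trans_symm, M.map_refl]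

/-- A morphism of symmetric sequences is determined by the transformation of divided power functors
it induces. -/
theorem hom_ext_gammaPair {M N : SymSeq F} {φ ψ : Hom M N}
    (h : ∀ (V : ModuleCat.{u} F) (x : Gamma M V),
      gammaPair φ (LinearMap.id : V →ₗ[F] V) x = gammaPair ψ LinearMap.id x) : φ = ψ := by
  refine Hom.ext_apply fun S _ x => ?_
  obtain ⟨n, ⟨e⟩⟩ := Finite.exists_equiv_fin S
  rw [app_eq_conj φ e, app_eq_conj ψ e]
  congr 1
  have h1 := congrArg (multilinearCoeff N n) (h _ (multilinearPart M n (M.map e x)))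
  rwa [gammaPair_multilinearPart, gammaPair_multilinearPart, multilinearCoeff_multilinearPart,
    multilinearCoeff_multilinearPart] at h1

/-- A morphism of symmetric sequences is invertible as soon as it is so on divided power functors. -/
theorem isIsoHom_of_gammaPair {M N : SymSeq F} {φ : Hom M N}
    (h : ∀ V : ModuleCat.{u} F, Function.Bijective (gammaPair φ (LinearMap.id : V →ₗ[F] V))) :
    IsIsoHom φ := fun S _ => by
  obtain ⟨n, ⟨e⟩⟩ := Finite.exists_equiv_fin S
  have hb : ∀ (L : SymSeq F) {S T : Type} [Finite S] [Finite T] (d : S ≃ T),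
      Function.Bijective (L.map d) := fun L S T _ _ d =>
    Function.bijective_iff_has_inverse.2 ⟨L.map d.symm, fun x => by
      rw [← L.map_trans, Equiv.self_trans_symm, L.map_refl], fun x => by
      rw [← L.map_trans, Equiv.symm_trans_self, L.map_refl]⟩
  have hf : (φ.app S : M.obj S → N.obj S) = N.map e.symm ∘ φ.app (Fin n) ∘ M.map e :=
    funext fun x => app_eq_conj φ e x
  rw [hf]
  refine (hb N e.symm).comp (Function.Bijective.comp ⟨fun x y hxy => ?_, fun y => ?_⟩ (hb M e))
  · have h1 := congrArg (multilinearPart N n) hxy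
    rw [← gammaPair_multilinearPart, ← gammaPair_multilinearPart] at h1
    have h2 := congrArg (multilinearCoeff M n) ((h _).1 h1)
    rwa [multilinearCoeff_multilinearPart, multilinearCoeff_multilinearPart] at h2
  · obtain ⟨x, hx⟩ := (h _).2 (multilinearPart N n y)
    refine ⟨multilinearCoeff M n x, ?_⟩
    rw [← multilinearCoeff_gammaPair, hx, multilinearCoeff_multilinearPart]

/-- The associators of `∘` are isomorphisms on reduced symmetric sequences. -/
theorem isIsoHom_assoc (M : SymSeq F) {N L : SymSeq F} (hN : N.IsReduced) (hL : L.IsReduced) :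
    IsIsoHom (assoc M N L) := by
  refine isIsoHom_of_gammaPair fun V => ?_
  have hNL := IsReduced.comp hN hL
  have hb : Function.Bijective (gammaPair (Hom.id M) (thetaMap N L V)) := by
    let e := LinearEquiv.ofBijective _ (bijective_thetaMap N hL V)
    have h1 : e.symm.toLinearMap ∘ₗ thetaMap N L V = LinearMap.id :=
      LinearMap.ext e.symm_apply_apply
    have h2 : thetaMap N L V ∘ₗ e.symm.toLinearMap = LinearMap.id :=
      LinearMap.ext e.apply_symm_apply
    refine Function.bijective_iff_has_inverse.2
      ⟨gammaPair (Hom.id M) e.symm.toLinearMap, fun x => ?_, fun x => ?_⟩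
    · have h3 := gammaPair_comp (Hom.id M) (Hom.id M) (thetaMap N L V) e.symm.toLinearMap
      rw [h1] at h3
      exact (LinearMap.congr_fun h3 x).symm.trans (LinearMap.congr_fun (gammaPair_id M _) x)
    · have h3 := gammaPair_comp (Hom.id M) (Hom.id M) e.symm.toLinearMap (thetaMap N L V)
      rw [h2] at h3
      exact (LinearMap.congr_fun h3 x).symm.trans (LinearMap.congr_fun (gammaPair_id M _) x)
  have h3 := (bijective_thetaMap M hN (Gamma L V)).comp (bijective_thetaMap (comp M N) hL V)
  have h4 : (thetaMap M N (Gamma L V) ∘ thetaMap (comp M N) L V : _ → _) =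
      (gammaPair (Hom.id M) (thetaMap N L V) ∘ thetaMap M (comp N L) V) ∘
        gammaPair (assoc M N L) LinearMap.id :=
    funext fun x => thetaMap_assoc M N L hN hL hNL V x
  rw [h4] at h3
  exact (Function.Bijective.of_comp_iff' (hb.comp (bijective_thetaMap M hNL V)) _).1 h3

/-! ### The divided power functors as a monoidal functor to endofunctors -/

theorem gammaNat_comp {M N L : SymSeq F} (ψ : Hom N L) (φ : Hom M N) (V : ModuleCat.{u} F) :
    gammaNat (ψ.comp φ) V = gammaNat φ V ≫ gammaNat ψ V :=
  congrArg ModuleCat.ofHom (gammaPair_comp φ ψ LinearMap.id LinearMap.id)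

theorem gammaNat_id (M : SymSeq F) (V : ModuleCat.{u} F) :
    gammaNat (Hom.id M) V = 𝟙 ((gammaFunctor M).obj V) :=
  congrArg ModuleCat.ofHom (gammaPair_id M V)

theorem gammaNat_naturality {M N : SymSeq F} (φ : Hom M N) {V W : ModuleCat.{u} F} (v : V ⟶ W) :
    (gammaFunctor M).map v ≫ gammaNat φ W = gammaNat φ V ≫ (gammaFunctor N).map v :=
  congrArg ModuleCat.ofHom ((gammaPair_comp (Hom.id M) φ v.hom LinearMap.id).symm.trans
    (gammaPair_comp φ (Hom.id N) LinearMap.id v.hom))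

theorem hom_ext_gammaNat {M N : SymSeq F} {φ ψ : Hom M N} (h : gammaNat φ = gammaNat ψ) : φ = ψ :=
  hom_ext_gammaPair fun V x =>
    LinearMap.congr_fun (congrArg ModuleCat.Hom.hom (congrFun h V)) x

/-- The map `Γ(M ∘ N, V) → Γ(M, Γ(N, V))` given by the trace map and the inverse associator. -/
def theta (M N : SymSeq F) (V : ModuleCat.{u} F) :
    (gammaFunctor (comp M N)).obj V ⟶ (gammaFunctor M).obj ((gammaFunctor N).obj V) :=
  gammaNat (trace M N) V ≫ dassocInv M N V

theorem isIso_theta (M : SymSeq F) {N : SymSeq F} (hN : N.IsReduced) (V : ModuleCat.{u} F) :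
    IsIso (theta M N V) :=
  (ConcreteCategory.isIso_iff_bijective (theta M N V)).2 (bijective_thetaMap M hN V)

theorem theta_gammaNat {M M' N N' : SymSeq F} (hN : N.IsReduced) (hN' : N'.IsReduced)
    (φ : Hom M M') (ψ : Hom N N') (V : ModuleCat.{u} F) :
    gammaNat (compMap φ ψ) V ≫ theta M' N' V =
      theta M N V ≫ (gammaFunctor M).map (gammaNat ψ V) ≫ gammaNat φ ((gammaFunctor N').obj V) := by
  rw [gammaNat_naturality]
  have h := fun a => thetaMap_gammaPair hN hN' φ ψ (LinearMap.id : V →ₗ[F] V) a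
  have h2 : gammaPair φ (gammaPair ψ (LinearMap.id : V →ₗ[F] V)) =
      gammaPair (Hom.id M') (gammaPair ψ LinearMap.id) ∘ₗ gammaPair φ LinearMap.id :=
    gammaPair_comp φ (Hom.id M') LinearMap.id (gammaPair ψ LinearMap.id)
  rw [h2] at h
  exact congrArg ModuleCat.ofHom (LinearMap.ext h)

theorem compMap_id (M N : SymSeq F) : compMap (Hom.id M) (Hom.id N) = Hom.id (comp M N) :=
  Hom.ext_apply fun S _ x => by
    refine LinearMap.congr_fun (f := (compMap (Hom.id M) (Hom.id N)).app S) (g := LinearMap.id)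
      (comp_ext_elt fun k f m n => ?_) x
    rw [compMap_elt, decPair_tmul]
    rfl

theorem theta_naturality (M : SymSeq F) {N : SymSeq F} (hN : N.IsReduced) {V W : ModuleCat.{u} F}
    (v : V ⟶ W) : (gammaFunctor (comp M N)).map v ≫ theta M N W =
      theta M N V ≫ (gammaFunctor M).map ((gammaFunctor N).map v) := by
  have h := fun a => thetaMap_gammaPair hN hN (Hom.id M) (Hom.id N) v.hom a
  rw [compMap_id] at h
  exact congrArg ModuleCat.ofHom (LinearMap.ext h)

theorem theta_gammaNat_left {M M' N : SymSeq F} (hN : N.IsReduced) (φ : Hom M M')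
    (V : ModuleCat.{u} F) : gammaNat (compMap φ (Hom.id N)) V ≫ theta M' N V =
      theta M N V ≫ gammaNat φ ((gammaFunctor N).obj V) := by
  rw [theta_gammaNat hN hN, gammaNat_id, CategoryTheory.Functor.map_id, Category.id_comp]

theorem theta_gammaNat_right (M : SymSeq F) {N N' : SymSeq F} (hN : N.IsReduced)
    (hN' : N'.IsReduced) (ψ : Hom N N') (V : ModuleCat.{u} F) :
    gammaNat (compMap (Hom.id M) ψ) V ≫ theta M N' V =
      theta M N V ≫ (gammaFunctor M).map (gammaNat ψ V) := by
  rw [theta_gammaNat hN hN', gammaNat_id, Category.comp_id]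

/-- The two ways to expand `Γ((M ∘ N) ∘ L, V)` agree up to the associator of `∘`. -/
theorem theta_assoc (M : SymSeq F) {N L : SymSeq F} (hN : N.IsReduced) (hL : L.IsReduced)
    (V : ModuleCat.{u} F) :
    theta (comp M N) L V ≫ theta M N ((gammaFunctor L).obj V) =
      gammaNat (assoc M N L) V ≫ theta M (comp N L) V ≫ (gammaFunctor M).map (theta N L V) :=
  congrArg ModuleCat.ofHom (LinearMap.ext (thetaMap_assoc M N L hN hL (hN.comp hL) V))

theorem theta_assocInv (M : SymSeq F) {N L : SymSeq F} (hN : N.IsReduced) (hL : L.IsReduced)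
    (V : ModuleCat.{u} F) :
    theta M (comp N L) V ≫ (gammaFunctor M).map (theta N L V) = gammaNat (assocInv M N L) V ≫
      theta (comp M N) L V ≫ theta M N ((gammaFunctor L).obj V) := by
  rw [theta_assoc M hN hL, ← Category.assoc, ← gammaNat_comp, assocInv,
    comp_homInv (isIsoHom_assoc M hN hL), gammaNat_id, Category.id_comp]

theorem insertLeft_theta (P : OperadData F) {N : SymSeq F} (hN : N.IsReduced)
    (V : ModuleCat.{u} F) : gammaNat (insertLeftHom P.seq N P.one) V ≫ theta P.seq N V =
      gammaUnit P ((gammaFunctor N).obj V) :=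
  congrArg ModuleCat.ofHom (LinearMap.ext (thetaMap_insertLeft P hN V))

theorem insertRight_theta (M : SymSeq F) (P : OperadData F) (hP : P.seq.IsReduced)
    (V : ModuleCat.{u} F) : gammaNat (insertRightHom M P.seq P.one) V ≫ theta M P.seq V =
      (gammaFunctor M).map (gammaUnit P V) :=
  congrArg ModuleCat.ofHom (LinearMap.ext (thetaMap_insertRight M P hP V))

/-- The units of the functors `Γ(P)` are natural in `V`, and in `P`. -/
theorem gammaUnit_gammaPair {P R : OperadData F} (φ : Hom P.seq R.seq)
    (hφ : φ.app Unit P.one = R.one) {V W : ModuleCat.{u} F} (v : V →ₗ[F] W) (x : V) :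
    gammaPair φ v (gammaUnitMap P V x) = gammaUnitMap R W (v x) := by
  refine gamma_ext R.seq W fun n => ?_
  rw [← coeffAt_fin, ← coeffAt_fin, coeffAt_gammaPair]
  by_cases h : Nonempty (Unit ≃ Fin n)
  · obtain ⟨e⟩ := h
    rw [coeffAt_gammaUnitMap P V e, coeffAt_gammaUnitMap R W e, gPair_tmul, φ.naturality, hφ]
  · have h' := not_nonempty_iff.1 h
    have h1 := LinearMap.congr_fun (coeffAt_gammaUnitMap_of_ne P V h') x
    have h2 := LinearMap.congr_fun (coeffAt_gammaUnitMap_of_ne R W h') (v x)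
    rw [LinearMap.comp_apply] at h1 h2
    rw [h1, h2]
    exact map_zero _

theorem gammaUnit_naturality (P : OperadData F) {V W : ModuleCat.{u} F} (v : V ⟶ W) :
    v ≫ gammaUnit P W = gammaUnit P V ≫ (gammaFunctor P.seq).map v :=
  congrArg ModuleCat.ofHom (LinearMap.ext fun x =>
    (gammaUnit_gammaPair (P := P) (R := P) (Hom.id P.seq) rfl v.hom x).symm)

theorem gammaUnit_gammaNat {P R : OperadData F} (φ : Hom P.seq R.seq)
    (hφ : φ.app Unit P.one = R.one) (V : ModuleCat.{u} F) :
    gammaUnit P V ≫ gammaNat φ V = gammaUnit R V :=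
  congrArg ModuleCat.ofHom (LinearMap.ext fun x => gammaUnit_gammaPair φ hφ LinearMap.id x)

theorem theta_dassoc (M : SymSeq F) {N : SymSeq F} (hN : N.IsReduced) (V : ModuleCat.{u} F) :
    theta M N V ≫ dassoc M N V = gammaNat (trace M N) V := by
  have h : dassocInv M N V ≫ dassoc M N V = 𝟙 _ :=
    congrArg ModuleCat.ofHom (LinearMap.ext (dassocMap_dassocInvMap M hN V))
  rw [theta, Category.assoc, h, Category.comp_id]

/-- Under the identification `Γ(P ∘ P) ≅ Γ(P) Γ(P)`, the multiplication of `Γ(P)` is that of `P`. -/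
theorem theta_gammaMul (P : OperadData F) (hP : P.seq.IsReduced) (V : ModuleCat.{u} F) :
    theta P.seq P.seq V ≫ gammaMul P V = gammaNat P.mul V := by
  rw [gammaMul, ← Category.assoc, theta_dassoc _ hP, ← Category.assoc, ← gammaNat_comp, traceInv,
    homInv_comp (isIsoHom_trace P.seq hP), gammaNat_id, Category.id_comp]

theorem dcompMap_trace {M M' N N' : SymSeq F} (φ : Hom M M') (ψ : Hom N N') :
    (dcompMap φ ψ).comp (trace M N) = (trace M' N').comp (compMap φ ψ) := by
  refine Hom.ext_apply fun S _ x => ?_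
  refine LinearMap.congr_fun (f := DirectSum.lmap _ ∘ₗ DirectSum.lmap _)
    (g := DirectSum.lmap _ ∘ₗ DirectSum.lmap _) ?_ x
  rw [← DirectSum.lmap_comp, ← DirectSum.lmap_comp]
  congr 1; funext k
  refine Representation.Coinvariants.hom_ext (LinearMap.ext fun y => Subtype.ext ?_)
  change prePair φ ψ S (Fin k) (preNorm M N S (Fin k) (Representation.Coinvariants.mk _ y)) =
    (preNorm M' N' S (Fin k) (Representation.Coinvariants.mk _ (prePair φ ψ S (Fin k) y)) :
      Pre M' N' S (Fin k))
  rw [coe_preNorm_mk, coe_preNorm_mk, map_sum]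
  exact Finset.sum_congr rfl fun σ _ => prePair_preMap φ ψ _ _ y

theorem dassoc_dcompMap {M M' N N' : SymSeq F} (hN : N.IsReduced) (hN' : N'.IsReduced)
    (φ : Hom M M') (ψ : Hom N N') (V : ModuleCat.{u} F) :
    dassoc M N V ≫ gammaNat (dcompMap φ ψ) V = (gammaFunctor M).map (gammaNat ψ V) ≫
      gammaNat φ ((gammaFunctor N').obj V) ≫ dassoc M' N' V := by
  have := isIso_theta M hN V
  rw [← cancel_epi (theta M N V), ← Category.assoc, theta_dassoc M hN, ← gammaNat_comp,
    dcompMap_trace, gammaNat_comp, ← theta_dassoc M' hN', ← Category.assoc, theta_gammaNat hN hN']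
  simp only [Category.assoc]

theorem IsReduced.of_isIsoHom {M N : SymSeq F} (hM : M.IsReduced) {φ : Hom M N} (h : IsIsoHom φ) :
    N.IsReduced := fun S _ hS => by
  have := hM S hS
  exact (h S).2.subsingleton

end SymSeq

open SymSeq

variable {F : Type u} [Field F]

/-! ### Operads and monads -/

theorem theta_theta_map_gammaMul (P : OperadData F) (hP : P.seq.IsReduced) (V : ModuleCat.{u} F) :
    (theta (comp P.seq P.seq) P.seq V ≫ theta P.seq P.seq ((gammaFunctor P.seq).obj V)) ≫
      (gammaFunctor P.seq).map (gammaMul P V) ≫ gammaMul P V =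
        gammaNat ((P.mul.comp (compMap (Hom.id P.seq) P.mul)).comp (assoc P.seq P.seq P.seq)) V := by
  rw [theta_assoc P.seq hP hP, Category.assoc, Category.assoc, ← Functor.map_comp_assoc,
    theta_gammaMul P hP]
  have h := theta_gammaNat_right P.seq (hP.comp hP) hP P.mul V
  rw [← reassoc_of% h, theta_gammaMul P hP, gammaNat_comp, gammaNat_comp]

theorem theta_theta_gammaMul (P : OperadData F) (hP : P.seq.IsReduced) (V : ModuleCat.{u} F) :
    (theta (comp P.seq P.seq) P.seq V ≫ theta P.seq P.seq ((gammaFunctor P.seq).obj V)) ≫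
      gammaMul P ((gammaFunctor P.seq).obj V) ≫ gammaMul P V =
        gammaNat (P.mul.comp (compMap P.mul (Hom.id P.seq))) V := by
  rw [Category.assoc, reassoc_of% theta_gammaMul P hP ((gammaFunctor P.seq).obj V)]
  have h := theta_gammaNat_left hP P.mul V
  rw [← reassoc_of% h, theta_gammaMul P hP, gammaNat_comp]

theorem gammaUnit_gammaMul (P : OperadData F) (hP : P.seq.IsReduced) (V : ModuleCat.{u} F) :
    gammaUnit P ((gammaFunctor P.seq).obj V) ≫ gammaMul P V =
    gammaNat (P.mul.comp (insertLeftHom P.seq P.seq P.one)) V := by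
  rw [← insertLeft_theta P hP, Category.assoc, theta_gammaMul P hP, gammaNat_comp]

theorem map_gammaUnit_gammaMul (P : OperadData F) (hP : P.seq.IsReduced) (V : ModuleCat.{u} F) :
    (gammaFunctor P.seq).map (gammaUnit P V) ≫ gammaMul P V =
    gammaNat (P.mul.comp (insertRightHom P.seq P.seq P.one)) V := by
  rw [← insertRight_theta P.seq P hP, Category.assoc, theta_gammaMul P hP, gammaNat_comp]

theorem gammaMul_naturality (P : OperadData F) (hP : P.seq.IsReduced) {V W : ModuleCat.{u} F} (v : V ⟶ W) :
    (gammaFunctor P.seq).map ((gammaFunctor P.seq).map v) ≫ gammaMul P W =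
      gammaMul P V ≫ (gammaFunctor P.seq).map v := by
  have := isIso_theta P.seq hP V
  rw [← cancel_epi (theta P.seq P.seq V), ← reassoc_of% theta_naturality P.seq hP v,
    theta_gammaMul P hP, reassoc_of% theta_gammaMul P hP V, gammaNat_naturality]

/-- A reduced symmetric sequence with a unit and a multiplication is an operad if and only if the
associated endofunctor is a monad. -/
theorem isOperad_iff_isMonad (P : OperadData F) (hP : P.seq.IsReduced) :
    P.IsOperad ↔ (gammaData P).IsMonad := by
  have hi := fun V : ModuleCat.{u} F => isIso_theta P.seq hP V
  have hi' := fun V : ModuleCat.{u} F => isIso_theta (comp P.seq P.seq) hP V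
  constructor
  · intro h
    have h1 : P.mul.comp (insertLeftHom P.seq P.seq P.one) = Hom.id P.seq :=
      Hom.ext_apply fun S _ x => h.one_mul S x
    have h2 : P.mul.comp (insertRightHom P.seq P.seq P.one) = Hom.id P.seq :=
      Hom.ext_apply fun S _ x => h.mul_one S x
    refine ⟨fun f => gammaUnit_naturality P f, fun f => gammaMul_naturality P hP f, fun V => ?_,
      fun V => ?_, fun V => ?_⟩
    · change (gammaFunctor P.seq).map (gammaMul P V) ≫ gammaMul P V =
        gammaMul P ((gammaFunctor P.seq).obj V) ≫ gammaMul P V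
      rw [← cancel_epi (theta (comp P.seq P.seq) P.seq V ≫
        theta P.seq P.seq ((gammaFunctor P.seq).obj V)), theta_theta_map_gammaMul P hP,
        theta_theta_gammaMul P hP, h.mul_assoc]
    · exact (gammaUnit_gammaMul P hP V).trans (by rw [h1, gammaNat_id]; rfl)
    · exact (map_gammaUnit_gammaMul P hP V).trans (by rw [h2, gammaNat_id]; rfl)
  · intro h
    have h1 : P.mul.comp (insertLeftHom P.seq P.seq P.one) = Hom.id P.seq :=
      hom_ext_gammaNat (funext fun V => by
        rw [← gammaUnit_gammaMul P hP, gammaNat_id]; exact h.left_unit V)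
    have h2 : P.mul.comp (insertRightHom P.seq P.seq P.one) = Hom.id P.seq :=
      hom_ext_gammaNat (funext fun V => by
        rw [← map_gammaUnit_gammaMul P hP, gammaNat_id]; exact h.right_unit V)
    refine ⟨fun S _ x => congrArg (fun φ : Hom P.seq P.seq => φ.app S x) h1,
      fun S _ x => congrArg (fun φ : Hom P.seq P.seq => φ.app S x) h2, ?_⟩
    refine hom_ext_gammaNat (funext fun V => ?_)
    rw [← theta_theta_gammaMul P hP, ← theta_theta_map_gammaMul P hP]
    exact congrArg (_ ≫ ·) (h.assoc V).symm

/-! ### The distributive law of monads -/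

open scoped Classical in
/-- The map `Γ(Q, Γ(P, V)) ≅ Γ(Q ∘ P, V) → Γ(P ∘ Q, V) ≅ Γ(P, Γ(Q, V))` induced by `Λ`. The first
map is invertible for `P` reduced; the value zero is assigned when it is not. -/
def lawMap (P Q : OperadData F) (Λ : Hom (comp Q.seq P.seq) (comp P.seq Q.seq))
    (V : ModuleCat.{u} F) : (gammaFunctor Q.seq).obj ((gammaFunctor P.seq).obj V) ⟶
    (gammaFunctor P.seq).obj ((gammaFunctor Q.seq).obj V) :=
  (if _h : IsIso (theta Q.seq P.seq V) then inv (theta Q.seq P.seq V) else 0) ≫ gammaNat Λ V ≫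
    theta P.seq Q.seq V

theorem theta_lawMap (P Q : OperadData F) (hP : P.seq.IsReduced)
    (Λ : Hom (comp Q.seq P.seq) (comp P.seq Q.seq)) (V : ModuleCat.{u} F) :
    theta Q.seq P.seq V ≫ lawMap P Q Λ V =
    gammaNat Λ V ≫ theta P.seq Q.seq V := by
  have := isIso_theta Q.seq hP V
  rw [lawMap, dif_pos this, IsIso.hom_inv_id_assoc]

theorem lawMap_naturality (P Q : OperadData F) (hP : P.seq.IsReduced)
    (hQ : Q.seq.IsReduced) (Λ : Hom (comp Q.seq P.seq) (comp P.seq Q.seq)) {V W : ModuleCat.{u} F} (v : V ⟶ W) :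
    (gammaFunctor Q.seq).map ((gammaFunctor P.seq).map v) ≫ lawMap P Q Λ W =
      lawMap P Q Λ V ≫ (gammaFunctor P.seq).map ((gammaFunctor Q.seq).map v) := by
  have := isIso_theta Q.seq hP V
  rw [← cancel_epi (theta Q.seq P.seq V), ← reassoc_of% theta_naturality Q.seq hP v,
    theta_lawMap P Q hP, reassoc_of% theta_lawMap P Q hP Λ V, ← theta_naturality P.seq hQ v,
    reassoc_of% gammaNat_naturality Λ v]

theorem map_gammaMul_lawMap (P Q : OperadData F) (hP : P.seq.IsReduced)
    (hQ : Q.seq.IsReduced) {Λ : Hom (comp Q.seq P.seq) (comp P.seq Q.seq)}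
    (hΛ : IsOperadicDistributiveLaw P Q Λ) (V : ModuleCat.{u} F) :
    (gammaFunctor Q.seq).map (gammaMul P V) ≫ lawMap P Q Λ V =
    lawMap P Q Λ ((gammaFunctor P.seq).obj V) ≫ (gammaFunctor P.seq).map (lawMap P Q Λ V) ≫
      gammaMul P ((gammaFunctor Q.seq).obj V) := by
  have := isIso_theta (comp Q.seq P.seq) hP V
  have := isIso_theta Q.seq hP ((gammaFunctor P.seq).obj V)
  rw [← cancel_epi (theta (comp Q.seq P.seq) P.seq V ≫
    theta Q.seq P.seq ((gammaFunctor P.seq).obj V))]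
  have hl := theta_gammaNat_right Q.seq (hP.comp hP) hP P.mul V
  have h1 := theta_gammaNat_left hP Λ V
  have h2 := theta_gammaNat_right P.seq (hQ.comp hP) (hP.comp hQ) Λ V
  have h3 := theta_gammaNat_left hQ P.mul V
  have hlhs : (theta (comp Q.seq P.seq) P.seq V ≫
      theta Q.seq P.seq ((gammaFunctor P.seq).obj V)) ≫
        (gammaFunctor Q.seq).map (gammaMul P V) ≫ lawMap P Q Λ V =
      gammaNat (Λ.comp ((compMap (Hom.id Q.seq) P.mul).comp (assoc Q.seq P.seq P.seq))) V ≫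
        theta P.seq Q.seq V := by
    rw [theta_assoc Q.seq hP hP, Category.assoc, Category.assoc, ← Functor.map_comp_assoc,
      theta_gammaMul P hP, ← reassoc_of% hl, theta_lawMap P Q hP]
    simp only [gammaNat_comp, Category.assoc]
  rw [hlhs, hΛ.odl₁, Category.assoc, reassoc_of% theta_lawMap P Q hP Λ ((gammaFunctor P.seq).obj V),
    ← reassoc_of% h1, reassoc_of% theta_assoc P.seq hQ hP V, ← Functor.map_comp_assoc,
    theta_lawMap P Q hP, Functor.map_comp_assoc, ← reassoc_of% h2,
    reassoc_of% theta_assocInv P.seq hP hQ V, theta_gammaMul P hP, ← h3]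
  simp only [gammaNat_comp, Category.assoc]

theorem gammaMul_lawMap (P Q : OperadData F) (hP : P.seq.IsReduced)
    (hQ : Q.seq.IsReduced) {Λ : Hom (comp Q.seq P.seq) (comp P.seq Q.seq)}
    (hΛ : IsOperadicDistributiveLaw P Q Λ) (V : ModuleCat.{u} F) :
    gammaMul Q ((gammaFunctor P.seq).obj V) ≫ lawMap P Q Λ V =
    (gammaFunctor Q.seq).map (lawMap P Q Λ V) ≫ lawMap P Q Λ ((gammaFunctor Q.seq).obj V) ≫
      (gammaFunctor P.seq).map (gammaMul Q V) := by
  have := isIso_theta Q.seq (hQ.comp hP) V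
  have := isIso_theta Q.seq hP V
  rw [← cancel_epi (theta Q.seq (comp Q.seq P.seq) V ≫
    (gammaFunctor Q.seq).map (theta Q.seq P.seq V))]
  have hl := theta_gammaNat_left hP Q.mul V
  have h1 := theta_gammaNat_right Q.seq (hQ.comp hP) (hP.comp hQ) Λ V
  have h2 := theta_gammaNat_left hQ Λ V
  have h3 := theta_gammaNat_right P.seq (hQ.comp hQ) hQ Q.mul V
  have hlhs : (theta Q.seq (comp Q.seq P.seq) V ≫
      (gammaFunctor Q.seq).map (theta Q.seq P.seq V)) ≫
        gammaMul Q ((gammaFunctor P.seq).obj V) ≫ lawMap P Q Λ V =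
      gammaNat ((Λ.comp (compMap Q.mul (Hom.id P.seq))).comp (assocInv Q.seq Q.seq P.seq)) V ≫
        theta P.seq Q.seq V := by
    rw [theta_assocInv Q.seq hQ hP, Category.assoc, Category.assoc,
      reassoc_of% theta_gammaMul Q hQ ((gammaFunctor P.seq).obj V), ← reassoc_of% hl,
      theta_lawMap P Q hP]
    simp only [gammaNat_comp, Category.assoc]
  rw [hlhs, hΛ.odl₃, Category.assoc, ← Functor.map_comp_assoc, theta_lawMap P Q hP,
    Functor.map_comp_assoc, ← reassoc_of% h1, reassoc_of% theta_assocInv Q.seq hP hQ V,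
    reassoc_of% theta_lawMap P Q hP Λ ((gammaFunctor Q.seq).obj V), ← reassoc_of% h2,
    reassoc_of% theta_assoc P.seq hQ hQ V, ← Functor.map_comp, theta_gammaMul Q hQ, ← h3]
  simp only [gammaNat_comp, Category.assoc]

theorem map_gammaUnit_lawMap (P Q : OperadData F) (hP : P.seq.IsReduced)
    (hQ : Q.seq.IsReduced) {Λ : Hom (comp Q.seq P.seq) (comp P.seq Q.seq)}
    (hΛ : IsOperadicDistributiveLaw P Q Λ) (V : ModuleCat.{u} F) :
    (gammaFunctor Q.seq).map (gammaUnit P V) ≫ lawMap P Q Λ V =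
    gammaUnit P ((gammaFunctor Q.seq).obj V) := by
  have h : Λ.comp (insertRightHom Q.seq P.seq P.one) = insertLeftHom P.seq Q.seq P.one :=
    Hom.ext_apply fun S _ x => hΛ.odl₂ S x
  rw [← insertRight_theta Q.seq P hP, Category.assoc, theta_lawMap P Q hP,
    ← insertLeft_theta P hQ, ← h, gammaNat_comp, Category.assoc]

theorem gammaUnit_lawMap (P Q : OperadData F) (hP : P.seq.IsReduced)
    (hQ : Q.seq.IsReduced) {Λ : Hom (comp Q.seq P.seq) (comp P.seq Q.seq)}
    (hΛ : IsOperadicDistributiveLaw P Q Λ) (V : ModuleCat.{u} F) :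
    gammaUnit Q ((gammaFunctor P.seq).obj V) ≫ lawMap P Q Λ V =
    (gammaFunctor P.seq).map (gammaUnit Q V) := by
  have h : Λ.comp (insertLeftHom Q.seq P.seq Q.one) = insertRightHom P.seq Q.seq Q.one :=
    Hom.ext_apply fun S _ x => hΛ.odl₄ S x
  rw [← insertLeft_theta Q hP, Category.assoc, theta_lawMap P Q hP,
    ← insertRight_theta P.seq Q hQ, ← h, gammaNat_comp, Category.assoc]

/-- The map `lawMap` is the image of `Λ` under the monoidal functor `Γ`, and the axioms are the images
of those of `Λ`. -/
theorem isDistributiveLaw_lawMap (P Q : OperadData F) (hP : P.seq.IsReduced)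
    (hQ : Q.seq.IsReduced) {Λ : Hom (comp Q.seq P.seq) (comp P.seq Q.seq)}
    (hΛ : IsOperadicDistributiveLaw P Q Λ)
    (mP : (gammaData P).IsMonad) (mQ : (gammaData Q).IsMonad) :
    IsDistributiveLaw mP.toMonad mQ.toMonad (lawMap P Q Λ) where
  naturality f := lawMap_naturality P Q hP hQ Λ f
  dl₁ V := map_gammaMul_lawMap P Q hP hQ hΛ V
  dl₂ V := map_gammaUnit_lawMap P Q hP hQ hΛ V
  dl₃ V := gammaMul_lawMap P Q hP hQ hΛ V
  dl₄ V := gammaUnit_lawMap P Q hP hQ hΛ V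

/-! ### The monad of the product operad -/

/-- The multiplication of the operad `P ∘ Q`. -/
def prodHom (P Q : OperadData F) (Λ : Hom (comp Q.seq P.seq) (comp P.seq Q.seq)) :
    Hom (comp (comp P.seq Q.seq) (comp P.seq Q.seq)) (comp P.seq Q.seq) :=
  (prodOperad P Q Λ).mul

/-- Under the identifications `Γ(P ∘ Q) ≅ Γ(P) Γ(Q)`, the multiplication of `P ∘ Q` becomes that of
the composite monad. -/
theorem theta_prodHom (P Q : OperadData F) (hP : P.seq.IsReduced) (hQ : Q.seq.IsReduced)
    (Λ : Hom (comp Q.seq P.seq) (comp P.seq Q.seq)) (V : ModuleCat.{u} F) :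
    gammaNat (prodHom P Q Λ) V ≫ theta P.seq Q.seq V =
      theta (comp P.seq Q.seq) (comp P.seq Q.seq) V ≫
        (gammaFunctor (comp P.seq Q.seq)).map (theta P.seq Q.seq V) ≫
          theta P.seq Q.seq ((gammaFunctor P.seq).obj ((gammaFunctor Q.seq).obj V)) ≫
            (gammaFunctor P.seq).map (lawMap P Q Λ ((gammaFunctor Q.seq).obj V)) ≫
              gammaMul P ((gammaFunctor Q.seq).obj ((gammaFunctor Q.seq).obj V)) ≫
                (gammaFunctor P.seq).map (gammaMul Q V) := by
  have hPQ := hP.comp hQ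
  have h1 := theta_gammaNat_right P.seq (hQ.comp hP) hPQ Λ ((gammaFunctor Q.seq).obj V)
  have h2 : ∀ {M N : SymSeq F} (φ : Hom M N), gammaNat (compMap φ (Hom.id Q.seq)) V ≫
      theta N Q.seq V = theta M Q.seq V ≫ gammaNat φ ((gammaFunctor Q.seq).obj V) :=
    fun φ => theta_gammaNat_left hQ φ V
  have h3 := theta_gammaNat (hQ.comp hQ) hQ P.mul Q.mul V
  rw [reassoc_of% theta_assocInv (comp P.seq Q.seq) hP hQ V,
    reassoc_of% theta_assoc P.seq hQ hP ((gammaFunctor Q.seq).obj V), ← Functor.map_comp_assoc,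
    theta_lawMap P Q hP, Functor.map_comp_assoc, ← reassoc_of% h1,
    reassoc_of% theta_assocInv P.seq hP hQ ((gammaFunctor Q.seq).obj V),
    reassoc_of% theta_gammaMul P hP
      ((gammaFunctor Q.seq).obj ((gammaFunctor Q.seq).obj V)), ← gammaNat_naturality,
    ← reassoc_of% h2, ← reassoc_of% h2, ← reassoc_of% h2,
    reassoc_of% theta_assoc (comp P.seq P.seq) hQ hQ V, ← Functor.map_comp_assoc,
    theta_gammaMul Q hQ, ← h3]
  simp only [prodHom, prodOperad, gammaNat_comp, Category.assoc]

/-- The multiplication of `Γ(P ∘ Q)`. -/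
def prodMul (P Q : OperadData F) (Λ : Hom (comp Q.seq P.seq) (comp P.seq Q.seq))
    (V : ModuleCat.{u} F) :
    (gammaFunctor (comp P.seq Q.seq)).obj ((gammaFunctor (comp P.seq Q.seq)).obj V) ⟶
      (gammaFunctor (comp P.seq Q.seq)).obj V :=
  gammaMul (prodOperad P Q Λ) V

/-- The unit of `Γ(P ∘ Q)`. -/
def prodUnit (P Q : OperadData F) (Λ : Hom (comp Q.seq P.seq) (comp P.seq Q.seq))
    (V : ModuleCat.{u} F) : V ⟶ (gammaFunctor (comp P.seq Q.seq)).obj V :=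
  gammaUnit (prodOperad P Q Λ) V

theorem theta_prodMul (P Q : OperadData F) (hP : P.seq.IsReduced)
    (hQ : Q.seq.IsReduced) (Λ : Hom (comp Q.seq P.seq) (comp P.seq Q.seq)) (V : ModuleCat.{u} F) :
    theta (comp P.seq Q.seq) (comp P.seq Q.seq) V ≫ prodMul P Q Λ V =
      gammaNat (prodHom P Q Λ) V :=
  theta_gammaMul (prodOperad P Q Λ) (hP.comp hQ) V

theorem gammaMul_mk (X : SymSeq F) (one : X.obj Unit) (mul : Hom (comp X X) X)
    (V : ModuleCat.{u} F) : gammaMul ⟨X, one, mul⟩ V =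
      dassoc X X V ≫ gammaNat (traceInv X X) V ≫ gammaNat mul V := rfl

theorem prodMul_eq (P Q : OperadData F) (Λ : Hom (comp Q.seq P.seq) (comp P.seq Q.seq))
    (V : ModuleCat.{u} F) : prodMul P Q Λ V = dassoc (comp P.seq Q.seq) (comp P.seq Q.seq) V ≫
      gammaNat (traceInv (comp P.seq Q.seq) (comp P.seq Q.seq)) V ≫
        gammaNat (prodHom P Q Λ) V :=
  gammaMul_mk (comp P.seq Q.seq) (prodOperad P Q Λ).one (prodHom P Q Λ) V

/-- The multiplication of the composite of `Γ(P)` and `Γ(Q)`, exchanging the factors by `Λ`. -/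
def compositeMul (P Q : OperadData F) (Λ : Hom (comp Q.seq P.seq) (comp P.seq Q.seq))
    (V : ModuleCat.{u} F) :
    (gammaFunctor P.seq).obj ((gammaFunctor Q.seq).obj ((gammaFunctor P.seq).obj
      ((gammaFunctor Q.seq).obj V))) ⟶ (gammaFunctor P.seq).obj ((gammaFunctor Q.seq).obj V) :=
  (gammaFunctor P.seq).map (lawMap P Q Λ ((gammaFunctor Q.seq).obj V)) ≫
    gammaMul P ((gammaFunctor Q.seq).obj ((gammaFunctor Q.seq).obj V)) ≫
      (gammaFunctor P.seq).map (gammaMul Q V)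

theorem prodMul_theta (P Q : OperadData F) (hP : P.seq.IsReduced)
    (hQ : Q.seq.IsReduced) (Λ : Hom (comp Q.seq P.seq) (comp P.seq Q.seq)) (V : ModuleCat.{u} F) :
    prodMul P Q Λ V ≫ theta P.seq Q.seq V =
      (gammaFunctor (comp P.seq Q.seq)).map (theta P.seq Q.seq V) ≫
        theta P.seq Q.seq ((gammaFunctor P.seq).obj ((gammaFunctor Q.seq).obj V)) ≫
          compositeMul P Q Λ V := by
  have := isIso_theta (comp P.seq Q.seq) (hP.comp hQ) V
  rw [← cancel_epi (theta (comp P.seq Q.seq) (comp P.seq Q.seq) V), ← Category.assoc,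
    theta_prodMul P Q hP hQ]
  exact theta_prodHom P Q hP hQ Λ V

theorem prodUnit_theta (P Q : OperadData F) (hQ : Q.seq.IsReduced)
    (Λ : Hom (comp Q.seq P.seq) (comp P.seq Q.seq)) (V : ModuleCat.{u} F) :
    prodUnit P Q Λ V ≫ theta P.seq Q.seq V =
      gammaUnit Q V ≫ gammaUnit P ((gammaFunctor Q.seq).obj V) := by
  have h : gammaUnit P V ≫ gammaNat (insertRightHom P.seq Q.seq Q.one) V = prodUnit P Q Λ V :=
    gammaUnit_gammaNat (P := P) (R := prodOperad P Q Λ)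
      (insertRightHom P.seq Q.seq Q.one) rfl V
  rw [gammaUnit_naturality, ← insertRight_theta P.seq Q hQ, ← Category.assoc, h]

/-- The map `Λ̃` is the one which corresponds to `Λ`. -/
theorem gammaLaw_eq_lawMap (P Q : OperadData F) (hP : P.seq.IsReduced) (hQ : Q.seq.IsReduced)
    (Λ : Hom (comp Q.seq P.seq) (comp P.seq Q.seq))
    (mP : (gammaData P).IsMonad) (mQ : (gammaData Q).IsMonad) :
    gammaLaw P Q Λ = lawMap P Q Λ := by
  funext V
  have hPQ := hP.comp hQ
  have hD : (dcomp P.seq Q.seq).IsReduced := hPQ.of_isIsoHom (isIsoHom_trace P.seq hQ)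
  have hT : (traceInv P.seq Q.seq).comp (trace P.seq Q.seq) = Hom.id _ :=
    homInv_comp (isIsoHom_trace P.seq hQ)
  have hd : ∀ W, dassoc P.seq Q.seq W ≫ gammaNat (traceInv P.seq Q.seq) W ≫ theta P.seq Q.seq W =
      𝟙 _ := fun W => by
    have := isIso_theta P.seq hQ W
    rw [← cancel_epi (theta P.seq Q.seq W), ← Category.assoc, theta_dassoc P.seq hQ,
      ← Category.assoc, ← gammaNat_comp, hT, gammaNat_id, Category.id_comp, Category.comp_id]
  -- the composite of the associators, the trace maps and the multiplication of `P ∘ Q` is the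
  -- multiplication of the composite monad
  have key : dassoc P.seq Q.seq ((gammaFunctor P.seq).obj ((gammaFunctor Q.seq).obj V)) ≫
      (gammaFunctor (dcomp P.seq Q.seq)).map (dassoc P.seq Q.seq V) ≫
      dassoc (dcomp P.seq Q.seq) (dcomp P.seq Q.seq) V ≫
      gammaNat (dcompMap (traceInv P.seq Q.seq) (traceInv P.seq Q.seq)) V ≫
      gammaNat (traceInv (comp P.seq Q.seq) (comp P.seq Q.seq)) V ≫
      gammaNat (prodHom P Q Λ) V ≫ theta P.seq Q.seq V = compositeMul P Q Λ V := by
    rw [reassoc_of% dassoc_dcompMap hD hPQ (traceInv P.seq Q.seq) (traceInv P.seq Q.seq) V]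
    have h1 : dassoc (comp P.seq Q.seq) (comp P.seq Q.seq) V ≫
        gammaNat (traceInv (comp P.seq Q.seq) (comp P.seq Q.seq)) V ≫
          gammaNat (prodHom P Q Λ) V ≫ theta P.seq Q.seq V =
        (gammaFunctor (comp P.seq Q.seq)).map (theta P.seq Q.seq V) ≫
          theta P.seq Q.seq ((gammaFunctor P.seq).obj ((gammaFunctor Q.seq).obj V)) ≫
            compositeMul P Q Λ V := by
      rw [← prodMul_theta P Q hP hQ, prodMul_eq]
      simp only [Category.assoc]
    rw [h1, ← reassoc_of% gammaNat_naturality (traceInv P.seq Q.seq) (theta P.seq Q.seq V),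
      ← Functor.map_comp_assoc, ← Functor.map_comp_assoc, Category.assoc, hd,
      CategoryTheory.Functor.map_id, Category.id_comp, reassoc_of% hd]
  have h2 : gammaLaw P Q Λ V = (gammaFunctor Q.seq).map ((gammaFunctor P.seq).map (gammaUnit Q V)) ≫
      gammaUnit P _ ≫ compositeMul P Q Λ V := by
    rw [← key, gammaLaw, theta]
    rfl
  have hu : (gammaFunctor Q.seq).map (gammaUnit Q V) ≫ gammaMul Q V = 𝟙 _ := mQ.right_unit V
  have hu' : ∀ W, gammaUnit P ((gammaFunctor P.seq).obj W) ≫ gammaMul P W = 𝟙 _ := mP.left_unit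
  rw [h2, compositeMul, ← reassoc_of% gammaUnit_naturality P
    (lawMap P Q Λ ((gammaFunctor Q.seq).obj V)), reassoc_of% hu',
    reassoc_of% lawMap_naturality P Q hP hQ Λ (gammaUnit Q V), ← Functor.map_comp, hu,
    CategoryTheory.Functor.map_id, Category.comp_id]

/-! ### Algebras over the monad of a distributive law -/

section beck

variable {C : Type*} [Category C]

/-- The restriction of a structure of algebra along a morphism of monads. -/
def AlgStr.restrict {S T : Monad C} (f : S ⟶ T) {A : C} (c : AlgStr T A) : AlgStr S A where
  str := f.app A ≫ c.str
  unit := by rw [← Category.assoc, f.app_η, c.unit]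
  assoc := by
    rw [← Category.assoc, f.app_μ, Category.assoc, c.assoc, S.map_comp, Category.assoc,
      Category.assoc, ← f.naturality_assoc c.str c.str]

theorem AlgStr.restrict_str {S T : Monad C} (f : S ⟶ T) {A : C} (c : AlgStr T A) :
    (c.restrict f).str = f.app A ≫ c.str := rfl

/-- Isomorphic monads have the same structures of algebra. -/
def AlgStr.equivOfIso {S T : Monad C} (e : S ≅ T) (A : C) : AlgStr S A ≃ AlgStr T A where
  toFun c := c.restrict e.inv
  invFun c := c.restrict e.hom
  left_inv c := AlgStr.ext (by
    have h : e.hom.app A ≫ e.inv.app A = 𝟙 _ :=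
      congrArg (fun f : S ⟶ S => f.app A) e.hom_inv_id
    rw [restrict_str, restrict_str, ← Category.assoc, h, Category.id_comp])
  right_inv c := AlgStr.ext (by
    have h : e.inv.app A ≫ e.hom.app A = 𝟙 _ :=
      congrArg (fun f : T ⟶ T => f.app A) e.inv_hom_id
    rw [restrict_str, restrict_str, ← Category.assoc, h, Category.id_comp])

theorem IsAlgHom.restrict {S T : Monad C} (f : S ⟶ T) {A B : C} {a : AlgStr T A} {b : AlgStr T B}
    {g : A ⟶ B} (h : IsAlgHom a b g) : IsAlgHom (a.restrict f) (b.restrict f) g := by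
  have h1 : T.map g ≫ b.str = a.str ≫ g := h
  change S.map g ≫ f.app B ≫ b.str = (f.app A ≫ a.str) ≫ g
  rw [f.naturality_assoc, h1, Category.assoc]

theorem isAlgHom_equivOfIso {S T : Monad C} (e : S ≅ T) {A B : C} {a : AlgStr S A}
    {b : AlgStr S B} {g : A ⟶ B} :
    IsAlgHom (AlgStr.equivOfIso e A a) (AlgStr.equivOfIso e B b) g ↔ IsAlgHom a b g := by
  refine ⟨fun h => ?_, fun h => h.restrict e.inv⟩
  have h1 := h.restrict e.hom
  have ha : (AlgStr.equivOfIso e A a).restrict e.hom = a := (AlgStr.equivOfIso e A).left_inv a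
  have hb : (AlgStr.equivOfIso e B b).restrict e.hom = b := (AlgStr.equivOfIso e B).left_inv b
  rwa [ha, hb] at h1

variable {S T : Monad C} {A : C} {Λ : ∀ X : C, T.obj (S.obj X) ⟶ S.obj (T.obj X)}

/-- For an associative `s : S T A → A`, the restriction of `s` to `S A` along the unit of `T` is
compatible with `s` itself. -/
theorem IsDistributiveLaw.map_str_left (h : IsDistributiveLaw S T Λ) {A : C}
    {s : S.obj (T.obj A) ⟶ A} (hs : S.map (T.map s) ≫ s =
      S.map (Λ (T.obj A)) ≫ S.μ.app (T.obj (T.obj A)) ≫ S.map (T.μ.app A) ≫ s) :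
    S.map s ≫ S.map (T.η.app A) ≫ s = S.μ.app (T.obj A) ≫ s := by
  have h1 : S.map (T.η.app (T.obj A)) ≫ S.map (T.μ.app A) = 𝟙 _ := by
    rw [← S.map_comp, T.left_unit]
    exact S.map_id _
  rw [← S.map_comp_assoc, T.unit_naturality, S.map_comp_assoc, hs,
    ← S.map_comp_assoc, h.dl₄, S.mu_naturality_assoc, reassoc_of% h1]
  rfl

theorem map_str_right_of_assoc {A : C}
    {s : S.obj (T.obj A) ⟶ A} (hs : S.map (T.map s) ≫ s =
      S.map (Λ (T.obj A)) ≫ S.μ.app (T.obj (T.obj A)) ≫ S.map (T.μ.app A) ≫ s) :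
    T.map s ≫ S.η.app (T.obj A) ≫ s = Λ (T.obj A) ≫ S.map (T.μ.app A) ≫ s := by
  rw [S.unit_naturality_assoc, hs, ← S.unit_naturality_assoc, S.left_unit_assoc]

/-- An algebra over the composite monad is recovered from its two restrictions. -/
theorem IsDistributiveLaw.map_right_left (h : IsDistributiveLaw S T Λ) {A : C}
    {s : S.obj (T.obj A) ⟶ A} (hs : S.map (T.map s) ≫ s =
      S.map (Λ (T.obj A)) ≫ S.μ.app (T.obj (T.obj A)) ≫ S.map (T.μ.app A) ≫ s) :
    S.map (S.η.app (T.obj A) ≫ s) ≫ S.map (T.η.app A) ≫ s = s := by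
  rw [S.map_comp, Category.assoc, h.map_str_left hs]
  exact S.right_unit_assoc (T.obj A) s

/-- The two structures of algebra defined by an algebra `s` over the composite monad. -/
def IsDistributiveLaw.compatStr (h : IsDistributiveLaw S T Λ) {A : C} (s : S.obj (T.obj A) ⟶ A)
    (hu : T.η.app A ≫ S.η.app (T.obj A) ≫ s = 𝟙 A) (hs : S.map (T.map s) ≫ s =
      S.map (Λ (T.obj A)) ≫ S.μ.app (T.obj (T.obj A)) ≫ S.map (T.μ.app A) ≫ s) :
    CompatStr S T Λ A where
  left :=
    { str := S.map (T.η.app A) ≫ s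
      unit := (CategoryTheory.Monad.unit_naturality_assoc C S (T.η.app A) s).symm.trans hu
      assoc := by
        rw [S.map_comp, Category.assoc, h.map_str_left hs, S.mu_naturality_assoc] }
  right :=
    { str := S.η.app (T.obj A) ≫ s
      unit := hu
      assoc := by
        rw [T.map_comp, Category.assoc, map_str_right_of_assoc hs, reassoc_of% h.dl₂,
          ← S.unit_naturality_assoc] }
  compat := by
    have h1 : S.map (T.map (T.η.app A)) ≫ S.map (T.μ.app A) = 𝟙 _ := by
      rw [← S.map_comp, T.right_unit]
      exact S.map_id _
    change T.map (S.map (T.η.app A) ≫ s) ≫ S.η.app (T.obj A) ≫ s =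
      Λ A ≫ S.map (S.η.app (T.obj A) ≫ s) ≫ S.map (T.η.app A) ≫ s
    rw [T.map_comp, Category.assoc, map_str_right_of_assoc hs, reassoc_of% h.naturality,
      reassoc_of% h1, h.map_right_left hs]
    rfl

theorem CompatStr.unit (s : CompatStr S T Λ A) :
    T.η.app A ≫ S.η.app (T.obj A) ≫ S.map s.right.str ≫ s.left.str = 𝟙 A := by
  have h1 := CategoryTheory.Monad.unit_naturality_assoc C S s.right.str s.left.str
  rw [← h1, s.left.unit]
  exact (congrArg (T.η.app A ≫ ·) (Category.comp_id _)).trans s.right.unit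

theorem CompatStr.assoc (h : IsDistributiveLaw S T Λ) (s : CompatStr S T Λ A) :
    S.map (Λ (T.obj A)) ≫ S.μ.app (T.obj (T.obj A)) ≫ S.map (T.μ.app A) ≫
      S.map s.right.str ≫ s.left.str =
        S.map (T.map (S.map s.right.str ≫ s.left.str)) ≫ S.map s.right.str ≫ s.left.str := by
  have h1 : T.map (S.map s.right.str ≫ s.left.str) ≫ s.right.str =
      Λ (T.obj A) ≫ S.map (T.map s.right.str) ≫ S.map s.right.str ≫ s.left.str := by
    rw [T.map_comp, Category.assoc, s.compat, reassoc_of% h.naturality s.right.str]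
  rw [← S.map_comp_assoc (T.map _), h1, ← S.map_comp_assoc (T.μ.app A), s.right.assoc,
    ← S.mu_naturality_assoc, s.left.assoc]
  simp only [S.map_comp, Category.assoc]

theorem CompatStr.ext_str {s t : CompatStr S T Λ A} (h₁ : s.left.str = t.left.str)
    (h₂ : s.right.str = t.right.str) : s = t := by
  obtain ⟨a, b, hs⟩ := s
  obtain ⟨a', b', ht⟩ := t
  obtain rfl : a = a' := AlgStr.ext h₁
  obtain rfl : b = b' := AlgStr.ext h₂
  rfl

/-- The structure map of an algebra over the composite monad. -/
def AlgStr.compositeStr {h : IsDistributiveLaw S T Λ} (c : AlgStr h.monad A) :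
    S.obj (T.obj A) ⟶ A := c.str

theorem AlgStr.compositeStr_unit {h : IsDistributiveLaw S T Λ} (c : AlgStr h.monad A) :
    T.η.app A ≫ S.η.app (T.obj A) ≫ c.compositeStr = 𝟙 A :=
  (Category.assoc _ _ _).symm.trans c.unit

theorem AlgStr.compositeStr_assoc {h : IsDistributiveLaw S T Λ} (c : AlgStr h.monad A) :
    S.map (T.map c.compositeStr) ≫ c.compositeStr = S.map (Λ (T.obj A)) ≫
      S.μ.app (T.obj (T.obj A)) ≫ S.map (T.μ.app A) ≫ c.compositeStr := by
  have h1 : (S.map (Λ (T.obj A)) ≫ S.μ.app (T.obj (T.obj A)) ≫ S.map (T.μ.app A)) ≫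
      c.compositeStr = S.map (T.map c.compositeStr) ≫ c.compositeStr := c.assoc
  rw [← h1, Category.assoc, Category.assoc]

/-- Algebras over the composite monad of a distributive law are compatible pairs of structures. -/
def AlgStr.compatEquiv (h : IsDistributiveLaw S T Λ) (A : C) :
    AlgStr h.monad A ≃ CompatStr S T Λ A where
  toFun c := h.compatStr c.compositeStr c.compositeStr_unit c.compositeStr_assoc
  invFun s :=
    { str := S.map s.right.str ≫ s.left.str
      unit := (Category.assoc _ _ _).trans s.unit
      assoc := by
        refine Eq.trans ?_ (s.assoc h)
        change (S.map (Λ (T.obj A)) ≫ S.μ.app (T.obj (T.obj A)) ≫ S.map (T.μ.app A)) ≫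
          S.map s.right.str ≫ s.left.str = _
        rw [Category.assoc, Category.assoc] }
  left_inv c := AlgStr.ext (h.map_right_left c.compositeStr_assoc)
  right_inv s := by
    have h1 : S.map (T.η.app A) ≫ S.map s.right.str = 𝟙 _ := by
      rw [← S.map_comp, s.right.unit]
      exact S.map_id _
    refine CompatStr.ext_str ?_ ?_
    · change S.map (T.η.app A) ≫ S.map s.right.str ≫ s.left.str = s.left.str
      rw [reassoc_of% h1]
    · change S.η.app (T.obj A) ≫ S.map s.right.str ≫ s.left.str = s.right.str
      have h2 := CategoryTheory.Monad.unit_naturality_assoc C S s.right.str s.left.str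
      rw [← h2, s.left.unit]
      exact Category.comp_id _

theorem isAlgHom_compatEquiv (h : IsDistributiveLaw S T Λ) {A B : C} (a : AlgStr h.monad A)
    (b : AlgStr h.monad B) (g : A ⟶ B) : IsAlgHom a b g ↔
      IsAlgHom (AlgStr.compatEquiv h A a).left (AlgStr.compatEquiv h B b).left g ∧
        IsAlgHom (AlgStr.compatEquiv h A a).right (AlgStr.compatEquiv h B b).right g := by
  change S.map (T.map g) ≫ b.compositeStr = a.compositeStr ≫ g ↔
    S.map g ≫ S.map (T.η.app B) ≫ b.compositeStr = (S.map (T.η.app A) ≫ a.compositeStr) ≫ g ∧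
      T.map g ≫ S.η.app (T.obj B) ≫ b.compositeStr = (S.η.app (T.obj A) ≫ a.compositeStr) ≫ g
  have ha := h.map_right_left a.compositeStr_assoc
  have hb := h.map_right_left b.compositeStr_assoc
  constructor
  · intro hg
    constructor
    · rw [← S.map_comp_assoc, T.unit_naturality, S.map_comp_assoc, hg, Category.assoc]
    · rw [S.unit_naturality_assoc, hg, Category.assoc]
  · rintro ⟨h1, h2⟩
    rw [← ha, ← hb, ← S.map_comp_assoc, h2, S.map_comp_assoc, h1]
    simp only [Category.assoc]

/-- Endofunctors with a unit and a multiplication inherit the axioms of a monad along an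
isomorphism. -/
theorem MonadData.isMonad_of_iso {D : MonadData C} {M : Monad C} (e : D.T ≅ M.toFunctor)
    (hη : ∀ X, D.η X ≫ e.hom.app X = M.η.app X)
    (hμ : ∀ X, D.μ X ≫ e.hom.app X =
      D.T.map (e.hom.app X) ≫ e.hom.app (M.obj X) ≫ M.μ.app X) : D.IsMonad := by
  have hμn : ∀ {X Y : C} (f : X ⟶ Y), D.T.map (D.T.map f) ≫ D.μ Y = D.μ X ≫ D.T.map f :=
    fun {X Y} f => by
      rw [← cancel_mono (e.hom.app Y), Category.assoc, Category.assoc, hμ, e.hom.naturality,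
        reassoc_of% hμ X, ← D.T.map_comp_assoc, e.hom.naturality, D.T.map_comp_assoc,
        e.hom.naturality_assoc]
      congr 2
      exact CategoryTheory.Monad.mu_naturality C M f
  have hηn : ∀ {X Y : C} (f : X ⟶ Y), f ≫ D.η Y = D.η X ≫ D.T.map f := fun {X Y} f => by
    rw [← cancel_mono (e.hom.app Y), Category.assoc, Category.assoc, hη, e.hom.naturality,
      reassoc_of% hη X]
    exact CategoryTheory.Monad.unit_naturality C M f
  refine ⟨hηn, hμn, fun X => ?_, fun X => ?_, fun X => ?_⟩
  · rw [← cancel_mono (e.hom.app X), Category.assoc, Category.assoc, hμ,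
      ← reassoc_of% hμn (e.hom.app X), reassoc_of% hμ (M.obj X), ← D.T.map_comp_assoc, hμ,
      D.T.map_comp_assoc, D.T.map_comp_assoc, e.hom.naturality_assoc]
    congr 3
    exact M.assoc X
  · rw [← cancel_mono (e.hom.app X), Category.assoc, hμ, ← reassoc_of% hηn (e.hom.app X),
      reassoc_of% hη (M.obj X), Category.id_comp]
    exact (congrArg (e.hom.app X ≫ ·) (M.left_unit X)).trans (Category.comp_id _)
  · rw [← cancel_mono (e.hom.app X), Category.assoc, hμ, ← D.T.map_comp_assoc, hη,
      e.hom.naturality_assoc, Category.id_comp]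
    exact (congrArg (e.hom.app X ≫ ·) (M.right_unit X)).trans (Category.comp_id _)

end beck

/-! ### Divided power algebras over the product operad -/

/-- The isomorphism `Γ(P ∘ Q) ≅ Γ(P) Γ(Q)` of functors. -/
def thetaIso (P Q : OperadData F) (hQ : Q.seq.IsReduced) :
    gammaFunctor (comp P.seq Q.seq) ≅ gammaFunctor Q.seq ⋙ gammaFunctor P.seq :=
  have := isIso_theta P.seq hQ
  NatIso.ofComponents (fun V => asIso (theta P.seq Q.seq V)) fun v => theta_naturality P.seq hQ v

/-- The structure of `Γ(P ∘ Q)` is isomorphic to that of the composite monad, hence a monad. -/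
theorem isMonad_prodOperad (P Q : OperadData F) (hP : P.seq.IsReduced) (hQ : Q.seq.IsReduced)
    (Λ : Hom (comp Q.seq P.seq) (comp P.seq Q.seq)) (hΛ : IsOperadicDistributiveLaw P Q Λ)
    (mP : (gammaData P).IsMonad) (mQ : (gammaData Q).IsMonad) :
    (gammaData (prodOperad P Q Λ)).IsMonad :=
  MonadData.isMonad_of_iso (D := gammaData (prodOperad P Q Λ))
    (M := (isDistributiveLaw_lawMap P Q hP hQ hΛ mP mQ).monad) (thetaIso P Q hQ)
    (fun V => prodUnit_theta P Q hQ Λ V) (fun V => prodMul_theta P Q hP hQ Λ V)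

theorem exists_monadIso (P Q : OperadData F) (hP : P.seq.IsReduced) (hQ : Q.seq.IsReduced)
    (Λ : Hom (comp Q.seq P.seq) (comp P.seq Q.seq))
    (mP : (gammaData P).IsMonad) (mQ : (gammaData Q).IsMonad)
    (mPQ : (gammaData (prodOperad P Q Λ)).IsMonad)
    (dl : IsDistributiveLaw mP.toMonad mQ.toMonad (lawMap P Q Λ)) :
    ∃ Θ : mPQ.toMonad ≅ dl.monad, ∀ V, Θ.hom.toNatTrans.app V = gammaProdHom P Q V := by
  refine ⟨MonadIso.mk (thetaIso P Q hQ) (fun V => prodUnit_theta P Q hQ Λ V) (fun V => ?_),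
    fun V => rfl⟩
  exact (prodMul_theta P Q hP hQ Λ V).trans (Category.assoc _ _ _).symm

end DivPow

end

/-- Divided power algebras over an operad `P ∘ Q` obtained from a distributive law. -/
theorem proposition6p1 {F : Type u} [Field F] (P Q : DivPow.Operad F)
    (hP : P.seq.IsReduced) (hQ : Q.seq.IsReduced)
    (Λ : DivPow.SymSeq.Hom (DivPow.SymSeq.comp Q.seq P.seq) (DivPow.SymSeq.comp P.seq Q.seq))
    (hΛ : DivPow.IsOperadicDistributiveLaw P.toOperadData Q.toOperadData Λ) :
    -- the canonical maps whose inverses are used are isomorphisms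
    ((∀ M N L : DivPow.SymSeq F, M.IsReduced → N.IsReduced → L.IsReduced →
        DivPow.IsIsoHom (DivPow.SymSeq.assoc M N L)) ∧
      (∀ M N : DivPow.SymSeq F, M.IsReduced → N.IsReduced →
        DivPow.IsIsoHom (DivPow.SymSeq.trace M N)) ∧
      ∀ (M N : DivPow.SymSeq F) (V : ModuleCat.{u} F), M.IsReduced → N.IsReduced →
        (∀ x, DivPow.SymSeq.compositeIncl M N V (DivPow.SymSeq.dassoc M N V x) =
          DivPow.SymSeq.nestedIncl M N V x) ∧
        Function.Injective (DivPow.SymSeq.compositeIncl M N V) ∧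
        Function.LeftInverse (DivPow.SymSeq.dassocInv M N V) (DivPow.SymSeq.dassoc M N V) ∧
        Function.RightInverse (DivPow.SymSeq.dassocInv M N V) (DivPow.SymSeq.dassoc M N V)) ∧
    -- `P ∘ Q` is a reduced operad; `Γ(P)`, `Γ(Q)` and `Γ(P ∘ Q)` are monads
    (DivPow.prodOperad P.toOperadData Q.toOperadData Λ).seq.IsReduced ∧
    (DivPow.prodOperad P.toOperadData Q.toOperadData Λ).IsOperad ∧
    ∃ (mP : (DivPow.gammaData P.toOperadData).IsMonad)
      (mQ : (DivPow.gammaData Q.toOperadData).IsMonad)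
      (mPQ : (DivPow.gammaData (DivPow.prodOperad P.toOperadData Q.toOperadData Λ)).IsMonad)
      -- `Λ̃` is a distributive law of monads
      (dl : DivPow.IsDistributiveLaw mP.toMonad mQ.toMonad
        (DivPow.gammaLaw P.toOperadData Q.toOperadData Λ))
      -- `Γ(P ∘ Q)` is isomorphic to the monad `Γ(P) ∘ Γ(Q)` defined by `Λ̃`
      (Θ : mPQ.toMonad ≅ dl.monad),
      (∀ V : ModuleCat.{u} F,
        Θ.hom.toNatTrans.app V = DivPow.gammaProdHom P.toOperadData Q.toOperadData V) ∧
      -- structures of `Γ(P ∘ Q)`-algebra are the compatible pairs of structures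
      ∃ e : ∀ A : ModuleCat.{u} F, DivPow.AlgStr mPQ.toMonad A ≃
          DivPow.CompatStr mP.toMonad mQ.toMonad
            (DivPow.gammaLaw P.toOperadData Q.toOperadData Λ) A,
        (∀ (A : ModuleCat.{u} F) (c : DivPow.AlgStr mPQ.toMonad A),
          (e A c).left.str =
            mP.toMonad.map (mQ.toMonad.η.app A) ≫ Θ.inv.toNatTrans.app A ≫ c.str ∧
          (e A c).right.str =
            mP.toMonad.η.app (mQ.toMonad.obj A) ≫ Θ.inv.toNatTrans.app A ≫ c.str) ∧
        (∀ (A : ModuleCat.{u} F) (s : DivPow.CompatStr mP.toMonad mQ.toMonad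
            (DivPow.gammaLaw P.toOperadData Q.toOperadData Λ) A),
          ((e A).symm s).str =
            Θ.hom.toNatTrans.app A ≫ mP.toMonad.map s.right.str ≫ s.left.str) ∧
        ∀ (A B : ModuleCat.{u} F) (a : DivPow.AlgStr mPQ.toMonad A)
          (b : DivPow.AlgStr mPQ.toMonad B) (g : A ⟶ B),
          DivPow.IsAlgHom a b g ↔
            DivPow.IsAlgHom (e A a).left (e B b).left g ∧
              DivPow.IsAlgHom (e A a).right (e B b).right g := by
  have hPQ : (DivPow.prodOperad P.toOperadData Q.toOperadData Λ).seq.IsReduced := hP.comp hQ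
  have mP := (DivPow.isOperad_iff_isMonad P.toOperadData hP).1 P.isOperad
  have mQ := (DivPow.isOperad_iff_isMonad Q.toOperadData hQ).1 Q.isOperad
  have mPQ := DivPow.isMonad_prodOperad P.toOperadData Q.toOperadData hP hQ Λ hΛ mP mQ
  have dl := DivPow.isDistributiveLaw_lawMap P.toOperadData Q.toOperadData hP hQ hΛ mP mQ
  obtain ⟨Θ, hΘ⟩ := DivPow.exists_monadIso P.toOperadData Q.toOperadData hP hQ Λ mP mQ mPQ dl
  rw [DivPow.gammaLaw_eq_lawMap P.toOperadData Q.toOperadData hP hQ Λ mP mQ]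
  refine ⟨⟨fun M N L _ hN hL => DivPow.SymSeq.isIsoHom_assoc M hN hL,
    fun M N _ hN => DivPow.SymSeq.isIsoHom_trace M hN,
    fun M N V _ hN => ⟨DivPow.SymSeq.compositeIncl_dassocMap M hN V,
      DivPow.SymSeq.injective_compositeIncl M hN V,
      DivPow.SymSeq.dassocInvMap_dassocMap M hN V,
      DivPow.SymSeq.dassocMap_dassocInvMap M hN V⟩⟩, hPQ,
    (DivPow.isOperad_iff_isMonad _ hPQ).2 mPQ, mP, mQ, mPQ, dl, Θ, hΘ,
    fun A => (DivPow.AlgStr.equivOfIso Θ A).trans (DivPow.AlgStr.compatEquiv dl A),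
    fun A c => ⟨rfl, rfl⟩, fun A s => rfl, fun A B a b g => ?_⟩
  exact (DivPow.isAlgHom_equivOfIso Θ).symm.trans (DivPow.isAlgHom_compatEquiv dl _ _ g)
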